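/- **Setting.** Let $1\le d\le 6$ and $\alpha>0$. Let $f:\mathbb R\to\mathbb R$ be an odd $C^1$ function with $f'(0)=0$ such that, for some constants $C$, $\theta$, $\beta$ with $1<\theta$, $\theta<\frac{d+2}{d-2}$ if $d\ge 3$, and $0<\beta<\theta-1$, $$|f'(y)|\le C\max(|y|^\beta,|y|^{\theta-1}),\qquad |f'(y_1)-f'(y_2)|\le C\big(|y_1-y_2|^\beta+|y_1-y_2|^{\theta-1}\big)\qquad(y,y_1,y_2\in\mathbb R).$$ Let $\varphi_0\in H^1_{rad}(\mathbb R^d)$ be a real-valued radial solution (in the sense of distributions) of $-\Delta\varphi_0+\varphi_0-f(\varphi_0)=0$. In the complex space $L^2_{rad}(\mathbb R^d)$ of radial functions let $\mathcal L=-\Delta+1-f'(\varphi_0)$, and in $H^1_{rad}\times L^2_{rad}$ let $$A_\alpha=\begin{pmatrix}0&1\\-\mathcal L&-2\alpha\end{pmatrix},\qquad A_\alpha(u_1,u_2)=(u_2,\,-\mathcal L u_1-2\alpha u_2).$$ These operators are defined on all of $H^2_{rad}$ and $H^2_{rad}\times H^1_{rad}$ respectively. For a closed operator $T$, the spectrum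 $\sigma(T)$ is the complement of the set of $z$ for which $T-z$ has a bounded inverse; the discrete spectrum $\sigma_{disc}(T)$ is the set of isolated points $z$ of $\sigma(T)$ for which $T-z$ is Fredholm (equivalently, the isolated eigenvalues of finite algebraic multiplicity); and $\sigma_{ess}(T)=\sigma(T)\setminus\sigma_{disc}(T)$. An eigenvalue is simple if its algebraic multiplicity is one, that is, $\dim\ker(T-z)=1$ and $\ker(T-z)^2=\ker(T-z)$. **Lemma.** 1. $\sigma_{disc}(A_\alpha)\neq\emptyset$ if and only if $\sigma_{disc}(\mathcal L)\ne\emptyset$; more precisely, $z\in\sigma_{disc}(A_\alpha)$ if and only if $-(z^2+2\alpha z)\in\sigma_{disc}(\mathcal L)$. 2. There is $\delta(\alpha)>0$, depending only on $\alpha$, such that $\operatorname{Re}z<-\delta(\alpha)$ for all $z\in\sigma_{ess}(A_\alpha)$. 3. $\sigma(A_\alpha)\cap i\mathbb R$ is either empty or $\{0\}$. It is $\{0\}$ if and only if $0$ is an eigenvalue of $A_\alpha$, and if and only if $0$ is an eigenvalue of $\mathcal L$. In that case $\dim\ker\mathcal L=1$, and $0$ is a simple eigenvalue of $\mathcal L$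 and of $A_\alpha$. 4. The eigenvalues of $A_\alpha$ are precisely the numbers $-\alpha\pm\sqrt{\alpha^2-\mu}$, where $\mu\in\mathbb R$ is an eigenvalue of $\mathcal L$. - If $\alpha\ge1$, all points of $\sigma_{disc}(A_\alpha)$ and all eigenvalues of $A_\alpha$ are real. - If $0<\alpha<1$, every point of $\sigma_{disc}(A_\alpha)$ and every eigenvalue of $A_\alpha$ is either real, or lies on the line $\operatorname{Re}z=-\alpha$ and is of the form $-\alpha\pm\sqrt{\alpha^2-\mu}$ with an eigenvalue $\mu\in(0,1]$ of $\mathcal L$. 5. $z\in\sigma_{ess}(A_\alpha)$ if and only if $-(z^2+2\alpha z)\in\sigma_{ess}(\mathcal L)$. Explicitly: - if $0<\alpha\le1$, then $\sigma_{ess}(A_\alpha)=\{-\alpha\pm i b : b\in\mathbb R,\ b\ge\sqrt{1-\alpha^2}\}$; - if $\alpha>1$, then $\sigma_{ess}(A_\alpha)=\{\operatorname{Re}z=-\alpha\}\cup\big[-\alpha-\sqrt{\alpha^2-1},\,-\alpha+\sqrt{\alpha^2-1}\big]$. -/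

import Mathlib

open MeasureTheory Filter Topology
open scoped ENNReal ContDiff SchwartzMap LineDeriv Laplacian

noncomputable section

/-! ### Spectral theory of unbounded operators

For an operator `T` in a complex Banach space `H` (the definitions only use its topology), with domain `T.domain`. -/

namespace LinearPMap

variable {H : Type*} [AddCommGroup H] [Module ℂ H] [TopologicalSpace H]

/-- The operator `T - z`, as a linear map from the domain of `T` to `H`. -/
def subScalar (T : H →ₗ.[ℂ] H) (z : ℂ) : T.domain →ₗ[ℂ] H :=
  T.toFun - z • T.domain.subtype

/-- The resolvent set: `T - z` maps the domain bijectively onto `H`, and the inverse `R` is a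
bounded operator on `H`. -/
def resolventSet (T : H →ₗ.[ℂ] H) : Set ℂ :=
  {z | ∃ R : H →L[ℂ] H, ∀ x y : H, R y = x ↔ ∃ hx : x ∈ T.domain, T.subScalar z ⟨x, hx⟩ = y}

/-- The spectrum of `T`. -/
def opSpectrum (T : H →ₗ.[ℂ] H) : Set ℂ := (T.resolventSet)ᶜ

/-- The eigenspace `ker (T - z)`, as a subspace of `H`. -/
def eigenspace (T : H →ₗ.[ℂ] H) (z : ℂ) : Submodule ℂ H :=
  (LinearMap.ker (T.subScalar z)).map T.domain.subtype

/-- The set of eigenvalues of `T`. -/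
def pointSpectrum (T : H →ₗ.[ℂ] H) : Set ℂ := {z | T.eigenspace z ≠ ⊥}

/-- `z` is an eigenvalue of algebraic multiplicity one: the eigenspace is one-dimensional and
`ker (T - z)² = ker (T - z)`. -/
def IsSimpleEigenvalue (T : H →ₗ.[ℂ] H) (z : ℂ) : Prop :=
  Module.finrank ℂ (T.eigenspace z) = 1 ∧
    ∀ x : T.domain, T.subScalar z x ∈ T.eigenspace z → (x : H) ∈ T.eigenspace z

/-- `T - z` is a Fredholm operator: finite-dimensional kernel, closed range of finite
codimension. -/
def IsFredholmAt (T : H →ₗ.[ℂ] H) (z : ℂ) : Prop :=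
  FiniteDimensional ℂ (LinearMap.ker (T.subScalar z)) ∧
    _root_.IsClosed (LinearMap.range (T.subScalar z) : Set H) ∧
    FiniteDimensional ℂ (H ⧸ LinearMap.range (T.subScalar z))

/-- The discrete spectrum: the isolated points `z` of the spectrum at which `T - z` is Fredholm.
(For a closed operator an isolated point of the spectrum is of this kind if and only if it is an
eigenvalue of finite algebraic multiplicity in the sense that its Riesz projection has finite
rank.) -/
def discSpectrum (T : H →ₗ.[ℂ] H) : Set ℂ :=
  {z | z ∈ T.opSpectrum ∧ (∀ᶠ w in 𝓝[≠] z, w ∉ T.opSpectrum) ∧ T.IsFredholmAt z}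

/-- The essential spectrum: the part of the spectrum which is not discrete. -/
def essSpectrum (T : H →ₗ.[ℂ] H) : Set ℂ := T.opSpectrum \ T.discSpectrum

end LinearPMap

namespace KleinGordon

/-- The Euclidean space `ℝ^d`. -/
abbrev Space (d : ℕ) : Type := EuclideanSpace ℝ (Fin d)

/-- The complex Hilbert space `L²(ℝ^d)`. -/
abbrev L2 (d : ℕ) : Type := Lp ℂ 2 (volume : Measure (Space d))

/-- `L²_rad(ℝ^d)`: the functions `u ∈ L²` for which `u(x)` depends only on `|x|`. -/
def L2rad (d : ℕ) : Submodule ℂ (L2 d) where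
  carrier := {u | ∃ g : ℝ → ℂ, (u : Space d → ℂ) =ᵐ[volume] fun x => g ‖x‖}
  zero_mem' := ⟨0, Lp.coeFn_zero ℂ 2 volume⟩
  add_mem' := by
    rintro u v ⟨g, hg⟩ ⟨h, hh⟩
    refine ⟨g + h, (Lp.coeFn_add u v).trans ?_⟩
    filter_upwards [hg, hh] with x h1 h2
    simp [h1, h2]
  smul_mem' := by
    rintro c u ⟨g, hg⟩
    refine ⟨c • g, (Lp.coeFn_smul c u).trans ?_⟩
    filter_upwards [hg] with x h1
    simp [h1]

/-- An `L²` function as a tempered distribution. -/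
def toDist {d : ℕ} : L2 d →ₗ[ℂ] 𝓢'(Space d, ℂ) :=
  (Lp.toTemperedDistributionCLM ℂ (volume : Measure (Space d)) 2).toLinearMap

theorem toDist_injective {d : ℕ} : Function.Injective (toDist (d := d)) :=
  LinearMap.ker_eq_bot.mp (Lp.ker_toTemperedDistributionCLM_eq_bot (F := ℂ)
    (μ := (volume : Measure (Space d))) (p := 2))

theorem laplacian_zero (d : ℕ) : Δ (0 : 𝓢'(Space d, ℂ)) = 0 :=
  map_zero (LineDeriv.laplacianCLM ℝ (Space d) 𝓢'(Space d, ℂ))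

theorem laplacian_add {d : ℕ} (a b : 𝓢'(Space d, ℂ)) : Δ (a + b) = Δ a + Δ b :=
  map_add (LineDeriv.laplacianCLM ℝ (Space d) 𝓢'(Space d, ℂ)) a b

theorem laplacian_smul {d : ℕ} (c : ℂ) (a : 𝓢'(Space d, ℂ)) : Δ (c • a) = c • Δ a := by
  let b := stdOrthonormalBasis ℝ (Space d)
  rw [TemperedDistribution.laplacian_eq_sum b, TemperedDistribution.laplacian_eq_sum b,
    Finset.smul_sum]
  simp only [LineDeriv.lineDerivOp_smul]

/-- `H¹_rad(ℝ^d)`, realised as the space of the pairs `(u, ∇u)` with `u ∈ L²_rad` whose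
distributional partial derivatives are in `L²`. Its norm, inherited from the ambient Hilbert
space, is the `H¹` norm `(‖u‖² + ∑ᵢ ‖∂ᵢu‖²)^{1/2}`. -/
def H1rad (d : ℕ) : Submodule ℂ (WithLp 2 (L2 d × PiLp 2 (fun _ : Fin d => L2 d))) where
  carrier := {p | p.fst ∈ L2rad d ∧
    ∀ i, ∂_{EuclideanSpace.single i (1 : ℝ)} (toDist p.fst) = toDist (p.snd i)}
  zero_mem' := by
    refine ⟨(L2rad d).zero_mem, fun i => ?_⟩
    have h : ∂_{EuclideanSpace.single i (1 : ℝ)} (0 : 𝓢'(Space d, ℂ)) = 0 :=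
      map_zero (LineDeriv.lineDerivOpCLM ℂ 𝓢'(Space d, ℂ) (EuclideanSpace.single i (1 : ℝ)))
    simp [h]
  add_mem' := by
    rintro p q ⟨hp, hp'⟩ ⟨hq, hq'⟩
    refine ⟨(L2rad d).add_mem hp hq, fun i => ?_⟩
    simp only [WithLp.add_fst, WithLp.add_snd, PiLp.add_apply, map_add]
    rw [LineDeriv.lineDerivOp_add, hp', hq']
  smul_mem' := by
    rintro c p ⟨hp, hp'⟩
    refine ⟨(L2rad d).smul_mem c hp, fun i => ?_⟩
    simp only [WithLp.smul_fst, WithLp.smul_snd, PiLp.smul_apply, map_smul]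
    rw [LineDeriv.lineDerivOp_smul, hp']

/-- The inclusion of `H¹_rad` into `L²_rad`. -/
def incl (d : ℕ) : H1rad d →ₗ[ℂ] L2rad d where
  toFun p := ⟨p.1.fst, p.2.1⟩
  map_add' _ _ := rfl
  map_smul' _ _ := rfl

theorem incl_injective (d : ℕ) : Function.Injective (incl d) := by
  rintro ⟨p, hp⟩ ⟨q, hq⟩ h
  have h1 : p.fst = q.fst := congrArg Subtype.val h
  have h2 : p.snd = q.snd := by
    ext1 i
    apply toDist_injective
    rw [← hp.2 i, ← hq.2 i, h1]
  apply Subtype.ext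
  exact (WithLp.ofLp_injective 2) (Prod.ext h1 h2)

/-- `H²_rad(ℝ^d) = H²(ℝ^d) ∩ L²_rad(ℝ^d)`. -/
def H2rad (d : ℕ) : Submodule ℂ (L2rad d) where
  carrier := {u | TemperedDistribution.MemSobolev 2 2 (toDist u.1)}
  zero_mem' := by
    simp
  add_mem' := by
    intro u v hu hv
    have := TemperedDistribution.MemSobolev.add hu hv
    simpa using this
  smul_mem' := by
    intro c u hu
    have := TemperedDistribution.MemSobolev.smul c hu
    simpa using this

/-- The graph of `-Δ + 1 - V` on radial functions: the pairs `(u, w)` with `u ∈ H²_rad` and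
`w = -Δu + u - Vu` in `L²_rad`. -/
def schrodingerGraph {d : ℕ} (V : Space d → ℝ) : Submodule ℂ (L2rad d × L2rad d) where
  carrier := {p | p.1 ∈ H2rad d ∧ ∃ q : L2 d,
    ((q : Space d → ℂ) =ᵐ[volume] fun x => (V x : ℂ) * (p.1 : L2 d) x) ∧
    toDist (p.2 : L2 d) = -Δ (toDist (p.1 : L2 d)) + toDist (p.1 : L2 d) - toDist q}
  zero_mem' := by
    refine ⟨(H2rad d).zero_mem, 0, ?_, ?_⟩
    · filter_upwards [Lp.coeFn_zero ℂ 2 (volume : Measure (Space d))] with x hx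
      simp only [Prod.fst_zero, ZeroMemClass.coe_zero, ↓hx]
      simp
    · simp [laplacian_zero]
  add_mem' := by
    rintro ⟨u, w⟩ ⟨u', w'⟩ ⟨hu, q, hq, h⟩ ⟨hu', q', hq', h'⟩
    refine ⟨(H2rad d).add_mem hu hu', q + q', ?_, ?_⟩
    · filter_upwards [Lp.coeFn_add q q', hq, hq', Lp.coeFn_add (u : L2 d) (u' : L2 d)]
        with x h1 h2 h3 h4
      simp only [Prod.mk_add_mk, Submodule.coe_add] at *
      rw [h1, h4]; simp only [Pi.add_apply, h2, h3]; ring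
    · simp only [Prod.mk_add_mk, Submodule.coe_add, map_add] at *
      rw [h, h', laplacian_add]; abel
  smul_mem' := by
    rintro c ⟨u, w⟩ ⟨hu, q, hq, h⟩
    refine ⟨(H2rad d).smul_mem c hu, c • q, ?_, ?_⟩
    · filter_upwards [Lp.coeFn_smul c q, hq, Lp.coeFn_smul c (u : L2 d)] with x h1 h2 h3
      simp only [Prod.smul_mk, Submodule.coe_smul] at *
      rw [h1, h3]; simp only [Pi.smul_apply, h2, smul_eq_mul]; ring
    · simp only [Prod.smul_mk, Submodule.coe_smul, map_smul] at *
      rw [h, laplacian_smul]; simp [smul_sub, smul_add]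

/-- The Schrödinger operator `-Δ + 1 - V` in `L²_rad`, with domain
`{u ∈ H²_rad | (-Δ + 1 - V)u ∈ L²_rad}` (all of `H²_rad` if `V` is radial and bounded). -/
def schrodinger {d : ℕ} (V : Space d → ℝ) : L2rad d →ₗ.[ℂ] L2rad d :=
  (schrodingerGraph V).toLinearPMap

theorem schrodinger_graph {d : ℕ} (V : Space d → ℝ) :
    (schrodinger V).graph = schrodingerGraph V := by
  apply Submodule.toLinearPMap_graph_eq
  rintro ⟨u, w⟩ ⟨-, q, hq, h⟩ (rfl : u = 0)
  have hq0 : q = 0 := by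
    apply Lp.ext
    filter_upwards [hq, Lp.coeFn_zero ℂ 2 (volume : Measure (Space d))] with x h1 h2
    simp only [ZeroMemClass.coe_zero] at h1
    rw [h1, h2]; simp
  subst hq0
  apply Subtype.ext
  apply toDist_injective
  rw [h]
  simp [laplacian_zero]

/-- The phase space `H¹_rad × L²_rad`, with its product topology. -/
abbrev Hrad (d : ℕ) : Type := H1rad d × L2rad d

/-- The graph of the matrix operator `(u₁, u₂) ↦ (u₂, -L u₁ - 2 α u₂)` on `H¹_rad × L²_rad`,
where `L = -Δ + 1 - V`. That `u₂` equals the element `w₁` of `H¹_rad` says `u₂ ∈ H¹_rad`. -/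
def dampedGraph {d : ℕ} (α : ℝ) (V : Space d → ℝ) : Submodule ℂ (Hrad d × Hrad d) where
  carrier := {p | p.1.2 = incl d p.2.1 ∧
    (incl d p.1.1, -p.2.2 - (2 * α : ℂ) • p.1.2) ∈ (schrodinger V).graph}
  zero_mem' := by
    refine ⟨by simp, ?_⟩
    simp
  add_mem' := by
    rintro ⟨u, w⟩ ⟨u', w'⟩ ⟨h1, h2⟩ ⟨h1', h2'⟩
    refine ⟨by simp_all, ?_⟩
    convert (schrodinger V).graph.add_mem h2 h2' using 1
    simp only [Prod.mk_add_mk, Prod.fst_add, Prod.snd_add, map_add, smul_add]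
    congr 1; abel
  smul_mem' := by
    rintro c ⟨u, w⟩ ⟨h1, h2⟩
    refine ⟨by simp_all, ?_⟩
    convert (schrodinger V).graph.smul_mem c h2 using 1
    simp only [Prod.smul_mk, Prod.smul_fst, Prod.smul_snd, map_smul, smul_sub, smul_neg]
    rw [smul_comm]

/-- The matrix operator `A_α = (0, 1; -L, -2α)` in `H¹_rad × L²_rad`, with domain
`dom(L) × H¹_rad`, where `L = -Δ + 1 - V`. -/
def dampedOp {d : ℕ} (α : ℝ) (V : Space d → ℝ) : Hrad d →ₗ.[ℂ] Hrad d :=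
  (dampedGraph α V).toLinearPMap

theorem dampedOp_graph {d : ℕ} (α : ℝ) (V : Space d → ℝ) :
    (dampedOp α V).graph = dampedGraph α V := by
  apply Submodule.toLinearPMap_graph_eq
  rintro ⟨u, w⟩ ⟨h1, h2⟩ (rfl : u = 0)
  have hw1 : w.1 = 0 := by
    apply incl_injective d
    simpa using h1.symm
  have hw2 : w.2 = 0 := by
    have := (schrodinger V).graph_fst_eq_zero_snd h2 (by simp)
    simpa using this
  exact Prod.ext hw1 hw2

/-- The growth condition on the nonlinearity: `f'` is bounded by two powers and is Hölder
continuous, with an energy-subcritical exponent `θ` (no upper bound on `θ` if `d ≤ 2`). -/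
def GrowthCondition (d : ℕ) (f : ℝ → ℝ) : Prop :=
  ∃ C θ β : ℝ, 1 < θ ∧ (3 ≤ d → θ < ((d : ℝ) + 2) / ((d : ℝ) - 2)) ∧ 0 < β ∧ β < θ - 1 ∧
    (∀ y, |deriv f y| ≤ C * max (|y| ^ β) (|y| ^ (θ - 1))) ∧
    ∀ y₁ y₂, |deriv f y₁ - deriv f y₂| ≤ C * (|y₁ - y₂| ^ β + |y₁ - y₂| ^ (θ - 1))

/-- `φ` is a real-valued function in `H¹_rad` that solves `-Δφ + φ - f(φ) = 0` in the sense of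
distributions. -/
structure IsRadialEquilibrium {d : ℕ} (f : ℝ → ℝ) (φ : Space d → ℝ) : Prop where
  mem_H1rad : ∃ u : H1rad d, ((incl d u : L2 d) : Space d → ℂ) =ᵐ[volume] fun x => (φ x : ℂ)
  equation : ∀ ψ : Space d → ℝ, ContDiff ℝ ∞ ψ → HasCompactSupport ψ →
    ∫ x, φ x * (-(Δ ψ) x + ψ x) = ∫ x, f (φ x) * ψ x

end KleinGordon

end

noncomputable section
set_option linter.unusedSectionVars false

/-! ### Spectral notions in terms of the graph -/

namespace LinearPMap

section Basic

variable {H : Type*} [AddCommGroup H] [Module ℂ H] [TopologicalSpace H]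

/-! Put p(z) = -(z² + 2αz). In (A - z)u = y the second component can be eliminated: the equation
says u₂ = y₁ + z u₁ and (L - p(z))u₁ = -y₂ - (2α + z)y₁. So invertibility, eigenspaces and the
Fredholm property of A at z are those of L at p(z) (`IsDamped`), and isolation in the spectrum is
transported because p is nonconstant and open. Every claim about A thus reduces to the spectrum of L
and the shape of the preimage of [1,∞) under p. Only the algebraic simplicity of 0 needs more: there
symmetry of L and α > 0 exclude a Jordan block.

For L, let S = (-Δ + 1)⁻¹ and let V be multiplication by v(|x|) = f'(φ). Then (L - w)S = 1 - wS - VS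
(`pencil`), a bounded operator. S is an explicit Fourier multiplier and VS is compact, so the
Fredholm alternative gives essential spectrum [1,∞) and only isolated eigenvalues elsewhere;
symmetry makes eigenvalues real and yields the Fredholm property (`IsPerturbedInverse`).

The analysis lies in three facts about radial functions, all obtained from the profile on (0,∞).
First, v is bounded, tends to 0 and is integrable at infinity (`GrowthCondition.exists_potential`):
the profile of φ solves an ODE, a bootstrap using subcriticality bounds it near 0, and a
monotonicity argument makes it decay exponentially. Secondly, VS is compact
(`isCompactOperator_radMul_comp_freeRes`), since an H¹ radial function with vanishing means on
finitely many thin shells is small after multiplication by v. Thirdly, solutions of the radial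
eigenvalue equation are governed by their Cauchy data at r = 1: an energy estimate excludes
eigenvalues above 1 (`initial_eq_zero`), and a vanishing Wronskian makes each eigenspace
one-dimensional (`wronskian_eq_zero`). -/

theorem exists_subScalar_eq_iff (T : H →ₗ.[ℂ] H) (z : ℂ) (x y : H) :
    (∃ hx : x ∈ T.domain, T.subScalar z ⟨x, hx⟩ = y) ↔ (x, y + z • x) ∈ T.graph := by
  rw [mem_graph_iff]
  constructor
  · rintro ⟨hx, rfl⟩
    exact ⟨⟨x, hx⟩, rfl, by simp [subScalar]⟩
  · rintro ⟨⟨x', hx⟩, rfl, h2⟩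
    refine ⟨hx, ?_⟩
    simp only at h2
    simp [subScalar, h2]

theorem mem_range_subScalar_iff (T : H →ₗ.[ℂ] H) (z : ℂ) (y : H) :
    y ∈ LinearMap.range (T.subScalar z) ↔ ∃ x, (x, y + z • x) ∈ T.graph := by
  simp_rw [← exists_subScalar_eq_iff, LinearMap.mem_range, Subtype.exists]

theorem mem_eigenspace_iff (T : H →ₗ.[ℂ] H) (z : ℂ) (x : H) :
    x ∈ T.eigenspace z ↔ (x, z • x) ∈ T.graph := by
  have := exists_subScalar_eq_iff T z x 0
  rw [zero_add] at this
  rw [← this, eigenspace, Submodule.mem_map]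
  constructor
  · rintro ⟨⟨x, hx⟩, h, rfl⟩
    exact ⟨hx, h⟩
  · rintro ⟨hx, h⟩
    exact ⟨⟨x, hx⟩, h, rfl⟩

theorem mem_resolventSet_iff (T : H →ₗ.[ℂ] H) (z : ℂ) :
    z ∈ T.resolventSet ↔ ∃ R : H →L[ℂ] H, ∀ x y, R y = x ↔ (x, y + z • x) ∈ T.graph := by
  simp only [resolventSet, Set.mem_ofPred_eq, exists_subScalar_eq_iff]

theorem mem_pointSpectrum_iff (T : H →ₗ.[ℂ] H) (z : ℂ) :
    z ∈ T.pointSpectrum ↔ ∃ x, x ≠ 0 ∧ (x, z • x) ∈ T.graph := by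
  simp only [pointSpectrum, Set.mem_ofPred_eq, Submodule.ne_bot_iff, mem_eigenspace_iff]
  exact ⟨fun ⟨x, h1, h2⟩ => ⟨x, h2, h1⟩, fun ⟨x, h1, h2⟩ => ⟨x, h2, h1⟩⟩

theorem pointSpectrum_subset_opSpectrum (T : H →ₗ.[ℂ] H) : T.pointSpectrum ⊆ T.opSpectrum := by
  intro z hz hz'
  obtain ⟨x, hx0, hx⟩ := (mem_pointSpectrum_iff T z).1 hz
  obtain ⟨R, hR⟩ := (mem_resolventSet_iff T z).1 hz'
  have h1 : R 0 = x := (hR x 0).2 (by simpa using hx)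
  exact hx0 (by simpa using h1.symm)

/-- The kernel of `T - z` is isomorphic to the eigenspace. -/
def kerEquivEigenspace (T : H →ₗ.[ℂ] H) (z : ℂ) :
    LinearMap.ker (T.subScalar z) ≃ₗ[ℂ] T.eigenspace z :=
  Submodule.equivMapOfInjective _ (Submodule.injective_subtype _) _

theorem isFredholmAt_iff (T : H →ₗ.[ℂ] H) (z : ℂ) : T.IsFredholmAt z ↔
    FiniteDimensional ℂ (T.eigenspace z) ∧
    _root_.IsClosed (LinearMap.range (T.subScalar z) : Set H) ∧
    FiniteDimensional ℂ (H ⧸ LinearMap.range (T.subScalar z)) := by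
  have h : FiniteDimensional ℂ (LinearMap.ker (T.subScalar z)) ↔
      FiniteDimensional ℂ (T.eigenspace z) :=
    ⟨fun _ => (kerEquivEigenspace T z).finiteDimensional,
      fun _ => (kerEquivEigenspace T z).symm.finiteDimensional⟩
  rw [IsFredholmAt, h]

end Basic

end LinearPMap

/-! ### Fredholm alternative for compact perturbations of invertible operators -/

section CompactPerturbation

variable {H : Type*} [NormedAddCommGroup H] [NormedSpace ℂ H] [CompleteSpace H]

theorem IsCompactOperator.isUnit_one_sub {K : H →L[ℂ] H} (hK : IsCompactOperator K)
    (hinj : ∀ x, K x = x → x = 0) : IsUnit (1 - K) := by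
  rcases hK.hasEigenvalue_or_mem_resolventSet (one_ne_zero (α := ℂ)) with h | h
  · obtain ⟨x, hx⟩ := h.exists_hasEigenvector
    exact absurd (hinj x (by simpa using hx.apply_eq_smul)) hx.2
  · rw [spectrum.mem_resolventSet_iff] at h
    simpa using h

/-- Factor U - K = U(1 - U⁻¹K); since U⁻¹K is compact, injectivity is the only obstruction. -/
theorem IsCompactOperator.isUnit_sub {U K : H →L[ℂ] H} (hU : IsUnit U) (hK : IsCompactOperator K)
    (hinj : ∀ x, U x = K x → x = 0) : IsUnit (U - K) := by
  obtain ⟨U, rfl⟩ := hU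
  have h1 : IsCompactOperator ((U⁻¹ : (H →L[ℂ] H)ˣ) * K : H →L[ℂ] H) :=
    hK.clm_comp (U⁻¹ : (H →L[ℂ] H)ˣ).1
  have h2 := h1.isUnit_one_sub (fun x hx => hinj x (by
    have : (U : H →L[ℂ] H) (((U⁻¹ : (H →L[ℂ] H)ˣ) * K : H →L[ℂ] H) x) = K x := by
      rw [← mul_apply_eq_comp, Units.mul_inv_cancel_left]
    rw [← this, hx]))
  have h3 : (U : H →L[ℂ] H) - K = U * (1 - (U⁻¹ : (H →L[ℂ] H)ˣ) * K) := by
    rw [mul_sub, Units.mul_inv_cancel_left, mul_one]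
  rw [h3]
  exact U.isUnit.mul h2

/-- On this closed kernel U⁻¹K is the identity, so the identity of the kernel is compact. -/
theorem IsCompactOperator.finiteDimensional_of_eq {U K : H →L[ℂ] H} (hU : IsUnit U)
    (hK : IsCompactOperator K) : FiniteDimensional ℂ (LinearMap.ker (U - K : H →L[ℂ] H).toLinearMap) := by
  obtain ⟨U, rfl⟩ := hU
  have h1 : IsCompactOperator ((U⁻¹ : (H →L[ℂ] H)ˣ) * K : H →L[ℂ] H) :=
    hK.clm_comp (U⁻¹ : (H →L[ℂ] H)ˣ).1
  set N := LinearMap.ker ((U : H →L[ℂ] H) - K : H →L[ℂ] H).toLinearMap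
  have hN : ∀ x ∈ N, (((U⁻¹ : (H →L[ℂ] H)ˣ) * K : H →L[ℂ] H) : H →ₗ[ℂ] H) x = x := by
    intro x hx
    have hx' : (U : H →L[ℂ] H) x = K x := by
      have : (U : H →L[ℂ] H) x - K x = 0 := hx
      exact sub_eq_zero.1 this
    show (U⁻¹ : (H →L[ℂ] H)ˣ).1 (K x) = x
    rw [← hx', ← mul_apply_eq_comp, Units.inv_mul, one_apply_eq_self]
  have hcl : IsClosed (N : Set H) := ContinuousLinearMap.isClosed_ker _
  have h2 := IsCompactOperator.restrict (f := (((U⁻¹ : (H →L[ℂ] H)ˣ) * K : H →L[ℂ] H) : H →ₗ[ℂ] H))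
    h1 (V := N) (fun x hx => by rw [hN x hx]; exact hx) hcl
  apply FiniteDimensional.of_isCompactOperator_id (𝕜 := ℂ)
  have h3 : (id : N → N) = LinearMap.restrict
      (((U⁻¹ : (H →L[ℂ] H)ˣ) * K : H →L[ℂ] H) : H →ₗ[ℂ] H)
      (fun x (hx : x ∈ N) => by rw [hN x hx]; exact hx) := by
    funext x
    apply Subtype.ext
    rw [LinearMap.coe_restrict_apply]
    exact (hN x x.2).symm
  rw [h3]
  exact h2

end CompactPerturbation

/-! ### Spectrum of a relatively compact symmetric perturbation -/

section Pencil

variable {H : Type*} [NormedAddCommGroup H] [InnerProductSpace ℂ H] [CompleteSpace H]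

open scoped InnerProductSpace

/-- The half-line `[1, ∞)` in the complex plane. -/
def unitRay : Set ℂ := {z | z.im = 0 ∧ 1 ≤ z.re}

/-- The operator `1 - w S - V S`, so that `(S⁻¹ - V - w) S = 1 - w S - V S`. -/
def pencil (S V : H →L[ℂ] H) (w : ℂ) : H →L[ℂ] H := 1 - w • S - V ∘L S

theorem pencil_apply (S V : H →L[ℂ] H) (w : ℂ) (f : H) :
    pencil S V w f = f - w • S f - V (S f) := rfl

/-- `L = S⁻¹ - V`, where the inverse `S` of a self-adjoint operator has the same properties as
`(-Δ + 1)⁻¹` and `V` is a relatively compact symmetric perturbation. -/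
structure IsPerturbedInverse (L : H →ₗ.[ℂ] H) (S V : H →L[ℂ] H) : Prop where
  graph : ∀ u w, (u, w) ∈ L.graph ↔ ∃ f, u = S f ∧ w = f - V (S f)
  symm_S : ∀ f g, ⟪S f, g⟫_ℂ = ⟪f, S g⟫_ℂ
  symm_V : ∀ f g, ⟪V f, g⟫_ℂ = ⟪f, V g⟫_ℂ
  inj : ∀ f, S f = 0 → f = 0
  compact : IsCompactOperator (V ∘L S)
  isUnit : ∀ w, w ∉ unitRay → IsUnit (1 - w • S)
  not_isUnit : ∀ w ∈ unitRay, ¬ IsUnit (1 - w • S)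
  inj_ray : ∀ w ∈ unitRay, ∀ f, f = w • S f → f = 0

namespace IsPerturbedInverse

variable {L : H →ₗ.[ℂ] H} {S V : H →L[ℂ] H} (h : IsPerturbedInverse L S V)
include h

/-- Parametrising the domain by S turns the unbounded operator L - z into the bounded `pencil`. -/
theorem graph_iff (z : ℂ) (x y : H) :
    (x, y + z • x) ∈ L.graph ↔ ∃ f, x = S f ∧ y = pencil S V z f := by
  rw [h.graph]
  refine exists_congr fun f => and_congr_right ?_
  rintro rfl
  rw [pencil_apply, ← eq_sub_iff_add_eq]
  constructor <;> rintro rfl <;> abel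

theorem symmetric {u w u' w' : H} (h1 : (u, w) ∈ L.graph) (h2 : (u', w') ∈ L.graph) :
    ⟪w, u'⟫_ℂ = ⟪u, w'⟫_ℂ := by
  obtain ⟨f, rfl, rfl⟩ := (h.graph _ _).1 h1
  obtain ⟨g, rfl, rfl⟩ := (h.graph _ _).1 h2
  rw [inner_sub_left, inner_sub_right, h.symm_V, ← h.symm_S f g]

theorem mem_eigenspace_iff (z : ℂ) (x : H) :
    x ∈ L.eigenspace z ↔ ∃ f, x = S f ∧ pencil S V z f = 0 := by
  rw [LinearPMap.mem_eigenspace_iff]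
  have := h.graph_iff z x 0
  rw [zero_add] at this
  rw [this]
  simp_rw [eq_comm (a := (0 : H))]

theorem mem_pointSpectrum_iff (z : ℂ) :
    z ∈ L.pointSpectrum ↔ ∃ f, f ≠ 0 ∧ pencil S V z f = 0 := by
  rw [LinearPMap.pointSpectrum, Set.mem_ofPred_eq, Submodule.ne_bot_iff]
  constructor
  · rintro ⟨x, hx, hx0⟩
    obtain ⟨f, rfl, hf⟩ := (h.mem_eigenspace_iff z x).1 hx
    exact ⟨f, fun h0 => hx0 (by simp [h0]), hf⟩
  · rintro ⟨f, hf0, hf⟩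
    exact ⟨S f, (h.mem_eigenspace_iff z _).2 ⟨f, rfl, hf⟩, fun h0 => hf0 (h.inj f h0)⟩

theorem mem_resolventSet_iff (z : ℂ) : z ∈ L.resolventSet ↔ IsUnit (pencil S V z) := by
  rw [LinearPMap.mem_resolventSet_iff]
  simp_rw [h.graph_iff]
  constructor
  · rintro ⟨R, hR⟩
    rw [ContinuousLinearMap.isUnit_iff_bijective]
    constructor
    · rw [injective_iff_map_eq_zero]
      intro f hf
      have : R 0 = S f := (hR _ _).2 ⟨f, rfl, hf.symm⟩
      exact h.inj f (by simpa using this.symm)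
    · intro y
      obtain ⟨f, -, hf⟩ := (hR (R y) y).1 rfl
      exact ⟨f, hf.symm⟩
  · rintro ⟨B, hB⟩
    refine ⟨S * (B⁻¹ : (H →L[ℂ] H)ˣ), fun x y => ?_⟩
    rw [← hB]
    constructor
    · rintro rfl
      refine ⟨(B⁻¹ : (H →L[ℂ] H)ˣ).1 y, rfl, ?_⟩
      rw [← mul_apply_eq_comp, Units.mul_inv, one_apply_eq_self]
    · rintro ⟨f, rfl, rfl⟩
      show S ((B⁻¹ : (H →L[ℂ] H)ˣ).1 (B.1 f)) = S f
      rw [← mul_apply_eq_comp (B⁻¹ : (H →L[ℂ] H)ˣ).1, Units.inv_mul,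
        one_apply_eq_self]

theorem im_eq_zero_of_mem_pointSpectrum {z : ℂ} (hz : z ∈ L.pointSpectrum) : z.im = 0 := by
  obtain ⟨x, hx0, hx⟩ := (LinearPMap.mem_pointSpectrum_iff L z).1 hz
  have := h.symmetric hx hx
  rw [inner_smul_left, inner_smul_right] at this
  have h2 := mul_right_cancel₀ (inner_self_ne_zero.2 hx0) this
  exact Complex.conj_eq_iff_im.1 h2

/-- Weyl's argument through the Fredholm alternative: if L - w were invertible, adding the compact
VS back to the pencil would leave an injective operator 1 - wS (by `inj_ray`), which would then be
invertible, against `not_isUnit`. -/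
theorem unitRay_subset : unitRay ⊆ L.opSpectrum := by
  intro w hw hw'
  rw [h.mem_resolventSet_iff] at hw'
  apply h.not_isUnit w hw
  have h1 := IsCompactOperator.isUnit_sub hw' (K := -(V ∘L S)) (by
    simpa using h.compact.neg) (fun x hx => by
      apply h.inj_ray w hw
      rw [pencil_apply] at hx
      have : x - w • S x = 0 := by
        have h3 : x - w • S x = (x - w • S x - V (S x)) + V (S x) := by abel
        rw [h3, hx]; simp
      exact sub_eq_zero.1 this)
  convert h1 using 1
  rw [pencil]; abel

theorem isUnit_or_mem_pointSpectrum {w : ℂ} (hw : w ∉ unitRay) :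
    w ∈ L.resolventSet ∨ w ∈ L.pointSpectrum := by
  rw [h.mem_resolventSet_iff, h.mem_pointSpectrum_iff]
  by_cases h0 : ∃ f, f ≠ 0 ∧ pencil S V w f = 0
  · exact Or.inr h0
  · left
    push Not at h0
    apply IsCompactOperator.isUnit_sub (h.isUnit w hw) h.compact
    intro x hx
    by_contra hx0
    exact h0 x hx0 (sub_eq_zero.2 hx)

theorem finiteDimensional_eigenspace {w : ℂ} (hw : w ∉ unitRay) :
    FiniteDimensional ℂ (L.eigenspace w) := by
  have h1 := IsCompactOperator.finiteDimensional_of_eq (h.isUnit w hw) h.compact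
  have h2 : L.eigenspace w ≤ (LinearMap.ker (1 - w • S - V ∘L S : H →L[ℂ] H).toLinearMap).map
      (S : H →ₗ[ℂ] H) := by
    intro x hx
    obtain ⟨f, rfl, hf⟩ := (h.mem_eigenspace_iff w x).1 hx
    exact ⟨f, hf, rfl⟩
  exact Submodule.finiteDimensional_of_le h2

omit [CompleteSpace H] h in
-- Every vector agrees modulo R with its projection onto N, so N surjects onto the quotient.
theorem finiteDimensional_compl {N R : Submodule ℂ H} [FiniteDimensional ℂ N]
    (hR : ∀ f, (∀ n ∈ N, ⟪n, f⟫_ℂ = 0) → f ∈ R) : FiniteDimensional ℂ (H ⧸ R) := by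
  have h2 : Function.Surjective (R.mkQ ∘ₗ N.subtype) := by
    intro q
    obtain ⟨x, rfl⟩ := R.mkQ_surjective q
    refine ⟨N.orthogonalProjectionOnto x, ?_⟩
    rw [← sub_eq_zero]
    show R.mkQ (N.orthogonalProjectionOnto x : H) - R.mkQ x = 0
    rw [← map_sub, Submodule.mkQ_apply, Submodule.Quotient.mk_eq_zero]
    rw [← neg_mem_iff, neg_sub]
    exact hR _ fun n hn => Submodule.inner_right_of_mem_orthogonal hn
        (N.sub_starProjection_mem_orthogonal x)
  exact Module.Finite.of_surjective _ h2

/-- Off the half-line `[1, ∞)`, eigenvalues are isolated in the spectrum, and `L - w` is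
Fredholm there. -/
theorem mem_discSpectrum_of_mem_pointSpectrum {μ : ℂ} (hμ : μ ∉ unitRay)
    (hp : μ ∈ L.pointSpectrum) : μ ∈ L.discSpectrum := by
  have hfd := h.finiteDimensional_eigenspace hμ
  set N := L.eigenspace μ with hN
  set P : H →L[ℂ] H := N.starProjection with hP
  have hμr := h.im_eq_zero_of_mem_pointSpectrum hp
  have hPS : IsCompactOperator ((V - P) ∘L S) := by
    have : (V - P) ∘L S = V ∘L S - P ∘L S := by ext; simp
    rw [this]
    refine h.compact.sub ?_
    have : ProperSpace N := FiniteDimensional.proper ℂ N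
    have h1 : IsCompactOperator N.subtypeL :=
      isCompactOperator_of_locallyCompactSpace_rng N.subtypeL
    exact h1.comp_clm (N.orthogonalProjectionOnto ∘L S)
  have horth : ∀ f, ∀ n ∈ N, ⟪n, f - V (S f) - μ • S f⟫_ℂ = 0 := by
    intro f n hn
    have h1 := h.symmetric ((LinearPMap.mem_eigenspace_iff _ _ _).1 hn)
      ((h.graph _ _).2 ⟨f, rfl, rfl⟩)
    rw [inner_smul_left, Complex.conj_eq_iff_im.2 hμr] at h1
    rw [inner_sub_right, ← h1, inner_smul_right, sub_self]
  have hker : ∀ f, f - V (S f) - μ • S f = 0 → S f ∈ N := fun f hf =>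
    (h.mem_eigenspace_iff μ _).2 ⟨f, rfl, by rw [pencil_apply, ← hf]; abel⟩
  have hPorth : ∀ f, (∀ n ∈ N, ⟪n, f⟫_ℂ = 0) → P f = 0 := fun f hf =>
    (Submodule.starProjection_apply_eq_zero_iff N).2 hf
  have hPmem : ∀ f, P f ∈ N := fun f => Submodule.starProjection_apply_mem N f
  have hPid : ∀ f ∈ N, P f = f := fun f hf => Submodule.starProjection_eq_self_iff.2 hf
  -- Adding the finite-rank projection P onto the eigenspace N makes L - μ invertible. By symmetry
  -- the range of L - μ is orthogonal to N, so (L - μ)u + Pu = 0 forces Pu = 0; then u lies in N and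
  -- u = Pu = 0.
  have hunit : IsUnit (pencil S (V - P) μ) := by
    apply IsCompactOperator.isUnit_sub (h.isUnit μ hμ) hPS
    intro f hf
    have hf' : (f - V (S f) - μ • S f) + P (S f) = 0 := by
      have : f - μ • S f = V (S f) - P (S f) := hf
      have h2 : f - V (S f) - μ • S f = (f - μ • S f) - V (S f) := by abel
      rw [h2, this]; abel
    have h3 : P (S f) = 0 := by
      have h4 := congrArg P hf'
      rw [map_add, map_zero, hPorth _ (horth f), zero_add, hPid _ (hPmem _)] at h4
      exact h4
    rw [h3, add_zero] at hf'
    exact h.inj f (by rw [← hPid _ (hker f hf'), h3])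
  have hrange : (LinearMap.range (L.subScalar μ) : Submodule ℂ H) = Nᗮ := by
    ext y
    rw [LinearPMap.mem_range_subScalar_iff, Submodule.mem_orthogonal]
    simp_rw [h.graph_iff]
    constructor
    · rintro ⟨x, f, rfl, rfl⟩ n hn
      rw [← horth f n hn, pencil_apply]
      congr 1; abel
    · intro hy
      obtain ⟨f, hf⟩ := ((ContinuousLinearMap.isUnit_iff_bijective).1 hunit).2 y
      have hf' : (f - V (S f) - μ • S f) + P (S f) = y := by
        rw [← hf, pencil_apply, sub_apply]; abel
      have h3 : P (S f) = 0 := by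
        have h4 := congrArg P hf'
        rwa [map_add, hPorth _ (horth f), hPorth y hy, zero_add, hPid _ (hPmem _)] at h4
      rw [h3, add_zero] at hf'
      exact ⟨S f, f, rfl, by rw [← hf', pencil_apply]; abel⟩
  refine ⟨L.pointSpectrum_subset_opSpectrum hp, ?_, ?_⟩
  · obtain ⟨B, hB⟩ := hunit
    have hopen : ∀ᶠ w in 𝓝[≠] μ, w ∉ unitRay := by
      apply nhdsWithin_le_nhds
      refine IsOpen.mem_nhds (s := unitRayᶜ) ?_ hμ
      rw [isOpen_compl_iff]
      exact (isClosed_eq Complex.continuous_im continuous_const).inter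
        (isClosed_le continuous_const Complex.continuous_re)
    -- C is the inverse of L - μ + P; its norm determines how far μ is from other eigenvalues.
    set C : H →L[ℂ] H := S * (B⁻¹ : (H →L[ℂ] H)ˣ).1 with hC
    have hnear : ∀ᶠ w in 𝓝[≠] μ, ‖w - μ‖ * ‖C‖ < 1 := by
      apply nhdsWithin_le_nhds
      have : Tendsto (fun w : ℂ => ‖w - μ‖ * ‖C‖) (𝓝 μ) (𝓝 (‖μ - μ‖ * ‖C‖)) := by
        apply Continuous.tendsto; fun_prop
      exact this.eventually_lt_const (by simp)
    filter_upwards [hopen, hnear, self_mem_nhdsWithin] with w hw1 hw2 hw3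
    refine fun hw => hw ((h.isUnit_or_mem_pointSpectrum hw1).resolve_right fun hwp => ?_)
    obtain ⟨x, hx0, hx⟩ := (LinearPMap.mem_pointSpectrum_iff L w).1 hwp
    have hwr := h.im_eq_zero_of_mem_pointSpectrum hwp
    -- Eigenvectors for w ≠ μ are orthogonal to N, so P kills them and (L - μ + P)x = (w - μ)x.
    -- Hence x = (w - μ)Cx, which is impossible when |w - μ|‖C‖ < 1.
    have hxN : ∀ n ∈ N, ⟪n, x⟫_ℂ = 0 := by
      intro n hn
      have h1 := h.symmetric ((LinearPMap.mem_eigenspace_iff _ _ _).1 hn) hx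
      rw [inner_smul_left, inner_smul_right, Complex.conj_eq_iff_im.2 hμr] at h1
      by_contra h2
      exact hw3 (mul_right_cancel₀ h2 h1).symm
    obtain ⟨f, rfl, hf⟩ := (h.graph _ _).1 hx
    have h5 : B.1 f = (w - μ) • S f := by
      rw [hB, pencil_apply, sub_apply, hPorth _ hxN, sub_smul, hf]; abel
    have h6 : S f = (w - μ) • C (S f) := by
      rw [← map_smul, ← h5, hC, mul_apply_eq_comp,
        ← mul_apply_eq_comp (B⁻¹ : (H →L[ℂ] H)ˣ).1, Units.inv_mul,
        one_apply_eq_self]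
    have h7 : ‖S f‖ ≤ ‖w - μ‖ * ‖C‖ * ‖S f‖ := by
      conv_lhs => rw [h6, norm_smul]
      rw [mul_assoc]
      gcongr
      exact C.le_opNorm _
    nlinarith [norm_pos_iff.2 hx0]
  · rw [LinearPMap.isFredholmAt_iff]
    refine ⟨hfd, ?_, ?_⟩
    · rw [hrange]; exact Submodule.isClosed_orthogonal _
    · rw [hrange]
      exact finiteDimensional_compl (N := N) fun f hf => hf

/-- The points w + ε, ε > 0, stay in the half-line and hence in the spectrum, so w is not isolated.
-/
theorem not_mem_discSpectrum_of_mem_unitRay {w : ℂ} (hw : w ∈ unitRay) : w ∉ L.discSpectrum := by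
  rintro ⟨-, h2, -⟩
  have hmem : ∀ ε : ℝ, 0 < ε → w + ε ∈ L.opSpectrum := fun ε hε =>
    h.unitRay_subset ⟨by simp [hw.1], by simpa using by linarith [hw.2]⟩
  have ht : Tendsto (fun ε : ℝ => w + (ε : ℂ)) (𝓝[>] 0) (𝓝[≠] w) := by
    apply tendsto_nhdsWithin_iff.2
    constructor
    · have : Tendsto (fun ε : ℝ => w + (ε : ℂ)) (𝓝 0) (𝓝 (w + ((0 : ℝ) : ℂ))) := by
        apply Continuous.tendsto; fun_prop
      simpa using this.mono_left nhdsWithin_le_nhds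
    · filter_upwards [self_mem_nhdsWithin] with ε hε
      simpa using ne_of_gt hε
  obtain ⟨ε, h3, h4⟩ := ((ht.eventually h2).and self_mem_nhdsWithin).exists
  exact h3 (hmem ε h4)

theorem discSpectrum_eq : L.discSpectrum = L.pointSpectrum \ unitRay := by
  ext w
  constructor
  · intro hw
    have h1 : w ∉ unitRay := fun h1 => h.not_mem_discSpectrum_of_mem_unitRay h1 hw
    exact ⟨(h.isUnit_or_mem_pointSpectrum h1).resolve_left hw.1, h1⟩
  · exact fun hw => h.mem_discSpectrum_of_mem_pointSpectrum hw.2 hw.1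

theorem essSpectrum_eq : L.essSpectrum = unitRay := by
  ext w
  constructor
  · rintro ⟨h1, h2⟩
    by_contra h3
    exact h2 (h.mem_discSpectrum_of_mem_pointSpectrum h3
      ((h.isUnit_or_mem_pointSpectrum h3).resolve_left h1))
  · exact fun hw => ⟨h.unitRay_subset hw, h.not_mem_discSpectrum_of_mem_unitRay hw⟩

end IsPerturbedInverse

end Pencil

/-- A bounded operator with values in the range of a bounded injection factors through it. -/
theorem ContinuousLinearMap.exists_lift_of_range_subset {X Y Z : Type*} [NormedAddCommGroup X]
    [NormedSpace ℂ X] [CompleteSpace X] [NormedAddCommGroup Y] [NormedSpace ℂ Y] [CompleteSpace Y]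
    [NormedAddCommGroup Z] [NormedSpace ℂ Z] (i : Y →L[ℂ] Z) (hi : Function.Injective i)
    (T : X →L[ℂ] Z) (hT : ∀ x, T x ∈ Set.range i) : ∃ J : X →L[ℂ] Y, ∀ x, i (J x) = T x := by
  choose j hj using hT
  let J : X →ₗ[ℂ] Y :=
    { toFun := j
      map_add' := fun x y => hi (by simp [hj])
      map_smul' := fun c x => hi (by simp [hj]) }
  -- Closed graph theorem: limits in Y are identified after applying the injection i.
  refine ⟨ContinuousLinearMap.ofSeqClosedGraph (g := J) ?_, hj⟩
  intro u x y hu hJ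
  apply hi
  show i y = i (j x)
  rw [hj]
  have h1 : Tendsto (fun n => i (J (u n))) atTop (𝓝 (i y)) := (i.continuous.tendsto y).comp hJ
  have h2 : Tendsto (fun n => T (u n)) atTop (𝓝 (T x)) := (T.continuous.tendsto x).comp hu
  have h3 : (fun n => i (J (u n))) = fun n => T (u n) := funext fun n => hj (u n)
  rw [h3] at h1
  exact tendsto_nhds_unique h1 h2

/-! ### The quadratic map p and the preimage of the half-line -/

section ComplexPlane

/-- The polynomial `z ↦ -(z² + 2 α z)` relating the spectra of `A_α` and `L`. -/
def dampedSymbol (α : ℝ) (z : ℂ) : ℂ := -(z ^ 2 + 2 * α * z)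

theorem dampedSymbol_eq (α : ℝ) (z : ℂ) : dampedSymbol α z = α ^ 2 - (z + α) ^ 2 := by
  rw [dampedSymbol]; ring

theorem cpow_half_sq (w : ℂ) : (w ^ (1 / 2 : ℂ)) ^ 2 = w := by
  rw [← Complex.cpow_nat_mul]
  norm_num

theorem dampedSymbol_eq_iff (α : ℝ) (z μ : ℂ) : dampedSymbol α z = μ ↔
    (z = -α + ((α : ℂ) ^ 2 - μ) ^ (1 / 2 : ℂ) ∨ z = -α - ((α : ℂ) ^ 2 - μ) ^ (1 / 2 : ℂ)) := by
  rw [dampedSymbol_eq]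
  have h1 := cpow_half_sq ((α : ℂ) ^ 2 - μ)
  set s := ((α : ℂ) ^ 2 - μ) ^ (1 / 2 : ℂ)
  have h2 : (α : ℂ) ^ 2 - (z + α) ^ 2 = μ ↔ (z + α) ^ 2 = s ^ 2 := by
    rw [h1]
    constructor <;> intro h <;> linear_combination -h
  rw [h2, sq_eq_sq_iff_eq_or_eq_neg]
  refine or_congr ?_ ?_
  · rw [← eq_sub_iff_add_eq]; constructor <;> (rintro rfl; ring)
  · rw [← eq_sub_iff_add_eq]; constructor <;> (rintro rfl; ring)

theorem dampedSymbol_re_im (α : ℝ) (z : ℂ) :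
    (dampedSymbol α z).re = α ^ 2 - (z.re + α) ^ 2 + z.im ^ 2 ∧
      (dampedSymbol α z).im = -(2 * (z.re + α) * z.im) := by
  rw [dampedSymbol]
  constructor <;> simp [pow_two] <;> ring

theorem dampedSymbol_im_eq_zero_iff (α : ℝ) (z : ℂ) :
    (dampedSymbol α z).im = 0 ↔ z.re = -α ∨ z.im = 0 := by
  rw [(dampedSymbol_re_im α z).2, neg_eq_zero, mul_eq_zero, mul_eq_zero, ← eq_neg_iff_add_eq_zero]
  simp

theorem exists_dampedSymbol_eq (α : ℝ) (μ : ℂ) : ∃ z, dampedSymbol α z = μ :=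
  ⟨_, (dampedSymbol_eq_iff α _ μ).2 (Or.inl rfl)⟩

theorem continuous_dampedSymbol (α : ℝ) : Continuous (dampedSymbol α) := by
  unfold dampedSymbol; fun_prop

/-- The only other preimage of p(z) is -z - 2α, which is either z itself or at positive distance
from z. -/
theorem tendsto_dampedSymbol_punctured (α : ℝ) (z : ℂ) :
    Tendsto (dampedSymbol α) (𝓝[≠] z) (𝓝[≠] (dampedSymbol α z)) := by
  refine tendsto_nhdsWithin_iff.2
    ⟨((continuous_dampedSymbol α).tendsto z).mono_left nhdsWithin_le_nhds, ?_⟩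
  have h1 : ∀ᶠ w in 𝓝[≠] z, w ≠ -z - 2 * α := by
    by_cases h : z = -z - 2 * α
    · rw [← h]; exact self_mem_nhdsWithin
    · exact nhdsWithin_le_nhds (isOpen_ne.mem_nhds h)
  filter_upwards [h1, self_mem_nhdsWithin] with w hw1 hw2
  intro h
  have h3 : (w - z) * (w - (-z - 2 * α)) = 0 := by
    simp only [Set.mem_singleton_iff, dampedSymbol] at h
    linear_combination -h
  rcases mul_eq_zero.1 h3 with h4 | h4
  · exact hw2 (sub_eq_zero.1 h4)
  · exact hw1 (sub_eq_zero.1 h4)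

/-- Transfers isolation of spectral points in both directions. From z to p(z) it rests on the open
mapping theorem for the nonconstant analytic map p. -/
theorem eventually_dampedSymbol_iff (α : ℝ) (z : ℂ) (P : ℂ → Prop) :
    (∀ᶠ w in 𝓝[≠] z, P (dampedSymbol α w)) ↔ ∀ᶠ v in 𝓝[≠] (dampedSymbol α z), P v := by
  refine ⟨fun h => ?_, fun h => (tendsto_dampedSymbol_punctured α z).eventually h⟩
  have h1 : AnalyticAt ℂ (dampedSymbol α) z := by
    unfold dampedSymbol; fun_prop
  have h2 : 𝓝 (dampedSymbol α z) ≤ map (dampedSymbol α) (𝓝 z) := by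
    refine h1.eventually_constant_or_nhds_le_map_nhds.resolve_left fun h3 => ?_
    have h4 := (tendsto_dampedSymbol_punctured α z).eventually self_mem_nhdsWithin
    obtain ⟨w, h5, h6⟩ := (h4.and (nhdsWithin_le_nhds h3)).exists
    exact h5 h6
  rw [eventually_nhdsWithin_iff] at h ⊢
  apply h2
  rw [mem_map]
  filter_upwards [h] with w hw hw'
  exact hw fun h => hw' (by rw [Set.mem_singleton_iff] at h ⊢; rw [h])

theorem dampedSymbol_mem_unitRay_iff_of_le {α : ℝ} (h1 : α ≤ 1) (h0 : 0 < α) (z : ℂ) :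
    dampedSymbol α z ∈ unitRay ↔ z.re = -α ∧ Real.sqrt (1 - α ^ 2) ≤ |z.im| := by
  rw [unitRay, Set.mem_ofPred_eq, dampedSymbol_im_eq_zero_iff, (dampedSymbol_re_im α z).1,
    Real.sqrt_le_left (abs_nonneg _), sq_abs]
  constructor
  · rintro ⟨h | h, h2⟩
    · exact ⟨h, by rw [h] at h2; linarith⟩
    · rw [h] at h2
      -- On the real axis p ≤ α² ≤ 1, so a value at least 1 forces equality and z = -α.
      have h3 : z.re + α = 0 := by nlinarith [sq_nonneg (z.re + α)]
      refine ⟨by linarith, ?_⟩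
      rw [h3] at h2
      rw [h]; linarith
  · rintro ⟨h, h2⟩
    exact ⟨Or.inl h, by rw [h]; linarith⟩

theorem dampedSymbol_mem_unitRay_iff_of_lt {α : ℝ} (h1 : 1 < α) (z : ℂ) :
    dampedSymbol α z ∈ unitRay ↔ z.re = -α ∨ z.im = 0 ∧
      z.re ∈ Set.Icc (-α - Real.sqrt (α ^ 2 - 1)) (-α + Real.sqrt (α ^ 2 - 1)) := by
  rw [unitRay, Set.mem_ofPred_eq, dampedSymbol_im_eq_zero_iff, (dampedSymbol_re_im α z).1]
  have h2 : z.re ∈ Set.Icc (-α - Real.sqrt (α ^ 2 - 1)) (-α + Real.sqrt (α ^ 2 - 1)) ↔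
      (z.re + α) ^ 2 ≤ α ^ 2 - 1 := by
    rw [Set.mem_Icc, Real.sq_le (by nlinarith)]
    constructor <;> rintro ⟨_, _⟩ <;> constructor <;> linarith
  rw [h2]
  constructor
  · rintro ⟨h | h, h3⟩
    · exact Or.inl h
    · rw [h] at h3
      exact Or.inr ⟨h, by linarith⟩
  · rintro (h | ⟨h, h3⟩)
    · exact ⟨Or.inl h, by rw [h]; nlinarith [sq_nonneg z.im]⟩
    · exact ⟨Or.inr h, by rw [h]; linarith⟩

theorem exists_gap_of_pos {α : ℝ} (hα : 0 < α) :
    ∃ δ : ℝ, 0 < δ ∧ ∀ z, dampedSymbol α z ∈ unitRay → z.re < -δ := by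
  rcases le_or_gt α 1 with h | h
  · refine ⟨α / 2, by linarith, fun z hz => ?_⟩
    rw [((dampedSymbol_mem_unitRay_iff_of_le h hα z).1 hz).1]
    linarith
  · have h2 : Real.sqrt (α ^ 2 - 1) < α := by
      rw [Real.sqrt_lt' hα]; linarith
    have h3 := Real.sqrt_nonneg (α ^ 2 - 1)
    refine ⟨(α - Real.sqrt (α ^ 2 - 1)) / 2, by linarith, fun z hz => ?_⟩
    rcases (dampedSymbol_mem_unitRay_iff_of_lt h z).1 hz with h4 | ⟨-, -, h4⟩ <;> linarith

end ComplexPlane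

/-! ### Reduction of the damped matrix operator to L -/

section Damped

variable {H H₁ : Type*} [NormedAddCommGroup H] [InnerProductSpace ℂ H] [CompleteSpace H]
  [NormedAddCommGroup H₁] [NormedSpace ℂ H₁] [CompleteSpace H₁]

open scoped InnerProductSpace

/-- `A (u₁, u₂) = (u₂, -L u₁ - 2 α u₂)` in `H₁ × H`, for a space `H₁` between `H` and the domain of
the operator `L = S⁻¹ - V`. -/
structure IsDamped (A : H₁ × H →ₗ.[ℂ] H₁ × H) (L : H →ₗ.[ℂ] H) (S V : H →L[ℂ] H) (i : H₁ →L[ℂ] H)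
    (α : ℝ) : Prop where
  pert : IsPerturbedInverse L S V
  inj_i : Function.Injective i
  range_i : ∀ f, S f ∈ Set.range i
  graph : ∀ u w, (u, w) ∈ A.graph ↔
    u.2 = i w.1 ∧ (i u.1, -w.2 - (2 * α : ℂ) • u.2) ∈ L.graph

namespace IsDamped

variable {A : H₁ × H →ₗ.[ℂ] H₁ × H} {L : H →ₗ.[ℂ] H} {S V : H →L[ℂ] H} {i : H₁ →L[ℂ] H} {α : ℝ}
  (h : IsDamped A L S V i α)
include h

/-- Elimination of the second component; all comparisons between A and L are read off from this
equivalence. -/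
theorem graph_iff (z : ℂ) (u y : H₁ × H) : (u, y + z • u) ∈ A.graph ↔
    u.2 = i y.1 + z • i u.1 ∧
      (i u.1, (-y.2 - (2 * α + z) • i y.1) + dampedSymbol α z • i u.1) ∈ L.graph := by
  rw [h.graph]
  simp only [Prod.fst_add, Prod.smul_fst, Prod.snd_add, Prod.smul_snd, map_add, map_smul]
  refine and_congr_right fun h2 => ?_
  rw [h2, dampedSymbol]
  have : -(y.2 + z • (i y.1 + z • i u.1)) - (2 * α : ℂ) • (i y.1 + z • i u.1) =
      (-y.2 - (2 * α + z) • i y.1) + (-(z ^ 2 + 2 * α * z)) • i u.1 := by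
    module
  rw [this]

theorem mem_range_i {u w : H} (hu : (u, w) ∈ L.graph) : ∃ p, i p = u := by
  obtain ⟨f, rfl, -⟩ := (h.pert.graph _ _).1 hu
  exact h.range_i f

theorem mem_resolventSet_iff (z : ℂ) : z ∈ A.resolventSet ↔ dampedSymbol α z ∈ L.resolventSet := by
  rw [LinearPMap.mem_resolventSet_iff, LinearPMap.mem_resolventSet_iff]
  simp_rw [h.graph_iff]
  constructor
  · rintro ⟨R, hR⟩
    -- With data (0, -y) the eliminated equation is (L - p(z))u₁ = y, so the resolvent of L is a
    -- corner of that of A.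
    refine ⟨i ∘L ContinuousLinearMap.fst ℂ H₁ H ∘L R ∘L ContinuousLinearMap.inr ℂ H₁ H ∘L
      (-ContinuousLinearMap.id ℂ H), fun x y => ?_⟩
    have h1 : ∀ p : H₁, (R (0, -y)).1 = p ↔ (i p, y + dampedSymbol α z • i p) ∈ L.graph := by
      intro p
      constructor
      · rintro rfl
        have := ((hR _ (0, -y)).1 rfl).2
        simpa using this
      · intro hp
        rw [(hR (p, z • i p) (0, -y)).2 ⟨by simp, by simpa using hp⟩]
    show i (R (0, -y)).1 = x ↔ _
    constructor
    · rintro rfl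
      exact (h1 _).1 rfl
    · intro hx
      obtain ⟨p, rfl⟩ := h.mem_range_i hx
      rw [(h1 p).2 hx]
  · rintro ⟨R, hR⟩
    -- The first component must depend boundedly on the data in the norm of H₁, not merely in that
    -- of H.
    obtain ⟨J, hJ⟩ := ContinuousLinearMap.exists_lift_of_range_subset i h.inj_i R
      (fun y => h.mem_range_i ((hR _ y).1 rfl))
    let g : H₁ × H →L[ℂ] H := -(ContinuousLinearMap.snd ℂ H₁ H) -
      (2 * α + z) • (i ∘L ContinuousLinearMap.fst ℂ H₁ H)
    have hg : ∀ y, g y = -y.2 - (2 * α + z) • i y.1 := fun y => rfl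
    refine ⟨(J ∘L g).prod (i ∘L ContinuousLinearMap.fst ℂ H₁ H + z • (i ∘L J ∘L g)),
      fun x y => ?_⟩
    rw [← hg, ← hR]
    show (J (g y), i y.1 + z • i (J (g y))) = x ↔ _
    constructor
    · rintro rfl
      exact ⟨rfl, (hJ _).symm⟩
    · rintro ⟨h1, h2⟩
      have h3 : J (g y) = x.1 := h.inj_i (by rw [hJ, h2])
      rw [h3, ← h1]

theorem mem_opSpectrum_iff (z : ℂ) : z ∈ A.opSpectrum ↔ dampedSymbol α z ∈ L.opSpectrum :=
  (h.mem_resolventSet_iff z).not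

theorem mem_eigenspace_iff (z : ℂ) (u : H₁ × H) :
    u ∈ A.eigenspace z ↔ u.2 = z • i u.1 ∧ i u.1 ∈ L.eigenspace (dampedSymbol α z) := by
  rw [LinearPMap.mem_eigenspace_iff, LinearPMap.mem_eigenspace_iff]
  have := h.graph_iff z u 0
  simpa using this

/-- The eigenspaces of `A` and `L` are isomorphic. -/
def eigenspaceEquiv (z : ℂ) : A.eigenspace z ≃ₗ[ℂ] L.eigenspace (dampedSymbol α z) :=
  LinearEquiv.ofBijective
    ({ toFun := fun u => ⟨i u.1.1, ((h.mem_eigenspace_iff z u.1).1 u.2).2⟩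
       map_add' := fun u v => by ext; simp
       map_smul' := fun c u => by ext; simp } :
      A.eigenspace z →ₗ[ℂ] L.eigenspace (dampedSymbol α z)) <| by
    constructor
    · rintro ⟨u, hu⟩ ⟨v, hv⟩ huv
      have h1 : u.1 = v.1 := h.inj_i (congrArg Subtype.val huv)
      have h2 := ((h.mem_eigenspace_iff z u).1 hu).1
      have h3 := ((h.mem_eigenspace_iff z v).1 hv).1
      exact Subtype.ext (Prod.ext h1 (by rw [h2, h3, h1]))
    · rintro ⟨x, hx⟩
      obtain ⟨p, rfl⟩ := h.mem_range_i ((LinearPMap.mem_eigenspace_iff _ _ _).1 hx)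
      exact ⟨⟨(p, z • i p), (h.mem_eigenspace_iff z _).2 ⟨rfl, hx⟩⟩, rfl⟩

theorem mem_pointSpectrum_iff (z : ℂ) :
    z ∈ A.pointSpectrum ↔ dampedSymbol α z ∈ L.pointSpectrum := by
  rw [LinearPMap.pointSpectrum, LinearPMap.pointSpectrum, Set.mem_ofPred_eq, Set.mem_ofPred_eq,
    ne_eq, ne_eq, ← Submodule.subsingleton_iff_eq_bot, ← Submodule.subsingleton_iff_eq_bot,
    (h.eigenspaceEquiv z).toEquiv.subsingleton_congr]

/-- The range of `A - z` is the preimage of the range of `L - p(z)` under this map. -/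
def rangeMap (_ : IsDamped A L S V i α) (z : ℂ) : H₁ × H →L[ℂ] H :=
  -(ContinuousLinearMap.snd ℂ H₁ H) - (2 * α + z) • (i ∘L ContinuousLinearMap.fst ℂ H₁ H)

theorem rangeMap_apply (z : ℂ) (y : H₁ × H) :
    h.rangeMap z y = -y.2 - (2 * α + z) • i y.1 := rfl

theorem range_subScalar (z : ℂ) : (LinearMap.range (A.subScalar z) : Submodule ℂ (H₁ × H)) =
    (LinearMap.range (L.subScalar (dampedSymbol α z))).comap (h.rangeMap z : H₁ × H →ₗ[ℂ] H) := by
  ext y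
  rw [LinearPMap.mem_range_subScalar_iff, Submodule.mem_comap, LinearPMap.mem_range_subScalar_iff]
  simp_rw [h.graph_iff]
  constructor
  · rintro ⟨u, -, hu⟩
    exact ⟨i u.1, hu⟩
  · rintro ⟨x, hx⟩
    obtain ⟨p, rfl⟩ := h.mem_range_i hx
    exact ⟨(p, i y.1 + z • i p), rfl, hx⟩

/-- The range of A - z is the preimage of that of L - p(z) under `rangeMap`, which is bounded with
the continuous right inverse y ↦ (0, -y). Hence closedness and finite codimension agree. -/
theorem isFredholmAt_iff (z : ℂ) : A.IsFredholmAt z ↔ L.IsFredholmAt (dampedSymbol α z) := by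
  rw [LinearPMap.isFredholmAt_iff, LinearPMap.isFredholmAt_iff, h.range_subScalar]
  set R := LinearMap.range (L.subScalar (dampedSymbol α z))
  have hinr : ∀ y, h.rangeMap z (0, -y) = y := fun y => by simp [rangeMap_apply]
  refine and_congr ⟨fun _ => (h.eigenspaceEquiv z).finiteDimensional,
    fun _ => (h.eigenspaceEquiv z).symm.finiteDimensional⟩ (and_congr ⟨fun hc => ?_, fun hc => ?_⟩
      ⟨fun hc => ?_, fun hc => ?_⟩)
  · have h1 : (R : Set H) = (fun y : H => ((0 : H₁), -y)) ⁻¹'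
        (R.comap (h.rangeMap z : H₁ × H →ₗ[ℂ] H) : Set (H₁ × H)) := by
      ext y
      show y ∈ R ↔ h.rangeMap z (0, -y) ∈ R
      rw [hinr]
    rw [h1]
    exact hc.preimage (by fun_prop)
  · exact hc.preimage (h.rangeMap z).continuous
  · refine Module.Finite.of_surjective
      (Submodule.mapQ (R.comap (h.rangeMap z : H₁ × H →ₗ[ℂ] H)) R
        (h.rangeMap z : H₁ × H →ₗ[ℂ] H) le_rfl) ?_
    intro q
    obtain ⟨y, rfl⟩ := R.mkQ_surjective q
    refine ⟨Submodule.mkQ _ (0, -y), ?_⟩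
    rw [Submodule.mkQ_apply, Submodule.mapQ_apply]
    show R.mkQ (h.rangeMap z (0, -y)) = _
    rw [hinr]
  · refine FiniteDimensional.of_injective
      (Submodule.mapQ (R.comap (h.rangeMap z : H₁ × H →ₗ[ℂ] H)) R
        (h.rangeMap z : H₁ × H →ₗ[ℂ] H) le_rfl) ?_
    rw [← LinearMap.ker_eq_bot, Submodule.ker_mapQ, Submodule.mkQ_map_self]

theorem mem_discSpectrum_iff (z : ℂ) :
    z ∈ A.discSpectrum ↔ dampedSymbol α z ∈ L.discSpectrum := by
  rw [LinearPMap.discSpectrum, LinearPMap.discSpectrum, Set.mem_ofPred_eq, Set.mem_ofPred_eq,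
    h.isFredholmAt_iff, h.mem_opSpectrum_iff, ← eventually_dampedSymbol_iff]
  simp_rw [h.mem_opSpectrum_iff]

theorem mem_essSpectrum_iff (z : ℂ) :
    z ∈ A.essSpectrum ↔ dampedSymbol α z ∈ L.essSpectrum :=
  and_congr (h.mem_opSpectrum_iff z) (h.mem_discSpectrum_iff z).not

/-- By symmetry the range of L is orthogonal to its kernel, so L has no Jordan block. If Ax lies in
the kernel of A, then x₂ is in the kernel of L while L x₁ = -2α x₂; pairing with x₂ gives 2α‖x₂‖² =
0, and the damping α > 0 forces x₂ = 0. -/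
theorem isSimpleEigenvalue_zero (hα : 0 < α) (h1 : Module.finrank ℂ (L.eigenspace 0) = 1) :
    L.IsSimpleEigenvalue 0 ∧ A.IsSimpleEigenvalue 0 := by
  have h0 : dampedSymbol α 0 = 0 := by simp [dampedSymbol]
  have hsub : ∀ {T : H →ₗ.[ℂ] H} (x : T.domain), ((x : H), T.subScalar 0 x) ∈ T.graph :=
    fun {T} x => by simp [LinearPMap.subScalar, LinearPMap.mem_graph_iff]
  have horth : ∀ {n x w : H}, n ∈ L.eigenspace 0 → (x, w) ∈ L.graph → ⟪n, w⟫_ℂ = 0 := by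
    intro n x w hn hx
    rw [LinearPMap.mem_eigenspace_iff, zero_smul] at hn
    rw [← h.pert.symmetric hn hx, inner_zero_left]
  refine ⟨⟨h1, fun x hx => ?_⟩, ?_, fun x hx => ?_⟩
  · have h3 : L.subScalar 0 x = 0 := inner_self_eq_zero.1 (horth hx (hsub x))
    have := hsub x
    rw [h3] at this
    rw [LinearPMap.mem_eigenspace_iff, zero_smul]
    exact this
  · rw [(h.eigenspaceEquiv 0).finrank_eq, h0, h1]
  · obtain ⟨x, hxd⟩ := x
    have hg : (x, A.subScalar 0 ⟨x, hxd⟩) ∈ A.graph := by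
      simp [LinearPMap.subScalar, LinearPMap.mem_graph_iff, hxd]
    rw [h.mem_eigenspace_iff, h0, zero_smul] at hx
    obtain ⟨h4, h5⟩ := (h.graph _ _).1 hg
    rw [hx.1, neg_zero, zero_sub] at h5
    rw [← h4] at hx
    have h6 := horth hx.2 h5
    rw [inner_neg_right, neg_eq_zero, inner_smul_right, mul_eq_zero, inner_self_eq_zero] at h6
    have h7 : x.2 = 0 := h6.resolve_left (by simpa using hα.ne')
    rw [h7, smul_zero, neg_zero] at h5
    rw [h.mem_eigenspace_iff, h0, zero_smul, LinearPMap.mem_eigenspace_iff, zero_smul]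
    exact ⟨h7, h5⟩

/-- The spectrum of L is real, and on the imaginary axis Im p(z) = -2α Im z. -/
theorem opSpectrum_inter_imaginary_subset (hα : 0 < α) :
    A.opSpectrum ∩ {z : ℂ | z.re = 0} ⊆ {0} := by
  rintro z ⟨h1, h2⟩
  rw [h.mem_opSpectrum_iff] at h1
  have h3 : (dampedSymbol α z).im = 0 := by
    by_cases h4 : dampedSymbol α z ∈ unitRay
    · exact h4.1
    · exact h.pert.im_eq_zero_of_mem_pointSpectrum
        ((h.pert.isUnit_or_mem_pointSpectrum h4).resolve_left h1)
  rw [dampedSymbol_im_eq_zero_iff] at h3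
  have h2' : z.re = 0 := h2
  exact Complex.ext h2' (h3.resolve_left (by rw [h2']; linarith))

theorem zero_mem_opSpectrum_iff : (0 : ℂ) ∈ A.opSpectrum ↔ (0 : ℂ) ∈ L.pointSpectrum := by
  have h0 : dampedSymbol α 0 = 0 := by simp [dampedSymbol]
  rw [h.mem_opSpectrum_iff, h0]
  exact ⟨fun h1 => (h.pert.isUnit_or_mem_pointSpectrum (by simp [unitRay])).resolve_left h1,
    fun h1 => L.pointSpectrum_subset_opSpectrum h1⟩

theorem opSpectrum_inter_imaginary_eq_iff (hα : 0 < α) :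
    A.opSpectrum ∩ {z : ℂ | z.re = 0} = {0} ↔ (0 : ℂ) ∈ L.pointSpectrum := by
  rw [← h.zero_mem_opSpectrum_iff]
  constructor
  · intro h1
    have : (0 : ℂ) ∈ A.opSpectrum ∩ {z : ℂ | z.re = 0} := by rw [h1]; rfl
    exact this.1
  · intro h1
    refine (h.opSpectrum_inter_imaginary_subset hα).antisymm ?_
    rintro _ rfl
    exact ⟨h1, Complex.zero_re⟩

theorem dampedSymbol_mem_pointSpectrum {z : ℂ} (hz : z ∈ A.discSpectrum ∪ A.pointSpectrum) :
    dampedSymbol α z ∈ L.pointSpectrum := by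
  rcases hz with hz | hz
  · rw [h.mem_discSpectrum_iff, h.pert.discSpectrum_eq] at hz
    exact hz.1
  · exact (h.mem_pointSpectrum_iff z).1 hz

theorem mem_pointSpectrum_iff_exists (z : ℂ) : z ∈ A.pointSpectrum ↔
    ∃ μ : ℝ, (μ : ℂ) ∈ L.pointSpectrum ∧
      (z = -α + ((α : ℂ) ^ 2 - μ) ^ (1 / 2 : ℂ) ∨ z = -α - ((α : ℂ) ^ 2 - μ) ^ (1 / 2 : ℂ)) := by
  simp_rw [h.mem_pointSpectrum_iff, ← dampedSymbol_eq_iff]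
  constructor
  · intro hz
    have h1 := h.pert.im_eq_zero_of_mem_pointSpectrum hz
    have h2 : (((dampedSymbol α z).re : ℝ) : ℂ) = dampedSymbol α z :=
      Complex.ext (by simp) (by simp [h1])
    exact ⟨_, by rwa [h2], h2.symm⟩
  · rintro ⟨μ, h1, h2⟩
    rwa [h2]

/-- A nonreal z with p(z) real lies on Re z = -α, where p(z) = α² + (Im z)² > α². As an eigenvalue
of L this is at most 1, which gives α < 1. The last alternative replaces a sign hypothesis on α. -/
theorem real_or_of_mem (hL : ∀ μ : ℝ, 1 < μ → (μ : ℂ) ∉ L.pointSpectrum) {z : ℂ}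
    (hz : z ∈ A.discSpectrum ∪ A.pointSpectrum) : z.im = 0 ∨
      (z.re = -α ∧ α < 1 ∧ ∃ μ : ℝ, 0 < μ ∧ μ ≤ 1 ∧ (μ : ℂ) ∈ L.pointSpectrum ∧
          (z = -α + ((α : ℂ) ^ 2 - μ) ^ (1 / 2 : ℂ) ∨
            z = -α - ((α : ℂ) ^ 2 - μ) ^ (1 / 2 : ℂ))) ∨ α ≤ 0 := by
  have h1 := h.dampedSymbol_mem_pointSpectrum hz
  have h2 := h.pert.im_eq_zero_of_mem_pointSpectrum h1
  have h3 : (((dampedSymbol α z).re : ℝ) : ℂ) = dampedSymbol α z :=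
    Complex.ext (by simp) (by simp [h2])
  by_cases h4 : z.im = 0
  · exact Or.inl h4
  by_cases h0 : α ≤ 0
  · exact Or.inr (Or.inr h0)
  have h5 := ((dampedSymbol_im_eq_zero_iff α z).1 h2).resolve_right h4
  have h6 : (dampedSymbol α z).re = α ^ 2 + z.im ^ 2 := by
    rw [(dampedSymbol_re_im α z).1, h5]; ring
  have h7 : (dampedSymbol α z).re ≤ 1 := by
    by_contra h8
    exact hL _ (not_le.1 h8) (by rwa [h3])
  have h8 : 0 < z.im ^ 2 := by positivity
  push Not at h0
  refine Or.inr (Or.inl ⟨h5, by nlinarith, _, by rw [h6]; positivity, h7, by rwa [h3], ?_⟩)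
  rw [← dampedSymbol_eq_iff, h3]

end IsDamped

end Damped

namespace KleinGordon

variable {d : ℕ}

/-! ### Integration in polar coordinates -/

section Polar

variable [NeZero d]

instance : Nontrivial (Space d) := by
  refine ⟨⟨EuclideanSpace.single 0 1, 0, fun h => ?_⟩⟩
  have := congrArg (fun v : Space d => v 0) h
  simp at this

theorem finrank_space : Module.finrank ℝ (Space d) = d := by simp

/-- The area of the unit sphere. -/
def sphereArea (d : ℕ) : ℝ := d * (volume : Measure (Space d)).real (Metric.ball 0 1)

theorem sphereArea_pos : 0 < sphereArea d := by
  have : 0 < d := Nat.pos_of_ne_zero (NeZero.ne d)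
  refine mul_pos (by exact_mod_cast this) ?_
  exact ENNReal.toReal_pos (Metric.measure_ball_pos _ _ one_pos).ne' measure_ball_lt_top.ne

variable {F : Type*} [NormedAddCommGroup F] [NormedSpace ℝ F]

theorem integral_norm (f : ℝ → F) :
    ∫ x : Space d, f ‖x‖ = sphereArea d • ∫ r in Set.Ioi (0 : ℝ), r ^ (d - 1) • f r := by
  rw [integral_fun_norm_addHaar, finrank_space, sphereArea, mul_smul, ← Nat.cast_smul_eq_nsmul ℝ]

theorem integrable_norm_iff {f : ℝ → F} : Integrable (fun x : Space d => f ‖x‖) ↔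
    IntegrableOn (fun r : ℝ => r ^ (d - 1) • f r) (Set.Ioi 0) := by
  rw [integrable_fun_norm_addHaar, finrank_space]

theorem integrableOn_ball_norm_iff {f : ℝ → F} {R : ℝ} :
    IntegrableOn (fun x : Space d => f ‖x‖) (Metric.ball 0 R) ↔
    IntegrableOn (fun r : ℝ => r ^ (d - 1) • f r) (Set.Ioo 0 R) := by
  rw [integrableOn_fun_norm_addHaar, finrank_space]

/-- Integrate the indicator of the failure set in polar coordinates. P need not be measurable: on
the side where the hypothesis is given, the indicator vanishes almost everywhere and is therefore
integrable. -/
theorem ae_norm_iff {P : ℝ → Prop} :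
    (∀ᵐ x : Space d, P ‖x‖) ↔ ∀ᵐ r ∂(volume.restrict (Set.Ioi (0 : ℝ))), P r := by
  classical
  set f : ℝ → ℝ := fun r => if P r then 0 else 1
  have hf : ∀ r, f r = 0 ↔ P r := fun r => by simp [f]
  have hf0 : ∀ r, 0 ≤ f r := fun r => by simp only [f]; split_ifs <;> norm_num
  have h1 : ∀ᵐ r ∂(volume.restrict (Set.Ioi (0 : ℝ))), 0 ≤ r ^ (d - 1) • f r := by
    filter_upwards [ae_restrict_mem measurableSet_Ioi] with r hr
    exact mul_nonneg (pow_nonneg (le_of_lt hr) _) (hf0 r)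
  constructor
  · intro h
    have h2 : (fun x : Space d => f ‖x‖) =ᵐ[volume] 0 := by
      filter_upwards [h] with x hx using (hf _).2 hx
    have h3 : Integrable (fun x : Space d => f ‖x‖) := (integrable_congr h2).2 (integrable_zero _ _ _)
    have h4 := integral_norm (d := d) f
    rw [integral_congr_ae h2] at h4
    simp only [Pi.zero_apply, integral_zero] at h4
    have h5 := (smul_eq_zero.1 h4.symm).resolve_left sphereArea_pos.ne'
    rw [integral_eq_zero_iff_of_nonneg_ae h1 (integrable_norm_iff.1 h3)] at h5
    filter_upwards [h5, ae_restrict_mem measurableSet_Ioi] with r hr hr0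
    exact (hf r).1 ((smul_eq_zero.1 hr).resolve_left (pow_pos hr0 _).ne')
  · intro h
    have h2 : (fun r : ℝ => r ^ (d - 1) • f r) =ᵐ[volume.restrict (Set.Ioi (0 : ℝ))] 0 := by
      filter_upwards [h] with x hx
      simp [(hf _).2 hx]
    have h3 : Integrable (fun x : Space d => f ‖x‖) :=
      integrable_norm_iff.2 ((integrable_congr h2).2 (integrable_zero _ _ _))
    have h4 := integral_norm (d := d) f
    rw [integral_congr_ae h2] at h4
    simp only [Pi.zero_apply, integral_zero, smul_zero] at h4
    rw [integral_eq_zero_iff_of_nonneg (fun x => hf0 _) h3] at h4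
    filter_upwards [h4] with x hx using (hf _).1 hx

end Polar

/-! ### Radial functions as the rotation-invariant ones -/

section Invariance

/-- The action of a linear isometry on `L²`. -/
def rotate (e : Space d ≃ₗᵢ[ℝ] Space d) : L2 d →ₗᵢ[ℂ] L2 d :=
  Lp.compMeasurePreservingₗᵢ ℂ e e.measurePreserving

theorem coeFn_rotate (e : Space d ≃ₗᵢ[ℝ] Space d) (u : L2 d) :
    rotate e u =ᵐ[volume] fun x => u (e x) :=
  Lp.coeFn_compMeasurePreserving u e.measurePreserving

theorem ae_comp_isometry (e : Space d ≃ₗᵢ[ℝ] Space d) {P : Space d → Prop}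
    (h : ∀ᵐ x, P x) : ∀ᵐ x, P (e x) :=
  e.measurePreserving.quasiMeasurePreserving.ae h

theorem exists_isometry_of_norm_eq {v w : Space d} (h : ‖v‖ = ‖w‖) :
    ∃ e : Space d ≃ₗᵢ[ℝ] Space d, e v = w :=
  ⟨_, Submodule.reflection_sub h⟩

/-- A locally integrable function which is invariant under linear isometries is radial. -/
theorem exists_radial_of_invariant {u : Space d → ℂ} (hu : LocallyIntegrable u)
    (h : ∀ e : Space d ≃ₗᵢ[ℝ] Space d, (fun x => u (e x)) =ᵐ[volume] u) :
    ∃ g : ℝ → ℂ, u =ᵐ[volume] fun x => g ‖x‖ := by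
  classical
  -- The invariance of u holds off a null set depending on e, but ball averages are invariant at
  -- every point; by Lebesgue differentiation they converge to u almost everywhere.
  let m : ℕ → Space d → ℂ := fun n x => ⨍ y in Metric.closedBall x (1 / ((n : ℝ) + 1)), u y
  have hinv : ∀ n (e : Space d ≃ₗᵢ[ℝ] Space d) x, m n (e x) = m n x := by
    intro n e x
    have h1 : e ⁻¹' Metric.closedBall (e x) (1 / ((n : ℝ) + 1)) =
        Metric.closedBall x (1 / ((n : ℝ) + 1)) := by
      ext y; simp
    simp only [m, setAverage_eq]
    have h2 : volume.real (Metric.closedBall (e x) (1 / ((n : ℝ) + 1))) =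
        volume.real (Metric.closedBall x (1 / ((n : ℝ) + 1))) := by
      rw [measureReal_def, measureReal_def, ← e.measurePreserving.measure_preimage
        measurableSet_closedBall.nullMeasurableSet, h1]
    have h3 := e.measurePreserving.setIntegral_preimage_emb e.toHomeomorph.measurableEmbedding u
      (Metric.closedBall (e x) (1 / ((n : ℝ) + 1)))
    rw [h1] at h3
    rw [h2, ← h3, setIntegral_congr_ae measurableSet_closedBall]
    filter_upwards [h e] with y hy _ using hy
  have hlim : ∀ᵐ x, Tendsto (fun n => m n x) atTop (𝓝 (u x)) := by
    filter_upwards [IsUnifLocDoublingMeasure.ae_tendsto_average volume hu 1] with x hx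
    refine hx (fun _ => x) (fun n : ℕ => 1 / ((n : ℝ) + 1)) ?_ ?_
    · refine tendsto_nhdsWithin_iff.2 ⟨tendsto_one_div_add_atTop_nhds_zero_nat, ?_⟩
      exact Eventually.of_forall fun n => by simp only [Set.mem_Ioi]; positivity
    · refine Eventually.of_forall fun n => Metric.mem_closedBall_self ?_
      positivity
  -- The profile at r is the limit of the averages at one chosen point of the sphere; an isometry
  -- moves that point to any other.
  refine ⟨fun r => if hr : ∃ x : Space d, ‖x‖ = r then limUnder atTop (fun n => m n hr.choose)
    else 0, ?_⟩
  filter_upwards [hlim] with x hx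
  have hr : ∃ y : Space d, ‖y‖ = ‖x‖ := ⟨x, rfl⟩
  rw [dif_pos hr]
  obtain ⟨e, he⟩ := exists_isometry_of_norm_eq hr.choose_spec.symm
  have : (fun n => m n hr.choose) = fun n => m n x := by
    funext n; rw [← he, hinv]
  rw [this, hx.limUnder_eq]

/-- Unlike the existence of a profile, invariance is visibly a closed condition and commutes with
the Fourier transform. -/
theorem mem_L2rad_iff (u : L2 d) : u ∈ L2rad d ↔ ∀ e, rotate e u = u := by
  constructor
  · rintro ⟨g, hg⟩ e
    apply Lp.ext
    filter_upwards [hg, ae_comp_isometry e hg, coeFn_rotate e u] with x h1 h2 h3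
    rw [h3, h2, h1, e.norm_map]
  · intro h
    refine exists_radial_of_invariant ((Lp.memLp u).locallyIntegrable (by norm_num)) fun e => ?_
    have := coeFn_rotate e u
    rw [h e] at this
    exact this.symm

theorem isClosed_L2rad : IsClosed (L2rad d : Set (L2 d)) := by
  have : (L2rad d : Set (L2 d)) = ⋂ e, {u | rotate e u = u} := by
    ext u; simp [mem_L2rad_iff]
  rw [this]
  exact isClosed_iInter fun e => isClosed_eq (rotate e).continuous continuous_id

instance : CompleteSpace (L2rad d) := isClosed_L2rad.completeSpace_coe

open FourierTransform in
theorem fourier_rotate (e : Space d ≃ₗᵢ[ℝ] Space d) (u : L2 d) :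
    𝓕 (rotate e u) = rotate e (𝓕 u) := by
  apply DenseRange.induction_on (p := fun u : L2 d => 𝓕 (rotate e u) = rotate e (𝓕 u))
    (SchwartzMap.denseRange_toLpCLM (p := 2) ENNReal.ofNat_ne_top) u
  · refine isClosed_eq ?_ ?_
    · exact (Lp.fourierTransformₗᵢ (Space d) ℂ).continuous.comp (rotate e).continuous
    · exact (rotate e).continuous.comp (Lp.fourierTransformₗᵢ (Space d) ℂ).continuous
  · intro f
    have key : ∀ ψ : 𝓢(Space d, ℂ), rotate e (ψ.toLp 2) =
        (SchwartzMap.compCLMOfContinuousLinearEquiv ℂ e.toContinuousLinearEquiv ψ).toLp 2 := by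
      intro ψ
      apply Lp.ext
      filter_upwards [coeFn_rotate e (ψ.toLp 2), ae_comp_isometry e (ψ.coeFn_toLp 2 volume),
        (SchwartzMap.compCLMOfContinuousLinearEquiv ℂ e.toContinuousLinearEquiv ψ).coeFn_toLp 2
          volume] with x h1 h2 h3
      rw [h1, h2, h3]; rfl
    simp only [SchwartzMap.toLpCLM_apply]
    rw [key, SchwartzMap.toLp_fourier_eq, SchwartzMap.toLp_fourier_eq, key]
    congr 1
    ext x
    rw [SchwartzMap.fourier_coe]
    exact Real.fourier_comp_linearIsometry e f x

open FourierTransform in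
theorem fourier_mem_L2rad_iff (u : L2 d) : 𝓕 u ∈ L2rad d ↔ u ∈ L2rad d := by
  rw [mem_L2rad_iff, mem_L2rad_iff]
  refine forall_congr' fun e => ?_
  rw [← fourier_rotate]
  exact (Lp.fourierTransformₗᵢ (Space d) ℂ).injective.eq_iff

end Invariance

/-! ### Bounded multiplication operators -/

section Multiplication

/-- Multiplication by a bounded measurable function (and zero for other functions). -/
def mulOp (a : Space d → ℂ) : L2 d →L[ℂ] L2 d :=
  open Classical in
  if h : MemLp a ∞ volume then (ContinuousLinearMap.mul ℂ ℂ).holderL volume ∞ 2 2 (h.toLp a) else 0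

theorem coeFn_mulOp {a : Space d → ℂ} (h : MemLp a ∞ volume) (u : L2 d) :
    mulOp a u =ᵐ[volume] fun x => a x * u x := by
  rw [mulOp, dif_pos h]
  filter_upwards [(ContinuousLinearMap.mul ℂ ℂ).coeFn_holder (r := 2) (h.toLp a) u,
    h.coeFn_toLp] with x h1 h2
  rw [← h2]
  exact h1

theorem mulOp_mem_L2rad {a : Space d → ℂ} (h : MemLp a ∞ volume)
    (ha : ∃ g : ℝ → ℂ, a =ᵐ[volume] fun x => g ‖x‖) {u : L2 d} (hu : u ∈ L2rad d) :
    mulOp a u ∈ L2rad d := by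
  obtain ⟨g, hg⟩ := ha
  obtain ⟨k, hk⟩ := hu
  refine ⟨fun r => g r * k r, ?_⟩
  filter_upwards [coeFn_mulOp h u, hg, hk] with x h1 h2 h3
  rw [h1, h2, h3]

theorem memLp_top_of_continuous_bound {a : Space d → ℂ} (ha : Measurable a) (C : ℝ)
    (hC : ∀ x, ‖a x‖ ≤ C) : MemLp a ∞ volume :=
  memLp_top_of_bound ha.aestronglyMeasurable C (Eventually.of_forall hC)

theorem norm_mulOp_le {a : Space d → ℂ} (ha : MemLp a ∞ volume) {C : ℝ}
    (hC : ∀ᵐ x, ‖a x‖ ≤ C) (u : L2 d) : ‖mulOp a u‖ ≤ C * ‖u‖ := by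
  apply Lp.norm_le_mul_norm_of_ae_le_mul
  filter_upwards [coeFn_mulOp ha u, hC] with x h1 h2
  rw [h1, norm_mul]
  gcongr

open scoped InnerProductSpace in
theorem inner_mulOp {a : Space d → ℂ} (ha : MemLp a ∞ volume) (hr : ∀ᵐ x, (a x).im = 0)
    (u v : L2 d) : ⟪mulOp a u, v⟫_ℂ = ⟪u, mulOp a v⟫_ℂ := by
  rw [L2.inner_def, L2.inner_def]
  apply integral_congr_ae
  filter_upwards [coeFn_mulOp ha u, coeFn_mulOp ha v, hr] with x h1 h2 h3
  rw [h1, h2, RCLike.inner_apply, RCLike.inner_apply, map_mul,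
    show (starRingEnd ℂ) (a x) = a x from Complex.conj_eq_iff_im.2 h3]
  ring

end Multiplication

end KleinGordon

namespace KleinGordon

variable {d : ℕ}

/-! ### The free resolvent as a radial Fourier multiplier -/

section RadialOperators

/-- Multiplication by `g(|x|)` on radial functions. -/
def radMul (d : ℕ) (g : ℝ → ℂ) : L2rad d →L[ℂ] L2rad d :=
  ((mulOp fun x : Space d => g ‖x‖) ∘L (L2rad d).subtypeL).codRestrict (L2rad d) fun u => by
    by_cases h : MemLp (fun x : Space d => g ‖x‖) ∞ volume
    · exact mulOp_mem_L2rad h ⟨g, EventuallyEq.rfl⟩ u.2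
    · have : mulOp (fun x : Space d => g ‖x‖) = 0 := by rw [mulOp, dif_neg h]
      simp [this]

theorem coeFn_radMul {g : ℝ → ℂ} (hg : MemLp (fun x : Space d => g ‖x‖) ∞ volume) (u : L2rad d) :
    ((radMul d g u : L2 d) : Space d → ℂ) =ᵐ[volume] fun x => g ‖x‖ * (u : L2 d) x :=
  coeFn_mulOp hg u

open FourierTransform in
/-- The Fourier transform as a unitary operator on radial functions. -/
def radFourier (d : ℕ) : L2rad d ≃ₗᵢ[ℂ] L2rad d where
  toFun u := ⟨𝓕 (u : L2 d), (fourier_mem_L2rad_iff _).2 u.2⟩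
  invFun u := ⟨𝓕⁻ (u : L2 d), (fourier_mem_L2rad_iff _).1 (by rw [fourier_fourierInv_eq]; exact u.2)⟩
  left_inv u := Subtype.ext (fourierInv_fourier_eq (u : L2 d))
  right_inv u := Subtype.ext (fourier_fourierInv_eq (u : L2 d))
  map_add' u v := Subtype.ext (FourierTransform.fourier_add (u : L2 d) (v : L2 d))
  map_smul' c u := Subtype.ext (FourierTransform.fourier_smul c (u : L2 d))
  norm_map' u := Lp.norm_fourier_eq (u : L2 d)

/-- The radial Fourier multiplier with symbol `g(|ξ|)`. -/
def radFourierMul (d : ℕ) (g : ℝ → ℂ) : L2rad d →L[ℂ] L2rad d :=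
  ((radFourier d).symm : L2rad d →L[ℂ] L2rad d) ∘L radMul d g ∘L (radFourier d : L2rad d →L[ℂ] L2rad d)

theorem radFourier_radFourierMul (g : ℝ → ℂ) (u : L2rad d) :
    radFourier d (radFourierMul d g u) = radMul d g (radFourier d u) :=
  (radFourier d).apply_symm_apply _

/-- The symbol `(1 + 4π²r²)⁻¹` of `(-Δ + 1)⁻¹`. -/
def resSymbol (r : ℝ) : ℝ := (1 + (2 * Real.pi) ^ 2 * r ^ 2)⁻¹

theorem resSymbol_pos (r : ℝ) : 0 < resSymbol r := by unfold resSymbol; positivity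

theorem resSymbol_le_one (r : ℝ) : resSymbol r ≤ 1 := by
  unfold resSymbol
  apply inv_le_one_of_one_le₀
  have : 0 ≤ (2 * Real.pi) ^ 2 * r ^ 2 := by positivity
  linarith

theorem continuous_resSymbol : Continuous resSymbol := by
  unfold resSymbol
  refine Continuous.inv₀ (by fun_prop) fun r => ?_
  positivity

/-- The resolvent `(-Δ + 1)⁻¹` on radial functions. -/
def freeRes (d : ℕ) : L2rad d →L[ℂ] L2rad d := radFourierMul d (fun r => (resSymbol r : ℂ))

theorem memLp_resSymbol : MemLp (fun x : Space d => (resSymbol ‖x‖ : ℂ)) ∞ volume :=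
  memLp_top_of_continuous_bound
    (Complex.continuous_ofReal.comp (continuous_resSymbol.comp continuous_norm)).measurable 1
    fun x => by
      rw [Complex.norm_real, Real.norm_of_nonneg (resSymbol_pos _).le]; exact resSymbol_le_one _

theorem coeFn_fourier_freeRes (f : L2rad d) :
    ((radFourier d (freeRes d f) : L2 d) : Space d → ℂ) =ᵐ[volume]
      fun x => resSymbol ‖x‖ * (radFourier d f : L2 d) x := by
  rw [freeRes, radFourier_radFourierMul]
  exact coeFn_radMul memLp_resSymbol _

open scoped InnerProductSpace

theorem inner_freeRes (f g : L2rad d) : ⟪freeRes d f, g⟫_ℂ = ⟪f, freeRes d g⟫_ℂ := by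
  rw [← (radFourier d).inner_map_map, ← (radFourier d).inner_map_map f, freeRes,
    radFourier_radFourierMul, radFourier_radFourierMul]
  exact inner_mulOp memLp_resSymbol (Eventually.of_forall fun x => Complex.ofReal_im _) _ _

theorem eq_zero_of_fourier_mul {f g : L2rad d} (hg : g = 0) {a : Space d → ℂ}
    (h : ((g : L2 d) : Space d → ℂ) =ᵐ[volume] fun x => a x * (radFourier d f : L2 d) x)
    (ha : ∀ᵐ x, a x ≠ 0) : f = 0 := by
  subst hg
  apply (radFourier d).injective
  rw [map_zero]
  refine Subtype.ext (Lp.ext ?_)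
  show _ =ᵐ[volume] ((0 : L2 d) : Space d → ℂ)
  have h' : ((0 : L2 d) : Space d → ℂ) =ᵐ[volume] fun x => a x * (radFourier d f : L2 d) x := h
  filter_upwards [h', Lp.coeFn_zero ℂ 2 (volume : Measure (Space d)), ha] with x h1 h2 h3
  rw [h2] at h1 ⊢
  exact (mul_eq_zero.1 h1.symm).resolve_left h3

theorem freeRes_injective (f : L2rad d) (hf : freeRes d f = 0) : f = 0 := by
  exact eq_zero_of_fourier_mul (by rw [hf, map_zero]) (coeFn_fourier_freeRes f)
    (Eventually.of_forall fun x => by exact_mod_cast (resSymbol_pos _).ne')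

theorem one_sub_smul_resSymbol_ne_zero {w : ℂ} (hw : w ∉ unitRay) {t : ℝ} (h0 : 0 ≤ t)
    (h1 : t ≤ 1) : 1 - w * t ≠ 0 := by
  intro h
  have ht : t ≠ 0 := by rintro rfl; simp at h
  have h2 : w = ((t⁻¹ : ℝ) : ℂ) := by
    have : (t : ℂ) ≠ 0 := by exact_mod_cast ht
    rw [Complex.ofReal_inv]
    field_simp
    linear_combination -h
  apply hw
  rw [h2]
  exact ⟨Complex.ofReal_im _, by
    rw [Complex.ofReal_re]; exact (one_le_inv₀ (lt_of_le_of_ne h0 ht.symm)).2 h1⟩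

theorem coeFn_fourier_one_sub (w : ℂ) (f : L2rad d) :
    ((radFourier d ((1 - w • freeRes d) f) : L2 d) : Space d → ℂ) =ᵐ[volume]
      fun x => (1 - w * resSymbol ‖x‖) * (radFourier d f : L2 d) x := by
  have h : (radFourier d ((1 - w • freeRes d) f) : L2 d) =
      (radFourier d f : L2 d) - w • (radFourier d (freeRes d f) : L2 d) := by
    show (radFourier d (f - w • freeRes d f) : L2 d) = _
    rw [map_sub, map_smul]; rfl
  rw [h]
  filter_upwards [coeFn_fourier_freeRes f, Lp.coeFn_sub (radFourier d f : L2 d)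
    (w • (radFourier d (freeRes d f) : L2 d)),
    Lp.coeFn_smul w (radFourier d (freeRes d f) : L2 d)] with x h1 h2 h3
  rw [h2, Pi.sub_apply, h3, Pi.smul_apply, h1, smul_eq_mul]
  ring

/-- The symbol takes values in [0,1], where 1 - wt has no zero; by compactness its reciprocal is
bounded, and the inverse is the corresponding multiplier. -/
theorem isUnit_one_sub_freeRes {w : ℂ} (hw : w ∉ unitRay) : IsUnit (1 - w • freeRes d) := by
  have hcont : ContinuousOn (fun t : ℝ => ‖(1 - w * t)⁻¹‖) (Set.Icc 0 1) := by
    refine ContinuousOn.norm (ContinuousOn.inv₀ (by fun_prop) fun t ht => ?_)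
    exact one_sub_smul_resSymbol_ne_zero hw ht.1 ht.2
  obtain ⟨C, hC⟩ := isCompact_Icc.bddAbove_image hcont
  have hC' : ∀ r, ‖(1 - w * resSymbol r)⁻¹‖ ≤ C := fun r =>
    hC ⟨resSymbol r, ⟨(resSymbol_pos r).le, resSymbol_le_one r⟩, rfl⟩
  set g : ℝ → ℂ := fun r => (1 - w * resSymbol r)⁻¹
  have hgm : MemLp (fun x : Space d => g ‖x‖) ∞ volume := by
    refine memLp_top_of_continuous_bound (Continuous.measurable ?_) C fun x => hC' _
    refine Continuous.inv₀ ?_ fun x =>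
      one_sub_smul_resSymbol_ne_zero hw (resSymbol_pos _).le (resSymbol_le_one _)
    have := continuous_resSymbol
    fun_prop
  have hne : ∀ r, 1 - w * resSymbol r ≠ 0 := fun r =>
    one_sub_smul_resSymbol_ne_zero hw (resSymbol_pos _).le (resSymbol_le_one _)
  rw [ContinuousLinearMap.isUnit_iff_bijective]
  constructor
  · rw [injective_iff_map_eq_zero]
    intro f hf
    exact eq_zero_of_fourier_mul (by rw [hf, map_zero]) (coeFn_fourier_one_sub w f)
      (Eventually.of_forall fun x => hne _)
  · intro y
    refine ⟨radFourierMul d g y, (radFourier d).injective (Subtype.ext (Lp.ext ?_))⟩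
    filter_upwards [coeFn_fourier_one_sub w (radFourierMul d g y), coeFn_radMul hgm
      (radFourier d y)] with x h1 h2
    rw [h1, radFourier_radFourierMul, h2, mul_inv_cancel_left₀ (hne _)]

variable [NeZero d]

/-- `resSymbol` is injective on r > 0, so 1 - w·`resSymbol` vanishes on at most one sphere, a null
set. -/
theorem one_sub_freeRes_injective (w : ℂ) (f : L2rad d) (hf : f = w • freeRes d f) : f = 0 := by
  have hf' : (1 - w • freeRes d) f = 0 := by
    show f - w • freeRes d f = 0
    rw [← hf, sub_self]
  have hsub : {r : ℝ | 0 < r ∧ 1 - w * resSymbol r = 0}.Subsingleton := by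
    rintro r ⟨hr0, hr⟩ s ⟨hs0, hs⟩
    have hw : w ≠ 0 := by rintro rfl; simp at hr
    have h1 : (resSymbol r : ℂ) = resSymbol s := mul_left_cancel₀ hw (by linear_combination hs - hr)
    have h2 : resSymbol r = resSymbol s := by exact_mod_cast h1
    rw [resSymbol, resSymbol, inv_inj] at h2
    have h3 : r ^ 2 = s ^ 2 := by
      have : (0 : ℝ) < (2 * Real.pi) ^ 2 := by positivity
      exact mul_left_cancel₀ this.ne' (by linarith)
    exact (pow_left_inj₀ hr0.le hs0.le two_ne_zero).1 h3
  have hae : ∀ᵐ x : Space d, 1 - w * resSymbol ‖x‖ ≠ 0 := by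
    refine (ae_norm_iff (P := fun r => 1 - w * (resSymbol r : ℂ) ≠ 0)).2 ?_
    rw [ae_restrict_iff' measurableSet_Ioi, ae_iff]
    refine Set.Subsingleton.measure_zero (hsub.anti ?_) _
    intro r hr
    simp only [Set.mem_Ioi, ne_eq, Classical.not_imp, not_not, Set.mem_ofPred_eq] at hr
    exact hr
  exact eq_zero_of_fourier_mul (by rw [hf', map_zero]) (coeFn_fourier_one_sub w f) hae

/-- Approximate eigenvectors: in Fourier variables, take the indicator of an annulus so thin near
the zero of the multiplier that the bound given by an inverse fails. -/
theorem not_isUnit_one_sub_freeRes {w : ℂ} (hw : w ∈ unitRay) : ¬ IsUnit (1 - w • freeRes d) := by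
  rintro ⟨B, hB⟩
  set K := ‖(B⁻¹ : (L2rad d →L[ℂ] L2rad d)ˣ).1‖ with hK
  have hKn : 0 ≤ K := norm_nonneg (B⁻¹ : (L2rad d →L[ℂ] L2rad d)ˣ).1
  have hwr : w = (w.re : ℂ) := Complex.ext rfl (by simp [hw.1])
  have hbound : ∀ f : L2rad d, ‖f‖ ≤ K * ‖(1 - w • freeRes d) f‖ := by
    intro f
    have : (B⁻¹ : (L2rad d →L[ℂ] L2rad d)ˣ).1 ((1 - w • freeRes d) f) = f := by
      rw [← hB, ← mul_apply_eq_comp, Units.inv_mul, one_apply_eq_self]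
    conv_lhs => rw [← this]
    exact ContinuousLinearMap.le_opNorm _ _
  -- The radius at which 1 + 4π²k² = w.
  set k : ℝ := Real.sqrt (w.re - 1) / (2 * Real.pi) with hk
  have hk0 : 0 ≤ k := by positivity
  have hzero : 1 - w * resSymbol k = 0 := by
    have h1 : (2 * Real.pi) ^ 2 * k ^ 2 = w.re - 1 := by
      rw [hk, div_pow, Real.sq_sqrt (by linarith [hw.2])]
      field_simp
    rw [resSymbol, h1, hwr, ← Complex.ofReal_mul, ← Complex.ofReal_one, ← Complex.ofReal_sub]
    simp only [Complex.ofReal_re]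
    rw [add_sub_cancel, mul_inv_cancel₀ (by linarith [hw.2]), sub_self, Complex.ofReal_zero]
  have hc : Continuous fun r : ℝ => K * ‖1 - w * resSymbol r‖ := by
    have := continuous_resSymbol
    fun_prop
  obtain ⟨ε, hε, hball⟩ := Metric.mem_nhds_iff.1
    ((hc.tendsto k).eventually_lt_const (u := 1 / 2) (by simp [hzero]))
  -- The annulus lies on one side of k, so the case k = 0 needs no separate treatment.
  set A : Set (Space d) := {x | k < ‖x‖ ∧ ‖x‖ < k + ε}
  have hAo : IsOpen A := (isOpen_lt continuous_const continuous_norm).inter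
    (isOpen_lt continuous_norm continuous_const)
  have hAfin : volume A ≠ ⊤ := by
    refine ((measure_mono ?_).trans_lt (measure_ball_lt_top (x := (0 : Space d)) (r := k + ε))).ne
    intro x hx
    simpa using hx.2
  have hApos : volume A ≠ 0 := by
    refine (hAo.measure_pos volume ⟨EuclideanSpace.single 0 (k + ε / 2), ?_⟩).ne'
    simp only [A, Set.mem_ofPred_eq, PiLp.norm_single, Real.norm_eq_abs]
    rw [abs_of_nonneg (by positivity)]
    constructor <;> linarith
  set v0 : L2 d := indicatorConstLp 2 hAo.measurableSet hAfin (1 : ℂ)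
  have hv0r : v0 ∈ L2rad d := by
    refine ⟨Set.indicator {r | k < r ∧ r < k + ε} fun _ => 1, ?_⟩
    exact indicatorConstLp_coeFn
  set v : L2rad d := ⟨v0, hv0r⟩
  have hvne : v ≠ 0 := by
    intro h
    have h1 : v0 = 0 := congrArg Subtype.val h
    have h2 : ‖v0‖ = 0 := by rw [h1, norm_zero]
    rw [norm_indicatorConstLp (by norm_num) (by norm_num), norm_one, one_mul,
      Real.rpow_eq_zero measureReal_nonneg (by norm_num)] at h2
    exact (ENNReal.toReal_pos hApos hAfin).ne' h2
  set f := (radFourier d).symm v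
  have hf : radFourier d f = v := (radFourier d).apply_symm_apply v
  have h1 : ‖((radFourier d ((1 - w • freeRes d) f) : L2rad d) : L2 d)‖ * K ≤ 1 / 2 * ‖v0‖ := by
    have hx : ‖((K : ℂ) • (radFourier d ((1 - w • freeRes d) f) : L2 d))‖ ≤ 1 / 2 * ‖v0‖ := by
      apply Lp.norm_le_mul_norm_of_ae_le_mul
      filter_upwards [coeFn_fourier_one_sub w f, Lp.coeFn_smul (K : ℂ)
        (radFourier d ((1 - w • freeRes d) f) : L2 d),
        indicatorConstLp_coeFn (p := 2) (hs := hAo.measurableSet) (hμs := hAfin) (c := (1 : ℂ))]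
        with x hx1 hx2 hx3
      rw [hx2, Pi.smul_apply, hx1, hf]
      show ‖(K : ℂ) • ((1 - w * resSymbol ‖x‖) * v0 x)‖ ≤ 1 / 2 * ‖v0 x‖
      rw [hx3]
      by_cases hxA : x ∈ A
      · rw [Set.indicator_of_mem hxA, mul_one, norm_smul, Complex.norm_real,
          Real.norm_of_nonneg hKn, norm_one, mul_one]
        refine le_of_lt (hball (?_ : ‖x‖ ∈ Metric.ball k ε))
        rw [Metric.mem_ball, Real.dist_eq, abs_of_pos (by linarith [hxA.1])]
        linarith [hxA.2]
      · rw [Set.indicator_of_notMem hxA]; simp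
    rw [norm_smul, Complex.norm_real, Real.norm_of_nonneg hKn] at hx
    rwa [mul_comm]
  have h2 : ‖f‖ = ‖v0‖ := by rw [← (radFourier d).norm_map f, hf]; rfl
  have h3 : ‖(1 - w • freeRes d) f‖ = ‖((radFourier d ((1 - w • freeRes d) f) : L2rad d) : L2 d)‖ := by
    rw [← (radFourier d).norm_map]; rfl
  have h4 := hbound f
  have h5 : 0 < ‖f‖ := by
    rw [← (radFourier d).norm_map f, hf]; exact norm_pos_iff.2 hvne
  rw [h3] at h4
  linarith [mul_comm K ‖((radFourier d ((1 - w • freeRes d) f) : L2rad d) : L2 d)‖]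

end RadialOperators

/-! ### Sobolev spaces and the range of the free resolvent -/

section Sobolev

/-- Converts distributional identities on the Fourier side into almost everywhere identities;
compactly supported smooth test functions suffice. -/
theorem smulLeftCLM_toDist_iff {p : Space d → ℂ} (hp : p.HasTemperateGrowth) (v w : L2 d) :
    TemperedDistribution.smulLeftCLM ℂ p (toDist v) = toDist w ↔
      (w : Space d → ℂ) =ᵐ[volume] fun x => p x * v x := by
  have hvl : LocallyIntegrable (fun x => p x * v x) :=
    ((Lp.memLp v).locallyIntegrable (by norm_num)).continuous_mul hp.1.continuous
  have hwl : LocallyIntegrable (fun x => w x) := (Lp.memLp w).locallyIntegrable (by norm_num)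
  have h1 : ∀ ψ : 𝓢(Space d, ℂ), TemperedDistribution.smulLeftCLM ℂ p (toDist v) ψ =
      ∫ x, ψ x * (p x * v x) := by
    intro ψ
    rw [TemperedDistribution.smulLeftCLM_apply_apply]
    refine (Lp.toTemperedDistribution_apply v _).trans (integral_congr_ae (Eventually.of_forall ?_))
    intro x
    simp only [SchwartzMap.smulLeftCLM_apply_apply hp, smul_eq_mul]
    ring
  have h2 : ∀ ψ : 𝓢(Space d, ℂ), toDist w ψ = ∫ x, ψ x * w x := fun ψ =>
    Lp.toTemperedDistribution_apply w _
  constructor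
  · intro h
    refine EventuallyEq.symm (f := fun x => p x * v x) (g := w)
      (ae_eq_of_integral_contDiff_smul_eq hvl hwl ?_)
    intro g hg hgc
    have hg₁ : HasCompactSupport (Complex.ofRealCLM ∘ g) := hgc.comp_left rfl
    have hg₂ : ContDiff ℝ ∞ (Complex.ofRealCLM ∘ g) := by fun_prop
    have h3 := congrArg (fun T : 𝓢'(Space d, ℂ) => T (hg₁.toSchwartzMap hg₂)) h
    simp only [h1, h2] at h3
    exact h3
  · intro h
    ext ψ
    rw [h1, h2]
    refine integral_congr_ae ?_
    filter_upwards [h] with x hx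
    rw [hx]

open FourierTransform in
theorem fourier_toDist (u : L2rad d) : 𝓕 (toDist (u : L2 d)) = toDist (radFourier d u : L2 d) :=
  Lp.fourier_toTemperedDistribution_eq (u : L2 d)

open FourierTransform in
theorem free_equation_iff (u f : L2rad d) :
    toDist (f : L2 d) = -Δ (toDist (u : L2 d)) + toDist (u : L2 d) ↔
      (radFourier d f : L2 d) =ᵐ[volume]
        fun x => (1 + (2 * Real.pi) ^ 2 * ‖x‖ ^ 2 : ℂ) * (radFourier d u : L2 d) x := by
  have hsq : (fun x : Space d => Complex.ofReal (‖x‖ ^ 2)).HasTemperateGrowth := by fun_prop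
  have hp : (fun x : Space d => (1 + (2 * Real.pi) ^ 2 * ‖x‖ ^ 2 : ℂ)).HasTemperateGrowth := by
    have h1 : (fun x : Space d => (1 + (2 * Real.pi) ^ 2 * ‖x‖ ^ 2 : ℂ)) =
        fun x => (1 : ℂ) + (2 * Real.pi) ^ 2 * Complex.ofReal (‖x‖ ^ 2) := by
      ext x; push_cast; ring
    rw [h1]
    fun_prop
  rw [← smulLeftCLM_toDist_iff hp]
  have h2 : 𝓕 (-Δ (toDist (u : L2 d)) + toDist (u : L2 d)) =
      TemperedDistribution.smulLeftCLM ℂ (fun x : Space d => (1 + (2 * Real.pi) ^ 2 * ‖x‖ ^ 2 : ℂ))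
        (toDist (radFourier d u : L2 d)) := by
    rw [FourierTransform.fourier_add, fourier_toDist,
      TemperedDistribution.laplacian_eq_fourierMultiplierCLM,
      TemperedDistribution.fourierMultiplierCLM_apply, fourier_toDist]
    have h3 : (fun x : Space d => (1 + (2 * Real.pi) ^ 2 * ‖x‖ ^ 2 : ℂ)) =
        (fun _ => (1 : ℂ)) + ((2 * Real.pi : ℂ) ^ 2) • fun x => Complex.ofReal (‖x‖ ^ 2) := by
      ext x; simp
    rw [h3, TemperedDistribution.smulLeftCLM_add (by fun_prop) (by fun_prop),
      TemperedDistribution.smulLeftCLM_smul hsq, add_comm]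
    have h4 : (-(-(2 * Real.pi) ^ 2 • 𝓕⁻ (TemperedDistribution.smulLeftCLM ℂ
        (fun x : Space d => Complex.ofReal (‖x‖ ^ 2)) (toDist (radFourier d u : L2 d)))) :
          𝓢'(Space d, ℂ)) =
        ((2 * Real.pi : ℂ) ^ 2) • 𝓕⁻ (TemperedDistribution.smulLeftCLM ℂ
        (fun x : Space d => Complex.ofReal (‖x‖ ^ 2)) (toDist (radFourier d u : L2 d))) := by
      generalize 𝓕⁻ (TemperedDistribution.smulLeftCLM ℂ
        (fun x : Space d => Complex.ofReal (‖x‖ ^ 2)) (toDist (radFourier d u : L2 d))) = T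
      ext ψ
      show -((-(2 * Real.pi) ^ 2 : ℝ) • T ψ) = ((2 * Real.pi : ℂ) ^ 2) • T ψ
      rw [neg_smul, neg_neg, ← Complex.coe_smul]
      norm_cast
    rw [h4, FourierTransform.fourier_smul, fourier_fourierInv_eq]
    ext ψ
    simp
  rw [← h2, ← fourier_toDist]
  constructor
  · intro h; rw [h]
  · intro h
    have := congrArg (fun T : 𝓢'(Space d, ℂ) => 𝓕⁻ T) h
    simp only [fourierInv_fourier_eq] at this
    exact this.symm

theorem mem_H2rad_iff (u : L2rad d) : u ∈ H2rad d ↔ ∃ w : L2 d,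
    (w : Space d → ℂ) =ᵐ[volume] fun x => (1 + ‖x‖ ^ 2 : ℂ) * (radFourier d u : L2 d) x := by
  have hp : (fun x : Space d => (((1 + ‖x‖ ^ 2) ^ ((2 : ℝ) / 2) : ℝ) : ℂ)).HasTemperateGrowth := by
    fun_prop
  show TemperedDistribution.MemSobolev 2 2 (toDist (u : L2 d)) ↔ _
  rw [TemperedDistribution.memSobolev_iff_exists_smulLeftCLM_fourier, fourier_toDist]
  refine exists_congr fun w => ?_
  refine (smulLeftCLM_toDist_iff hp _ w).trans ?_
  simp only [div_self (two_ne_zero' ℝ), Real.rpow_one, Complex.ofReal_add, Complex.ofReal_one,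
    Complex.ofReal_pow]

theorem freeRes_equation (f : L2rad d) : toDist (f : L2 d) =
    -Δ (toDist (freeRes d f : L2 d)) + toDist (freeRes d f : L2 d) := by
  rw [free_equation_iff]
  filter_upwards [coeFn_fourier_freeRes f] with x hx
  rw [hx, resSymbol, ← mul_assoc]
  have h : ((1 + (2 * Real.pi) ^ 2 * ‖x‖ ^ 2 : ℝ) : ℂ) ≠ 0 := by
    have : (0 : ℝ) < 1 + (2 * Real.pi) ^ 2 * ‖x‖ ^ 2 := by positivity
    exact_mod_cast this.ne'
  push_cast at h ⊢
  rw [mul_inv_cancel₀ h, one_mul]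

theorem freeRes_mem_H2rad (f : L2rad d) : freeRes d f ∈ H2rad d := by
  rw [mem_H2rad_iff]
  have hm : MemLp (fun x : Space d => (((1 + ‖x‖ ^ 2) * resSymbol ‖x‖ : ℝ) : ℂ)) ∞ volume := by
    refine memLp_top_of_continuous_bound (Continuous.measurable ?_) 1 fun x => ?_
    · have := continuous_resSymbol
      fun_prop
    -- The weight defining `MemSobolev` is 1 + |ξ|² without the factor 2π, so the two symbols are
    -- only comparable: (1 + 4π²|ξ|²)/(1 + |ξ|²) lies between 1 and 4π².
    · have hpi : (1 : ℝ) ≤ (2 * Real.pi) ^ 2 := by nlinarith [Real.pi_gt_three]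
      rw [Complex.norm_real, Real.norm_of_nonneg (mul_nonneg (by positivity) (resSymbol_pos _).le),
        resSymbol, ← div_eq_mul_inv, div_le_one (by positivity)]
      nlinarith [sq_nonneg ‖x‖]
  refine ⟨mulOp _ (radFourier d f : L2 d), (coeFn_mulOp hm _).trans ?_⟩
  filter_upwards [coeFn_fourier_freeRes f] with x hx
  rw [hx]
  push_cast
  ring

/-- Together with `freeRes_mem_H2rad` this identifies the range of S with all of H²_rad, hence the
domain of L. -/
theorem exists_freeRes_eq {u : L2rad d} (hu : u ∈ H2rad d) : ∃ f, freeRes d f = u := by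
  obtain ⟨w, hw⟩ := (mem_H2rad_iff u).1 hu
  have hm : MemLp (fun x : Space d =>
      (((1 + (2 * Real.pi) ^ 2 * ‖x‖ ^ 2) * (1 + ‖x‖ ^ 2)⁻¹ : ℝ) : ℂ)) ∞ volume := by
    refine memLp_top_of_continuous_bound (Continuous.measurable ?_) ((2 * Real.pi) ^ 2) fun x => ?_
    · refine Complex.continuous_ofReal.comp (Continuous.mul (by fun_prop)
        (Continuous.inv₀ (by fun_prop) fun x => by positivity))
    · have hpi : (1 : ℝ) ≤ (2 * Real.pi) ^ 2 := by nlinarith [Real.pi_gt_three]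
      rw [Complex.norm_real, Real.norm_of_nonneg (by positivity), ← div_eq_mul_inv,
        div_le_iff₀ (by positivity)]
      nlinarith [sq_nonneg ‖x‖]
  set v : L2 d := mulOp _ w
  have hv : (v : Space d → ℂ) =ᵐ[volume]
      fun x => (1 + (2 * Real.pi) ^ 2 * ‖x‖ ^ 2 : ℂ) * (radFourier d u : L2 d) x := by
    filter_upwards [coeFn_mulOp hm w, hw] with x h1 h2
    have h : ((1 + ‖x‖ ^ 2 : ℝ) : ℂ) ≠ 0 := by
      have : (0 : ℝ) < 1 + ‖x‖ ^ 2 := by positivity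
      exact_mod_cast this.ne'
    rw [h1, h2]
    push_cast at h ⊢
    field_simp
  have hvr : v ∈ L2rad d := by
    obtain ⟨g, hg⟩ := (radFourier d u).2
    refine ⟨fun r => (1 + (2 * Real.pi) ^ 2 * r ^ 2 : ℂ) * g r, ?_⟩
    filter_upwards [hv, hg] with x h1 h2
    rw [h1, h2]
  refine ⟨(radFourier d).symm ⟨v, hvr⟩, (radFourier d).injective (Subtype.ext (Lp.ext ?_))⟩
  filter_upwards [coeFn_fourier_freeRes ((radFourier d).symm ⟨v, hvr⟩), hv] with x h1 h2
  rw [h1, LinearIsometryEquiv.apply_symm_apply]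
  show (resSymbol ‖x‖ : ℂ) * v x = _
  rw [h2, resSymbol]
  have h : ((1 + (2 * Real.pi) ^ 2 * ‖x‖ ^ 2 : ℝ) : ℂ) ≠ 0 := by
    have : (0 : ℝ) < 1 + (2 * Real.pi) ^ 2 * ‖x‖ ^ 2 := by positivity
    exact_mod_cast this.ne'
  push_cast at h ⊢
  rw [inv_mul_cancel_left₀ h]

theorem exists_incl_eq {u : L2rad d} (hu : u ∈ H2rad d) : ∃ p, incl d p = u := by
  have h1 : TemperedDistribution.MemSobolev 2 2 (toDist (u : L2 d)) := hu
  have h2 : ∀ i : Fin d, ∃ w : L2 d,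
      ∂_{EuclideanSpace.single i (1 : ℝ)} (toDist (u : L2 d)) = toDist w := fun i =>
    TemperedDistribution.memSobolev_zero_iff.1
      ((h1.lineDerivOp (m := EuclideanSpace.single i (1 : ℝ))).mono (by norm_num))
  choose w hw using h2
  exact ⟨⟨WithLp.toLp 2 ((u : L2 d), WithLp.toLp 2 w), u.2, hw⟩, rfl⟩

/-- Tested against a fixed Schwartz function, the weak derivative identity is a closed condition on
the pair (u, ∇u). Completeness is what the closed graph argument for the embedding needs. -/
theorem isClosed_H1rad : IsClosed (H1rad d : Set (WithLp 2 (L2 d × PiLp 2 fun _ : Fin d => L2 d))) := by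
  have h1 : (H1rad d : Set (WithLp 2 (L2 d × PiLp 2 fun _ : Fin d => L2 d))) =
      (fun p => p.fst) ⁻¹' (L2rad d : Set (L2 d)) ∩ ⋂ i : Fin d, ⋂ ψ : 𝓢(Space d, ℂ),
        {p | (∂_{EuclideanSpace.single i (1 : ℝ)} (toDist p.fst)) ψ = toDist (p.snd i) ψ} := by
    ext p
    simp only [Set.mem_inter_iff, Set.mem_preimage, SetLike.mem_coe, Set.mem_iInter,
      Set.mem_ofPred_eq]
    refine and_congr_right fun _ => forall_congr' fun i => ?_
    exact ⟨fun h ψ => by rw [h], fun h => by ext ψ; exact h ψ⟩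
  have h2 : ∀ ψ : 𝓢(Space d, ℂ), Continuous fun u : L2 d => toDist u ψ := by
    intro ψ
    have := (Lp.toTemperedDistributionCLM ℂ (volume : Measure (Space d)) 2).continuous
    exact (PointwiseConvergenceCLM.evalCLM (RingHom.id ℂ) ℂ ψ).continuous.comp this
  have hf : Continuous fun p : WithLp 2 (L2 d × PiLp 2 fun _ : Fin d => L2 d) => p.fst :=
    (WithLp.prod_continuous_ofLp 2 _ _).fst
  have hs : ∀ i, Continuous fun p : WithLp 2 (L2 d × PiLp 2 fun _ : Fin d => L2 d) => p.snd i :=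
    fun i => (PiLp.continuous_apply 2 _ i).comp (WithLp.prod_continuous_ofLp 2 _ _).snd
  rw [h1]
  refine (isClosed_L2rad.preimage hf).inter (isClosed_iInter fun i => isClosed_iInter fun ψ => ?_)
  refine isClosed_eq ?_ ?_
  · simp only [TemperedDistribution.lineDerivOp_apply_apply]
    exact (h2 _).comp hf
  · exact (h2 _).comp (hs i)

instance : CompleteSpace (H1rad d) := isClosed_H1rad.completeSpace_coe

/-- The inclusion of `H¹_rad` into `L²_rad` as a bounded operator. -/
def inclCLM (d : ℕ) : H1rad d →L[ℂ] L2rad d :=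
  (incl d).mkContinuous 1 fun p => by
    rw [one_mul]
    exact WithLp.norm_fst_le _ p.1

end Sobolev

end KleinGordon

/-! ### Test functions and local integrability on the half-line -/

/-- Real test functions on the open half-line `(0, ∞)`. -/
structure IsHalfLineTest (η : ℝ → ℝ) : Prop where
  contDiff : ContDiff ℝ ∞ η
  compact : HasCompactSupport η
  pos : tsupport η ⊆ Set.Ioi 0

/-- Integrability on all compact subintervals of `(0, ∞)`. -/
def LocIntPos {F : Type*} [NormedAddCommGroup F] (h : ℝ → F) : Prop :=
  ∀ a b, 0 < a → IntegrableOn h (Set.Icc a b)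

namespace LocIntPos

variable {F : Type*} [NormedAddCommGroup F] {h k : ℝ → F}

theorem intervalIntegrable (hh : LocIntPos h) {a b : ℝ} (ha : 0 < a) (hb : 0 < b) :
    IntervalIntegrable h volume a b :=
  ((hh (min a b) (max a b) (lt_min ha hb)).mono_set (by
    rw [← Set.uIcc])).intervalIntegrable

theorem of_continuousOn (hh : ContinuousOn h (Set.Ioi 0)) : LocIntPos h := fun _ _ ha =>
  (hh.mono fun _ hx => lt_of_lt_of_le ha hx.1).integrableOn_Icc

theorem sub (hh : LocIntPos h) (hk : LocIntPos k) : LocIntPos (fun r => h r - k r) :=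
  fun a b ha => (hh a b ha).sub (hk a b ha)

theorem continuousOn_smul [NormedSpace ℝ F] (hh : LocIntPos h) {c : ℝ → ℝ}
    (hc : ContinuousOn c (Set.Ioi 0)) : LocIntPos (fun r => c r • h r) := fun a b ha =>
  (hh a b ha).continuousOn_smul (hc.mono fun _ hx => lt_of_lt_of_le ha hx.1) isCompact_Icc

theorem locallyIntegrableOn (hh : LocIntPos h) : LocallyIntegrableOn h (Set.Ioi 0) := by
  intro x hx
  have hx' : (0 : ℝ) < x := hx
  refine ⟨Set.Icc (x / 2) (2 * x), nhdsWithin_le_nhds (Icc_mem_nhds (by linarith) (by linarith)),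
    hh _ _ (by linarith)⟩

end LocIntPos

namespace IsHalfLineTest

variable {η : ℝ → ℝ} (hη : IsHalfLineTest η)
include hη

/-- The point 1 is kept inside the interval because it is the base point of all primitives below. -/
theorem exists_Ioo : ∃ a b, 0 < a ∧ a < 1 ∧ 1 < b ∧ tsupport η ⊆ Set.Ioo a b := by
  by_cases hne : (tsupport η).Nonempty
  · obtain ⟨x, hx, hmin⟩ := hη.compact.isCompact.exists_isMinOn hne continuousOn_id
    obtain ⟨y, hy, hmax⟩ := hη.compact.isCompact.exists_isMaxOn hne continuousOn_id
    have hx0 : 0 < x := hη.pos hx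
    refine ⟨min (x / 2) (1 / 2), max (y + 1) 2, by positivity, ?_, ?_, fun z hz => ⟨?_, ?_⟩⟩
    · exact (min_le_right _ _).trans_lt (by norm_num)
    · exact lt_of_lt_of_le (by norm_num) (le_max_right _ _)
    · have h1 : x ≤ z := hmin hz
      exact lt_of_le_of_lt (min_le_left _ _) (by linarith)
    · have h1 : z ≤ y := hmax hz
      exact lt_of_lt_of_le (by linarith) (le_max_left _ _)
  · rw [Set.not_nonempty_iff_eq_empty] at hne
    exact ⟨1 / 2, 2, by norm_num, by norm_num, by norm_num, by simp [hne]⟩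

theorem deriv : IsHalfLineTest (deriv η) where
  contDiff := by
    have := (contDiff_infty_iff_deriv (𝕜 := ℝ)).1 hη.contDiff
    exact this.2
  compact := hη.compact.deriv
  pos := (tsupport_deriv_subset).trans hη.pos

theorem mul_contDiffOn {c : ℝ → ℝ} (hc : ContDiffOn ℝ ∞ c (Set.Ioi 0)) :
    IsHalfLineTest (fun r => c r * η r) where
  contDiff := by
    rw [contDiff_iff_contDiffAt]
    intro x
    by_cases hx : x ∈ tsupport η
    · exact (hc.contDiffAt (Ioi_mem_nhds (hη.pos hx))).mul hη.contDiff.contDiffAt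
    · have : (fun r => c r * η r) =ᶠ[𝓝 x] fun _ => 0 := by
        filter_upwards [notMem_tsupport_iff_eventuallyEq.1 hx] with r hr
        simp [hr]
      exact contDiffAt_const.congr_of_eventuallyEq this
  compact := hη.compact.mul_left
  pos := (tsupport_mul_subset_right).trans hη.pos

theorem eq_zero_of_nonpos {r : ℝ} (hr : r ≤ 0) : η r = 0 :=
  image_eq_zero_of_notMem_tsupport fun h => absurd (hη.pos h) (not_lt.2 hr)

variable {F : Type*} [NormedAddCommGroup F] [NormedSpace ℝ F]

theorem setIntegral_eq (k : ℝ → F) : ∫ r in Set.Ioi (0 : ℝ), η r • k r = ∫ r, η r • k r :=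
  setIntegral_eq_integral_of_forall_compl_eq_zero fun r hr => by
    rw [hη.eq_zero_of_nonpos (not_lt.1 hr), zero_smul]

theorem integrable_smul {k : ℝ → F} (hk : LocIntPos k) : Integrable (fun r => η r • k r) := by
  obtain ⟨a, b, ha, -, -, hab⟩ := hη.exists_Ioo
  have h1 : IntegrableOn (fun r => η r • k r) (Set.Icc a b) :=
    (hk a b ha).continuousOn_smul hη.contDiff.continuous.continuousOn isCompact_Icc
  rw [← integrableOn_iff_integrable_of_support_subset (s := Set.Icc a b)]
  · exact h1
  · intro r hr
    refine Set.Ioo_subset_Icc_self (hab (subset_tsupport _ ?_))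
    intro h0
    exact hr (by simp [h0])

theorem integral_eq_intervalIntegral {k : ℝ → F} {a b : ℝ} (h : a ≤ b)
    (hab : tsupport η ⊆ Set.Ioo a b) : ∫ r, η r • k r = ∫ r in a..b, η r • k r := by
  rw [intervalIntegral.integral_of_le h, setIntegral_eq_integral_of_forall_compl_eq_zero]
  intro r hr
  rw [image_eq_zero_of_notMem_tsupport fun h => hr (Set.Ioo_subset_Ioc_self (hab h)), zero_smul]

end IsHalfLineTest

theorem hasDerivAt_of_forall_sub_eq_integral {F : Type*} [NormedAddCommGroup F] [NormedSpace ℝ F]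
    [CompleteSpace F] {g h : ℝ → F}
    (hg : ∀ a b, 0 < a → 0 < b → g b - g a = ∫ r in a..b, h r) (hh : ContinuousOn h (Set.Ioi 0))
    {r : ℝ} (hr : 0 < r) : HasDerivAt g (h r) r := by
  have h1 : HasDerivAt (fun x => ∫ t in r..x, h t) (h r) r :=
    intervalIntegral.integral_hasDerivAt_right (by simp)
      (hh.stronglyMeasurableAtFilter isOpen_Ioi r hr) (hh.continuousAt (Ioi_mem_nhds hr))
  have h2 : g =ᶠ[𝓝 r] fun x => g r + ∫ t in r..x, h t := by
    filter_upwards [Ioi_mem_nhds hr] with x hx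
    rw [← hg r x hr hx, add_sub_cancel]
  exact (h1.const_add (g r)).congr_of_eventuallyEq h2

theorem continuousOn_of_forall_sub_eq_integral {F : Type*} [NormedAddCommGroup F]
    [NormedSpace ℝ F] [CompleteSpace F] {g h : ℝ → F}
    (hg : ∀ a b, 0 < a → 0 < b → g b - g a = ∫ r in a..b, h r) (hh : LocIntPos h) :
    ContinuousOn g (Set.Ioi 0) := by
  intro r hr
  have hr' : (0 : ℝ) < r := hr
  have h1 : ContinuousOn (fun x => ∫ t in r / 2..x, h t) (Set.uIcc (r / 2) (2 * r)) :=
    intervalIntegral.continuousOn_primitive_interval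
      ((hh (r / 2) (2 * r) (by linarith)).mono_set (by rw [Set.uIcc_of_le (by linarith)]))
  have h2 : ContinuousAt (fun x => ∫ t in r / 2..x, h t) r := by
    refine h1.continuousAt ?_
    rw [Set.uIcc_of_le (by linarith)]
    exact Icc_mem_nhds (by linarith) (by linarith)
  have h3 : g =ᶠ[𝓝 r] fun x => g (r / 2) + ∫ t in r / 2..x, h t := by
    filter_upwards [Ioi_mem_nhds hr'] with x hx
    rw [← hg (r / 2) x (by linarith) hx, add_sub_cancel]
  exact (((continuousAt_const.add h2).congr h3.symm)).continuousWithinAt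

/-! ### Weak derivatives on the half-line -/

section DuBoisReymond

/-- Integration by parts for absolutely continuous functions, since h is only locally integrable. -/
theorem integral_deriv_mul_primitive {η h : ℝ → ℝ} (hη : IsHalfLineTest η) (hh : LocIntPos h) :
    ∫ r in Set.Ioi (0 : ℝ), deriv η r • (∫ s in (1 : ℝ)..r, h s) =
      -∫ r in Set.Ioi (0 : ℝ), η r • h r := by
  obtain ⟨a, b, ha, ha1, hb1, hab⟩ := hη.exists_Ioo
  have hle : a ≤ b := by linarith
  rw [hη.deriv.setIntegral_eq, hη.setIntegral_eq,
    hη.integral_eq_intervalIntegral hle hab,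
    hη.deriv.integral_eq_intervalIntegral hle ((tsupport_deriv_subset).trans hab)]
  have hint : IntervalIntegrable h volume a b := hh.intervalIntegrable ha (by linarith)
  have hG : AbsolutelyContinuousOnInterval (fun r => ∫ s in (1 : ℝ)..r, h s) a b :=
    hint.absolutelyContinuousOnInterval_intervalIntegral (by
      rw [Set.uIcc_of_le hle]; exact ⟨ha1.le, hb1.le⟩)
  have hE : AbsolutelyContinuousOnInterval η a b :=
    ContDiffOn.absolutelyContinuousOnInterval ((hη.contDiff.of_le (by simp)).contDiffOn)
  have h1 := hG.integral_mul_deriv_eq_deriv_mul hE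
  have hηa : η a = 0 := image_eq_zero_of_notMem_tsupport fun h => lt_irrefl _ (hab h).1
  have hηb : η b = 0 := image_eq_zero_of_notMem_tsupport fun h => lt_irrefl _ (hab h).2
  rw [hηa, hηb, mul_zero, mul_zero, sub_zero, zero_sub] at h1
  simp only [smul_eq_mul]
  calc ∫ r in a..b, deriv η r * ∫ s in (1 : ℝ)..r, h s
      = ∫ r in a..b, (∫ s in (1 : ℝ)..r, h s) * deriv η r := by simp_rw [mul_comm]
    _ = _ := h1
    _ = -∫ r in a..b, η r * h r := by
      congr 1
      apply intervalIntegral.integral_congr_ae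
      filter_upwards [hint.ae_hasDerivAt_integral] with x hx hx'
      rw [(hx (Set.uIoc_subset_uIcc hx') 1 (by
        rw [Set.uIcc_of_le hle]; exact ⟨ha1.le, hb1.le⟩)).deriv, mul_comm]

theorem exists_halfLineTest_integral_one : ∃ η, IsHalfLineTest η ∧ ∫ r, η r = 1 := by
  let f : ContDiffBump (2 : ℝ) := ⟨1 / 2, 1, by norm_num, by norm_num⟩
  refine ⟨f.normed volume, ⟨f.contDiff_normed, f.hasCompactSupport_normed, ?_⟩, f.integral_normed⟩
  rw [f.tsupport_normed_eq]
  intro x hx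
  rw [Metric.mem_closedBall, Real.dist_eq, abs_le] at hx
  have : -1 ≤ x - 2 := hx.1
  exact Set.mem_Ioi.2 (by linarith)

/-- The mean-zero condition makes the primitive vanish again to the right of the support. -/
theorem exists_test_primitive {θ : ℝ → ℝ} (hθ : IsHalfLineTest θ) (h0 : ∫ r, θ r = 0) :
    ∃ η, IsHalfLineTest η ∧ deriv η = θ := by
  obtain ⟨a, b, ha, ha1, hb1, hab⟩ := hθ.exists_Ioo
  have hle : a ≤ b := by linarith
  set η : ℝ → ℝ := fun r => ∫ s in a..r, θ s
  have hcont := hθ.contDiff.continuous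
  have hd : ∀ r, HasDerivAt η (θ r) r := fun r =>
    intervalIntegral.integral_hasDerivAt_right (hcont.intervalIntegrable _ _)
      hcont.stronglyMeasurable.stronglyMeasurableAtFilter hcont.continuousAt
  have hderiv : deriv η = θ := funext fun r => (hd r).deriv
  have hz : ∀ s, s ∉ Set.Ioo a b → θ s = 0 := fun s hs =>
    image_eq_zero_of_notMem_tsupport fun h => hs (hab h)
  have hsupp : Function.support η ⊆ Set.Icc a b := by
    intro r hr
    by_contra hr'
    apply hr
    rw [Set.mem_Icc, not_and_or, not_le, not_le] at hr'
    rcases hr' with hr' | hr'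
    · show ∫ s in a..r, θ s = 0
      rw [intervalIntegral.integral_symm, intervalIntegral.integral_of_le hr'.le,
        setIntegral_eq_zero_of_forall_eq_zero, neg_zero]
      intro s hs
      exact hz s fun h => absurd h.1 (not_lt.2 hs.2)
    · show ∫ s in a..r, θ s = 0
      have h1 : ∫ s in a..r, θ s = ∫ s, θ s := by
        rw [intervalIntegral.integral_of_le (hle.trans hr'.le),
          setIntegral_eq_integral_of_forall_compl_eq_zero]
        intro s hs
        exact hz s fun h => hs ⟨h.1, (h.2.trans hr').le⟩
      rw [h1, h0]
  have htsupp : tsupport η ⊆ Set.Icc a b := closure_minimal hsupp isClosed_Icc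
  refine ⟨η, ⟨?_, ?_, fun r hr => lt_of_lt_of_le ha (htsupp hr).1⟩, hderiv⟩
  · rw [contDiff_infty_iff_deriv, hderiv]
    exact ⟨fun r => (hd r).differentiableAt, hθ.contDiff⟩
  · exact HasCompactSupport.of_support_subset_isCompact isCompact_Icc hsupp

theorem LocIntPos.primitive {h : ℝ → ℝ} (hh : LocIntPos h) :
    LocIntPos (fun r => ∫ s in (1 : ℝ)..r, h s) := by
  apply LocIntPos.of_continuousOn
  refine continuousOn_of_forall_sub_eq_integral (h := h) (fun a b ha hb => ?_) hh
  rw [intervalIntegral.integral_interval_sub_left]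
  · exact hh.intervalIntegrable one_pos hb
  · exact hh.intervalIntegrable one_pos ha

/-- Du Bois-Reymond: g minus a primitive of h annihilates all derivatives of test functions. A test
function ζ minus (∫ζ)η₀, with ∫η₀ = 1, is such a derivative, so the difference is constant. -/
theorem exists_primitive_of_weak_deriv_real {g h : ℝ → ℝ} (hg : LocIntPos g) (hh : LocIntPos h)
    (H : ∀ η, IsHalfLineTest η → ∫ r in Set.Ioi (0 : ℝ), deriv η r • g r =
      -∫ r in Set.Ioi (0 : ℝ), η r • h r) :
    ∃ c, g =ᵐ[volume.restrict (Set.Ioi 0)] fun r => c + ∫ s in (1 : ℝ)..r, h s := by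
  set k : ℝ → ℝ := fun r => g r - ∫ s in (1 : ℝ)..r, h s
  have hk : LocIntPos k := hg.sub hh.primitive
  have H1 : ∀ η, IsHalfLineTest η → ∫ r, deriv η r • k r = 0 := by
    intro η hη
    have h1 := H η hη
    have h2 := integral_deriv_mul_primitive hη hh
    rw [hη.deriv.setIntegral_eq] at h1 h2
    simp only [k, smul_sub]
    rw [integral_sub (hη.deriv.integrable_smul hg) (hη.deriv.integrable_smul hh.primitive), h1, h2,
      sub_self]
  obtain ⟨η₀, hη₀, hη₀1⟩ := exists_halfLineTest_integral_one
  set c := ∫ r, η₀ r • k r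
  have H2 : ∀ ζ, IsHalfLineTest ζ → ∫ r, ζ r • (k r - c) = 0 := by
    intro ζ hζ
    have hζi : Integrable ζ := hζ.contDiff.continuous.integrable_of_hasCompactSupport hζ.compact
    have hηi : Integrable η₀ := hη₀.contDiff.continuous.integrable_of_hasCompactSupport hη₀.compact
    set z := ∫ r, ζ r
    have hsub : Function.support (fun r => ζ r - z * η₀ r) ⊆ tsupport ζ ∪ tsupport η₀ := by
      intro r hr
      by_contra h
      rw [Set.mem_union, not_or] at h
      apply hr
      simp [image_eq_zero_of_notMem_tsupport h.1, image_eq_zero_of_notMem_tsupport h.2]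
    have hθ : IsHalfLineTest (fun r => ζ r - z * η₀ r) :=
      { contDiff := hζ.contDiff.sub (contDiff_const.mul hη₀.contDiff)
        compact := HasCompactSupport.of_support_subset_isCompact
          (hζ.compact.isCompact.union hη₀.compact.isCompact) hsub
        pos := (closure_minimal hsub ((isClosed_tsupport _).union (isClosed_tsupport _))).trans
          (Set.union_subset hζ.pos hη₀.pos) }
    have hθ0 : ∫ r, (ζ r - z * η₀ r) = 0 := by
      rw [integral_sub hζi (hηi.const_mul z), integral_const_mul, hη₀1, mul_one, sub_self]
    obtain ⟨η, hη, hηd⟩ := exists_test_primitive hθ hθ0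
    have h3 := H1 η hη
    rw [hηd] at h3
    have h4 : ∀ r, (ζ r - z * η₀ r) • k r = ζ r • k r - z * (η₀ r • k r) := by
      intro r; simp only [smul_eq_mul]; ring
    simp_rw [h4] at h3
    rw [integral_sub (hζ.integrable_smul hk) ((hη₀.integrable_smul hk).const_mul z),
      integral_const_mul] at h3
    simp_rw [smul_sub]
    rw [integral_sub (hζ.integrable_smul hk) (by simpa using hζi.mul_const c)]
    simp only [smul_eq_mul] at h3 ⊢
    rw [integral_mul_const]
    exact h3
  refine ⟨c, ?_⟩
  have h5 := isOpen_Ioi.ae_eq_zero_of_integral_contDiff_smul_eq_zero (μ := volume)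
    (f := fun r => k r - c) (U := Set.Ioi (0 : ℝ))
    (hk.sub (LocIntPos.of_continuousOn continuousOn_const)).locallyIntegrableOn
    fun ζ h1 h2 h3 => H2 ζ ⟨h1, h2, h3⟩
  rw [EventuallyEq, ae_restrict_iff' measurableSet_Ioi]
  filter_upwards [h5] with r hr hr0
  have := hr hr0
  simp only [k] at this
  linarith

theorem exists_primitive_of_weak_deriv {g h : ℝ → ℂ} (hg : LocIntPos g) (hh : LocIntPos h)
    (H : ∀ η, IsHalfLineTest η → ∫ r in Set.Ioi (0 : ℝ), deriv η r • g r =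
      -∫ r in Set.Ioi (0 : ℝ), η r • h r) :
    ∃ c, g =ᵐ[volume.restrict (Set.Ioi 0)] fun r => c + ∫ s in (1 : ℝ)..r, h s := by
  have key : ∀ T : ℂ →L[ℝ] ℝ, ∃ c, (fun r => T (g r)) =ᵐ[volume.restrict (Set.Ioi 0)]
      fun r => c + ∫ s in (1 : ℝ)..r, T (h s) := by
    intro T
    have hT : ∀ {k : ℝ → ℂ}, LocIntPos k → LocIntPos fun r => T (k r) := fun hk a b ha =>
      T.integrable_comp (hk a b ha)
    refine exists_primitive_of_weak_deriv_real (hT hg) (hT hh) fun η hη => ?_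
    have h1 := congrArg T (H η hη)
    rw [map_neg, ← T.integral_comp_comm (hη.integrable_smul hh).integrableOn,
      ← T.integral_comp_comm (hη.deriv.integrable_smul hg).integrableOn] at h1
    simpa only [map_smul] using h1
  obtain ⟨c₁, h1⟩ := key Complex.reCLM
  obtain ⟨c₂, h2⟩ := key Complex.imCLM
  refine ⟨⟨c₁, c₂⟩, ?_⟩
  filter_upwards [h1, h2, ae_restrict_mem measurableSet_Ioi] with r hr1 hr2 hr
  have hi := hh.intervalIntegrable one_pos hr
  have e1 := Complex.reCLM.intervalIntegral_comp_comm hi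
  have e2 := Complex.imCLM.intervalIntegral_comp_comm hi
  simp only [Complex.reCLM_apply, Complex.imCLM_apply] at *
  apply Complex.ext
  · rw [hr1, Complex.add_re, e1]
  · rw [hr2, Complex.add_im, e2]

end DuBoisReymond

namespace KleinGordon

variable {d : ℕ}

/-! ### Radial test functions and radial vector fields -/

section RadialTests

variable {χ : ℝ → ℝ} (hχ : IsHalfLineTest χ)
include hχ

theorem radial_test_eventually_zero :
    (fun x : Space d => χ ‖x‖) =ᶠ[𝓝 0] fun _ => 0 := by
  obtain ⟨a, b, ha, -, -, hab⟩ := hχ.exists_Ioo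
  filter_upwards [Metric.ball_mem_nhds (0 : Space d) ha] with x hx
  refine image_eq_zero_of_notMem_tsupport fun h => ?_
  have := (hab h).1
  rw [mem_ball_zero_iff] at hx
  linarith

theorem contDiff_radial_test : ContDiff ℝ ∞ fun x : Space d => χ ‖x‖ := by
  rw [contDiff_iff_contDiffAt]
  intro x
  by_cases hx : x = 0
  · subst hx
    exact contDiffAt_const.congr_of_eventuallyEq (radial_test_eventually_zero hχ)
  · exact hχ.contDiff.contDiffAt.comp x (contDiffAt_norm ℝ hx)

theorem hasCompactSupport_radial_test : HasCompactSupport fun x : Space d => χ ‖x‖ := by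
  obtain ⟨a, b, -, -, -, hab⟩ := hχ.exists_Ioo
  refine HasCompactSupport.of_support_subset_isCompact
    (isCompact_closedBall (0 : Space d) b) fun x hx => ?_
  rw [mem_closedBall_zero_iff]
  exact (hab (subset_tsupport _ hx)).2.le

theorem hasFDerivAt_radial_test (x : Space d) :
    HasFDerivAt (fun x : Space d => χ ‖x‖) ((‖x‖⁻¹ * deriv χ ‖x‖) • innerSL ℝ x) x := by
  by_cases hx : x = 0
  · subst hx
    simpa using (hasFDerivAt_const (0 : ℝ) (0 : Space d)).congr_of_eventuallyEq
      (radial_test_eventually_zero hχ)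
  · have h1 := ((hasStrictFDerivAt_norm_sq x).hasFDerivAt.sqrt (by simpa using hx))
    simp only [Real.sqrt_sq (norm_nonneg _)] at h1
    have h2 := ((hχ.contDiff.differentiable (by simp)) ‖x‖).hasDerivAt.comp_hasFDerivAt x h1
    have h3 : (‖x‖⁻¹ * deriv χ ‖x‖) • innerSL ℝ x =
        deriv χ ‖x‖ • (1 / (2 * ‖x‖)) • 2 • innerSL ℝ x := by
      ext y
      simp
      ring
    rw [h3]
    exact h2

theorem _root_.IsHalfLineTest.inv_mul : IsHalfLineTest fun r => r⁻¹ * χ r :=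
  hχ.mul_contDiffOn (contDiffOn_inv ℝ |>.mono fun _ hr => ne_of_gt hr)

theorem _root_.IsHalfLineTest.pow_mul (n : ℕ) : IsHalfLineTest fun r => r ^ n * χ r :=
  hχ.mul_contDiffOn (contDiff_id.pow n).contDiffOn

theorem _root_.IsHalfLineTest.inv_pow_mul (n : ℕ) : IsHalfLineTest fun r => (r ^ n)⁻¹ * χ r :=
  hχ.mul_contDiffOn (((contDiff_id.pow n).contDiffOn).inv fun _ hr => (pow_pos hr _).ne')

/-- The radial test function `χ(|x|)`. -/
def radTest (d : ℕ) : 𝓢(Space d, ℂ) :=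
  HasCompactSupport.toSchwartzMap (f := Complex.ofRealCLM ∘ fun x : Space d => χ ‖x‖)
    ((hasCompactSupport_radial_test hχ).comp_left rfl)
    (Complex.ofRealCLM.contDiff.comp (contDiff_radial_test hχ))

theorem radTest_apply (x : Space d) : radTest hχ d x = (χ ‖x‖ : ℂ) := rfl

/-- The test functions `χ(|x|) xᵢ`. -/
def radVecTest (i : Fin d) : 𝓢(Space d, ℂ) :=
  HasCompactSupport.toSchwartzMap (f := Complex.ofRealCLM ∘ fun x : Space d => χ ‖x‖ * x i)
    (((hasCompactSupport_radial_test hχ).mul_right).comp_left rfl)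
    (Complex.ofRealCLM.contDiff.comp ((contDiff_radial_test hχ).mul (by fun_prop)))

theorem radVecTest_apply (i : Fin d) (x : Space d) :
    radVecTest hχ i x = ((χ ‖x‖ * x i : ℝ) : ℂ) := rfl

theorem lineDeriv_radTest (i : Fin d) :
    ∂_{EuclideanSpace.single i (1 : ℝ)} (radTest hχ d) = radVecTest hχ.deriv.inv_mul i := by
  ext x
  rw [SchwartzMap.lineDerivOp_apply_eq_fderiv, radVecTest_apply]
  have h1 := Complex.ofRealCLM.hasFDerivAt.comp x (hasFDerivAt_radial_test hχ x)
  have h2 : fderiv ℝ (radTest hχ d) x = _ := h1.fderiv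
  rw [h2]
  simp [EuclideanSpace.inner_single_right]

theorem lineDeriv_radVecTest (i : Fin d) (x : Space d) :
    (∂_{EuclideanSpace.single i (1 : ℝ)} (radVecTest hχ i)) x =
      ((‖x‖⁻¹ * deriv χ ‖x‖ * x i ^ 2 + χ ‖x‖ : ℝ) : ℂ) := by
  rw [SchwartzMap.lineDerivOp_apply_eq_fderiv]
  have h0 : HasFDerivAt (fun x : Space d => x i) (EuclideanSpace.proj (𝕜 := ℝ) i) x :=
    (EuclideanSpace.proj (𝕜 := ℝ) i).hasFDerivAt
  have h1 := Complex.ofRealCLM.hasFDerivAt.comp x ((hasFDerivAt_radial_test hχ x).mul h0)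
  have h2 : fderiv ℝ (radVecTest hχ i) x = _ := h1.fderiv
  rw [h2]
  simp [EuclideanSpace.inner_single_right]
  ring

/-- The divergence of the vector field χ(|x|)x. -/
theorem sum_lineDeriv_radVecTest (x : Space d) :
    ∑ i, (∂_{EuclideanSpace.single i (1 : ℝ)} (radVecTest hχ i)) x =
      ((‖x‖ * deriv χ ‖x‖ + d * χ ‖x‖ : ℝ) : ℂ) := by
  simp only [lineDeriv_radVecTest]
  rw [← Complex.ofReal_sum, Finset.sum_add_distrib, ← Finset.mul_sum,
    ← EuclideanSpace.real_norm_sq_eq]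
  congr 1
  by_cases hx : ‖x‖ = 0
  · simp [hx]
  · simp
    field_simp

end RadialTests

theorem toDist_apply (w : L2 d) (ψ : 𝓢(Space d, ℂ)) : toDist w ψ = ∫ x, ψ x * w x :=
  Lp.toTemperedDistribution_apply w ψ

/-! ### The weak radial derivative -/

section RadialDerivative

theorem memLp_coord (i : Fin d) : MemLp (fun x : Space d => ((x i / ‖x‖ : ℝ) : ℂ)) ∞ volume := by
  refine memLp_top_of_continuous_bound (by fun_prop) 1 fun x => ?_
  rw [Complex.norm_real, norm_div, norm_norm]
  exact div_le_one_of_le₀ (PiLp.norm_apply_le x i) (norm_nonneg _)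

/-- The radial derivative `∑ᵢ (xᵢ/|x|) ∂ᵢu`, projected to the radial functions. -/
def radDeriv (p : H1rad d) : L2rad d :=
  (L2rad d).orthogonalProjectionOnto
    (∑ i, mulOp (fun x : Space d => ((x i / ‖x‖ : ℝ) : ℂ)) (p.1.snd i))

theorem norm_snd_le (p : H1rad d) (i : Fin d) : ‖p.1.snd i‖ ≤ ‖p‖ :=
  (PiLp.norm_apply_le p.1.snd i).trans (WithLp.norm_snd_le _ p.1)

theorem norm_radDeriv_le (p : H1rad d) : ‖radDeriv p‖ ≤ d * ‖p‖ := by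
  refine (Submodule.norm_orthogonalProjectionOnto_apply_le _ _).trans ?_
  refine (norm_sum_le _ _).trans ?_
  have : ∀ i ∈ Finset.univ, ‖mulOp (fun x : Space d => ((x i / ‖x‖ : ℝ) : ℂ)) (p.1.snd i)‖ ≤ ‖p‖ := by
    intro i _
    refine (norm_mulOp_le (memLp_coord i) (C := 1) (Eventually.of_forall fun x => ?_) _).trans ?_
    · rw [Complex.norm_real, norm_div, norm_norm]
      exact div_le_one_of_le₀ (PiLp.norm_apply_le x i) (norm_nonneg _)
    · rw [one_mul]; exact norm_snd_le p i
  refine (Finset.sum_le_card_nsmul _ _ _ this).trans ?_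
  simp

open scoped InnerProductSpace in
-- The pairing of ∇u with χ(|x|)x is a pairing of the raw radial derivative with the radial function
-- |x|χ(|x|), so the projection in `radDeriv` does not change it. It thus need not be shown
-- beforehand that the raw derivative is radial.
theorem sum_integral_radVecTest {χ : ℝ → ℝ} (hχ : IsHalfLineTest χ) (p : H1rad d) :
    ∑ i, ∫ x, radVecTest hχ i x * p.1.snd i x =
      ∫ x : Space d, ((‖x‖ * χ ‖x‖ : ℝ) : ℂ) * (radDeriv p : L2 d) x := by
  have hρ : IsHalfLineTest fun r => r ^ 1 * χ r := hχ.pow_mul 1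
  set t : L2 d := (radTest hρ d).toLp 2
  have ht : t =ᵐ[volume] fun x => ((‖x‖ * χ ‖x‖ : ℝ) : ℂ) := by
    filter_upwards [(radTest hρ d).coeFn_toLp 2 volume] with x hx
    rw [hx, radTest_apply, pow_one]
  have htr : t ∈ L2rad d := ⟨fun r => ((r * χ r : ℝ) : ℂ), ht⟩
  have hinner : ∀ w : L2 d, ⟪t, w⟫_ℂ = ∫ x, ((‖x‖ * χ ‖x‖ : ℝ) : ℂ) * w x := by
    intro w
    rw [L2.inner_def]
    refine integral_congr_ae ?_
    filter_upwards [ht] with x hx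
    rw [hx, RCLike.inner_apply, Complex.conj_ofReal, mul_comm]
  rw [← hinner]
  have h1 : ⟪t, (radDeriv p : L2 d)⟫_ℂ =
      ⟪t, ∑ i, mulOp (fun x : Space d => ((x i / ‖x‖ : ℝ) : ℂ)) (p.1.snd i)⟫_ℂ :=
    Submodule.inner_orthogonalProjectionOnto_eq_of_mem_left (K := L2rad d) ⟨t, htr⟩ _
  rw [h1, inner_sum]
  refine Finset.sum_congr rfl fun i _ => ?_
  rw [hinner]
  refine integral_congr_ae ?_
  filter_upwards [coeFn_mulOp (memLp_coord i) (p.1.snd i)] with x hx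
  rw [hx, radVecTest_apply]
  by_cases h0 : ‖x‖ = 0
  · have : x = 0 := norm_eq_zero.1 h0
    simp [this]
  · have h0' : (‖x‖ : ℂ) ≠ 0 := by exact_mod_cast h0
    push_cast
    field_simp

theorem integral_divergence {χ : ℝ → ℝ} (hχ : IsHalfLineTest χ) (p : H1rad d) :
    ∫ x : Space d, ((‖x‖ * deriv χ ‖x‖ + d * χ ‖x‖ : ℝ) : ℂ) * p.1.fst x =
      -∫ x : Space d, ((‖x‖ * χ ‖x‖ : ℝ) : ℂ) * (radDeriv p : L2 d) x := by
  rw [← sum_integral_radVecTest hχ]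
  have h1 : ∀ i, ∫ x, radVecTest hχ i x * p.1.snd i x =
      -toDist p.1.fst (∂_{EuclideanSpace.single i (1 : ℝ)} (radVecTest hχ i)) := by
    intro i
    rw [← toDist_apply, ← p.2.2 i, TemperedDistribution.lineDerivOp_apply_apply, map_neg]
  simp only [h1]
  rw [Finset.sum_neg_distrib, neg_neg, ← map_sum, toDist_apply]
  refine integral_congr_ae (Eventually.of_forall fun x => ?_)
  simp only [sum_apply]
  rw [sum_lineDeriv_radVecTest]

/-- Integrate by parts once and use ∇(χ(|x|)) = χ'(|x|) x/|x|. -/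
theorem laplacian_radTest {χ : ℝ → ℝ} (hχ : IsHalfLineTest χ) (p : H1rad d) :
    (Δ (toDist p.1.fst)) (radTest hχ d) =
      -∫ x : Space d, ((deriv χ ‖x‖ : ℝ) : ℂ) * (radDeriv p : L2 d) x := by
  rw [TemperedDistribution.laplacian_eq_sum (EuclideanSpace.basisFun (Fin d) ℝ)]
  simp only [EuclideanSpace.basisFun_apply, p.2.2]
  have h1 : ∀ i, (∂_{EuclideanSpace.single i (1 : ℝ)} (toDist (p.1.snd i))) (radTest hχ d) =
      -∫ x, radVecTest hχ.deriv.inv_mul i x * p.1.snd i x := by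
    intro i
    rw [TemperedDistribution.lineDerivOp_apply_apply, lineDeriv_radTest, map_neg, toDist_apply]
  have h2 : (∑ i, ∂_{EuclideanSpace.single i (1 : ℝ)} (toDist (p.1.snd i))) (radTest hχ d) =
      ∑ i, (∂_{EuclideanSpace.single i (1 : ℝ)} (toDist (p.1.snd i))) (radTest hχ d) := by
    simp
  rw [h2]
  simp only [h1]
  rw [Finset.sum_neg_distrib, sum_integral_radVecTest]
  congr 1
  refine integral_congr_ae (Eventually.of_forall fun x => ?_)
  by_cases h0 : ‖x‖ = 0
  · simp [h0, hχ.deriv.eq_zero_of_nonpos le_rfl]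
  · simp only
    rw [mul_inv_cancel_left₀ h0]

end RadialDerivative

/-! ### Radial profiles on the half-line -/

section Profile

variable [NeZero d]

theorem locIntPos_of_ae_eq {u : L2 d} {k : ℝ → ℂ} (hu : u =ᵐ[volume] fun x => k ‖x‖) :
    LocIntPos k := by
  intro a b ha
  have h1 : IntegrableOn (fun x : Space d => k ‖x‖) (Metric.ball 0 (b + 1)) :=
    ((((Lp.memLp u).locallyIntegrable (by norm_num)).integrableOn_isCompact
      (isCompact_closedBall 0 (b + 1))).mono_set Metric.ball_subset_closedBall).congr
      (ae_restrict_of_ae hu)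
  have h2 : IntegrableOn (fun r : ℝ => r ^ (d - 1) • k r) (Set.Icc a b) :=
    (integrableOn_ball_norm_iff.1 h1).mono_set fun r hr =>
      ⟨lt_of_lt_of_le ha hr.1, by linarith [hr.2]⟩
  have h3 : ContinuousOn (fun r : ℝ => (r ^ (d - 1))⁻¹) (Set.Icc a b) :=
    (continuous_pow _).continuousOn.inv₀ fun r hr => (pow_pos (lt_of_lt_of_le ha hr.1) _).ne'
  refine (h2.continuousOn_smul h3 isCompact_Icc).congr_fun (fun r hr => ?_) measurableSet_Icc
  exact inv_smul_smul₀ (pow_pos (lt_of_lt_of_le ha hr.1) _).ne' _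

theorem integrable_norm_sq {u : L2 d} : Integrable fun x => ‖u x‖ ^ 2 :=
  (memLp_two_iff_integrable_sq_norm (Lp.memLp u).1).1 (Lp.memLp u)

theorem integral_norm_sq (u : L2 d) : ∫ x, ‖u x‖ ^ 2 = ‖u‖ ^ 2 := by
  have h := L2.inner_def (𝕜 := ℂ) u u
  have h2 : ∀ x, inner ℂ (u x) (u x) = ((‖u x‖ ^ 2 : ℝ) : ℂ) := fun x => by
    rw [inner_self_eq_norm_sq_to_K]; push_cast; rfl
  simp only [h2] at h
  rw [inner_self_eq_norm_sq_to_K, integral_complex_ofReal] at h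
  have h3 : ((‖u‖ ^ 2 : ℝ) : ℂ) = ((∫ x, ‖u x‖ ^ 2 : ℝ) : ℂ) := by
    rw [← h]; push_cast; rfl
  exact (Complex.ofReal_injective h3).symm

theorem integrableOn_norm_sq_of_ae_eq {u : L2 d} {k : ℝ → ℂ} (hu : u =ᵐ[volume] fun x => k ‖x‖) :
    IntegrableOn (fun r : ℝ => r ^ (d - 1) * ‖k r‖ ^ 2) (Set.Ioi 0) := by
  refine (integrable_norm_iff (d := d) (f := fun r => ‖k r‖ ^ 2)).1 ((integrable_norm_sq (u := u)).congr ?_)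
  filter_upwards [hu] with x hx
  rw [hx]

theorem norm_sq_of_ae_eq {u : L2 d} {k : ℝ → ℂ} (hu : u =ᵐ[volume] fun x => k ‖x‖) :
    sphereArea d * ∫ r in Set.Ioi (0 : ℝ), r ^ (d - 1) * ‖k r‖ ^ 2 = ‖u‖ ^ 2 := by
  rw [← integral_norm_sq]
  refine (integral_norm (d := d) fun r => ‖k r‖ ^ 2).symm.trans (integral_congr_ae ?_)
  filter_upwards [hu] with x hx
  rw [hx]

/-- `g` is the radial profile of `p`, and `h` its derivative. -/
structure IsProfile (p : H1rad d) (g h : ℝ → ℂ) : Prop where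
  eq_fst : (p.1.fst : Space d → ℂ) =ᵐ[volume] fun x => g ‖x‖
  eq_deriv : ((radDeriv p : L2 d) : Space d → ℂ) =ᵐ[volume] fun x => h ‖x‖
  sub_eq : ∀ a b, 0 < a → 0 < b → g b - g a = ∫ r in a..b, h r

theorem integral_smul_radial {u : L2 d} {k : ℝ → ℂ} (hu : u =ᵐ[volume] fun x => k ‖x‖)
    (c : ℝ → ℝ) : ∫ x : Space d, (c ‖x‖ : ℂ) * u x =
      sphereArea d • ∫ r in Set.Ioi (0 : ℝ), (r ^ (d - 1) * c r) • k r := by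
  have h1 : ∫ x : Space d, (c ‖x‖ : ℂ) * u x = ∫ x : Space d, (c ‖x‖ : ℂ) * k ‖x‖ := by
    refine integral_congr_ae ?_
    filter_upwards [hu] with x hx
    rw [hx]
  rw [h1, integral_norm fun r => (c r : ℂ) * k r]
  simp only [mul_smul, Complex.real_smul]

/-- Take χ = r^{-d}η in `integral_divergence`: then r^{d-1}(rχ' + dχ) = η' and r^{d-1}·rχ = η, so
the polar weights cancel. -/
theorem weak_deriv_profile {p : H1rad d} {g h : ℝ → ℂ}
    (hg : (p.1.fst : Space d → ℂ) =ᵐ[volume] fun x => g ‖x‖)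
    (hh : ((radDeriv p : L2 d) : Space d → ℂ) =ᵐ[volume] fun x => h ‖x‖)
    {η : ℝ → ℝ} (hη : IsHalfLineTest η) :
    ∫ r in Set.Ioi (0 : ℝ), deriv η r • g r = -∫ r in Set.Ioi (0 : ℝ), η r • h r := by
  have h1 := integral_divergence (hη.inv_pow_mul d) p
  rw [integral_smul_radial hg fun r => r * deriv (fun r => (r ^ d)⁻¹ * η r) r + d * ((r ^ d)⁻¹ * η r),
    integral_smul_radial hh fun r => r * ((r ^ d)⁻¹ * η r), ← smul_neg] at h1
  have h2 := smul_right_injective ℂ (sphereArea_pos (d := d)).ne' h1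
  have hd : d - 1 + 1 = d := Nat.succ_pred_eq_of_ne_zero (NeZero.ne d)
  have e1 : ∫ r in Set.Ioi (0 : ℝ), deriv η r • g r = ∫ r in Set.Ioi (0 : ℝ), (r ^ (d - 1) *
      (r * deriv (fun r => (r ^ d)⁻¹ * η r) r + d * ((r ^ d)⁻¹ * η r))) • g r := by
    refine setIntegral_congr_fun measurableSet_Ioi fun r hr => ?_
    have hr0 : (r : ℝ) ≠ 0 := ne_of_gt hr
    have h3 := ((hasDerivAt_pow d r).fun_inv (pow_ne_zero d hr0)).fun_mul
      ((hη.contDiff.differentiable (by simp)) r).hasDerivAt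
    rw [h3.deriv]
    congr 1
    have h4 : r ^ d = r ^ (d - 1) * r := by rw [← pow_succ, hd]
    rw [h4]
    have h5 := pow_ne_zero (d - 1) hr0
    field_simp
    ring
  have e2 : ∫ r in Set.Ioi (0 : ℝ), η r • h r =
      ∫ r in Set.Ioi (0 : ℝ), (r ^ (d - 1) * (r * ((r ^ d)⁻¹ * η r))) • h r := by
    refine setIntegral_congr_fun measurableSet_Ioi fun r hr => ?_
    have hr0 : (r : ℝ) ≠ 0 := ne_of_gt hr
    congr 1
    have h4 : r ^ d = r ^ (d - 1) * r := by rw [← pow_succ, hd]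
    rw [h4]
    have h5 := pow_ne_zero (d - 1) hr0
    field_simp
  rw [e1, e2]
  exact h2

theorem exists_profile (p : H1rad d) : ∃ g h, IsProfile p g h := by
  obtain ⟨g₀, hg₀⟩ := p.2.1
  obtain ⟨h, hh⟩ := (radDeriv p).2
  have hhi := locIntPos_of_ae_eq hh
  obtain ⟨c, hc⟩ := exists_primitive_of_weak_deriv (locIntPos_of_ae_eq hg₀) hhi
    fun η hη => weak_deriv_profile hg₀ hh hη
  refine ⟨fun r => c + ∫ s in (1 : ℝ)..r, h s, h, ?_, hh, fun a b ha hb => ?_⟩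
  · filter_upwards [hg₀, (ae_norm_iff (d := d)
      (P := fun r => g₀ r = c + ∫ s in (1 : ℝ)..r, h s)).2 hc] with x h1 h2
    rw [h1, h2]
  · rw [add_sub_add_left_eq_sub, intervalIntegral.integral_interval_sub_left]
    · exact hhi.intervalIntegrable one_pos hb
    · exact hhi.intervalIntegrable one_pos ha

namespace IsProfile

variable {p : H1rad d} {g h : ℝ → ℂ} (hp : IsProfile p g h)
include hp

theorem locIntPos : LocIntPos h := locIntPos_of_ae_eq hp.eq_deriv

theorem continuousOn : ContinuousOn g (Set.Ioi 0) :=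
  continuousOn_of_forall_sub_eq_integral hp.sub_eq hp.locIntPos

theorem congr_deriv {k : ℝ → ℂ} (hk : h =ᵐ[volume.restrict (Set.Ioi 0)] k) : IsProfile p g k where
  eq_fst := hp.eq_fst
  eq_deriv := by
    filter_upwards [hp.eq_deriv, (ae_norm_iff (d := d) (P := fun r => h r = k r)).2 hk] with x h1 h2
    rw [h1, h2]
  sub_eq a b ha hb := by
    rw [hp.sub_eq a b ha hb]
    apply intervalIntegral.integral_congr_ae
    rw [EventuallyEq, ae_restrict_iff' measurableSet_Ioi] at hk
    filter_upwards [hk] with r hr hr'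
    exact hr (lt_of_lt_of_le (lt_min ha hb) (Set.uIoc_subset_uIcc hr').1)

/-- A radial function with a weak radial Laplacian `W(|x|)`, `W` continuous away from zero, is a
classical solution of the radial equation away from zero. -/
theorem exists_classical {W : ℝ → ℂ} (hW : ContinuousOn W (Set.Ioi 0))
    (H : ∀ χ (hχ : IsHalfLineTest χ),
      (Δ (toDist p.1.fst)) (radTest hχ d) = ∫ x : Space d, (χ ‖x‖ : ℂ) * W ‖x‖) :
    ∃ k, IsProfile p g k ∧ (∀ r, 0 < r → HasDerivAt g (k r) r) ∧
      ∀ r, 0 < r → HasDerivAt (fun r => r ^ (d - 1) • k r) (r ^ (d - 1) • W r) r := by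
  have hpow : ContinuousOn (fun r : ℝ => r ^ (d - 1)) (Set.Ioi 0) := (continuous_pow _).continuousOn
  have hWc : ContinuousOn (fun r : ℝ => r ^ (d - 1) • W r) (Set.Ioi 0) := hpow.smul hW
  -- Weakly, the flux r^{d-1}h has derivative r^{d-1}W. As W is continuous, the flux has a C¹
  -- representative F, and F/r^{d-1} is the classical derivative of g.
  obtain ⟨c, hc⟩ := exists_primitive_of_weak_deriv (hp.locIntPos.continuousOn_smul hpow)
    (LocIntPos.of_continuousOn hWc) fun η hη => by
      have h1 := H η hη
      rw [laplacian_radTest, integral_smul_radial hp.eq_deriv (deriv η),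
        integral_norm fun r => (η r : ℂ) * W r, ← smul_neg] at h1
      have h2 := smul_right_injective ℂ (sphereArea_pos (d := d)).ne' h1
      simp only [neg_eq_iff_eq_neg] at h2
      simp only [Complex.real_smul, ← mul_assoc, ← Complex.ofReal_mul] at h2 ⊢
      simpa only [mul_comm] using h2
  set F : ℝ → ℂ := fun r => c + ∫ s in (1 : ℝ)..r, s ^ (d - 1) • W s
  have hF : ∀ r, 0 < r → HasDerivAt F (r ^ (d - 1) • W r) r := by
    intro r hr
    refine hasDerivAt_of_forall_sub_eq_integral (h := fun r => r ^ (d - 1) • W r)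
      (fun a b ha hb => ?_) hWc hr
    simp only [F]
    rw [add_sub_add_left_eq_sub, intervalIntegral.integral_interval_sub_left]
    · exact (LocIntPos.of_continuousOn hWc).intervalIntegrable one_pos hb
    · exact (LocIntPos.of_continuousOn hWc).intervalIntegrable one_pos ha
  have hFc : ContinuousOn F (Set.Ioi 0) := fun r hr => (hF r hr).continuousAt.continuousWithinAt
  have hkc : ContinuousOn (fun r : ℝ => (r ^ (d - 1))⁻¹ • F r) (Set.Ioi 0) :=
    (hpow.inv₀ fun r hr => (pow_pos hr _).ne').smul hFc
  have hk : IsProfile p g fun r => (r ^ (d - 1))⁻¹ • F r := by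
    refine hp.congr_deriv ?_
    filter_upwards [hc, ae_restrict_mem measurableSet_Ioi] with r hr hr0
    rw [← hr, inv_smul_smul₀ (pow_pos hr0 _).ne']
  refine ⟨_, hk, fun r hr => hasDerivAt_of_forall_sub_eq_integral hk.sub_eq hkc hr, fun r hr => ?_⟩
  refine (hF r hr).congr_of_eventuallyEq ?_
  filter_upwards [Ioi_mem_nhds hr] with s hs
  exact smul_inv_smul₀ (pow_pos hs _).ne' _

end IsProfile

end Profile

end KleinGordon

/-! ### A criterion for compactness -/

section CompactCriterion

variable {E F : Type*} [NormedAddCommGroup E] [InnerProductSpace ℂ E] [CompleteSpace E]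
  [NormedAddCommGroup F] [NormedSpace ℂ F] [CompleteSpace F]

/-- An operator which is arbitrarily small on subspaces of finite codimension is compact. -/
theorem isCompactOperator_of_small_on_ker (T : E →L[ℂ] F)
    (h : ∀ ε : ℝ, 0 < ε → ∃ (n : ℕ) (l : Fin n → E →L[ℂ] ℂ),
      ∀ x, (∀ j, l j x = 0) → ‖T x‖ ≤ ε * ‖x‖) : IsCompactOperator T := by
  have hcl := isClosed_setOfPred_isCompactOperator (𝕜₁ := ℂ) (𝕜₂ := ℂ) (σ₁₂ := RingHom.id ℂ)
    (M₁ := E) (M₂ := F)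
  suffices T ∈ closure {f : E →L[ℂ] F | IsCompactOperator f} by
    rw [hcl.closure_eq] at this
    exact this
  rw [Metric.mem_closure_iff]
  intro ε hε
  obtain ⟨n, l, hl⟩ := h (ε / 2) (by positivity)
  let Φ : E →L[ℂ] (Fin n → ℂ) := ContinuousLinearMap.pi l
  -- The complement of K embeds into ℂⁿ, so T after the projection onto it has finite rank, and it
  -- differs from T by T after the projection onto K, of norm at most ε/2.
  let K : Submodule ℂ E := LinearMap.ker (Φ : E →ₗ[ℂ] (Fin n → ℂ))
  have hK : IsClosed (K : Set E) := Φ.isClosed_ker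
  have : CompleteSpace K := hK.completeSpace_coe
  have hinj : Function.Injective ((Φ : E →ₗ[ℂ] (Fin n → ℂ)) ∘ₗ Kᗮ.subtype) := by
    rw [injective_iff_map_eq_zero]
    intro x hx
    have h1 : (x : E) ∈ K := hx
    have h2 : inner ℂ (x : E) (x : E) = 0 := x.2 _ h1
    exact Subtype.ext (inner_self_eq_zero.1 h2)
  have : FiniteDimensional ℂ Kᗮ := FiniteDimensional.of_injective _ hinj
  have : ProperSpace Kᗮ := FiniteDimensional.proper ℂ Kᗮ
  refine ⟨(T ∘L Kᗮ.subtypeL) ∘L Kᗮ.orthogonalProjectionOnto, ?_, ?_⟩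
  · have h1 : IsCompactOperator (T ∘L Kᗮ.subtypeL) :=
      isCompactOperator_of_locallyCompactSpace_rng (T ∘L Kᗮ.subtypeL)
    exact h1.comp_clm _
  · rw [dist_eq_norm]
    refine lt_of_le_of_lt (ContinuousLinearMap.opNorm_le_bound _ (M := ε / 2) (by positivity)
      fun x => ?_) (by linarith)
    have h2 : x - Kᗮ.orthogonalProjectionOnto x = K.orthogonalProjectionOnto x := by
      rw [Submodule.orthogonalProjectionOnto_orthogonal]
      simp
    have h1 : (T - (T ∘L Kᗮ.subtypeL) ∘L Kᗮ.orthogonalProjectionOnto) x =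
        T (K.orthogonalProjectionOnto x : E) := by
      rw [← h2]
      simp
    rw [h1]
    refine (hl _ fun j => ?_).trans ?_
    · exact congrFun (K.orthogonalProjectionOnto x).2 j
    · gcongr
      exact Submodule.norm_orthogonalProjectionOnto_apply_le _ _

end CompactCriterion

/-- Cauchy–Schwarz, obtained from the nonnegativity of the variance ∫(f - m)², with m the mean of f.
-/
theorem sq_intervalIntegral_le {f : ℝ → ℝ} {a b : ℝ} (hab : a ≤ b)
    (hf : IntervalIntegrable f volume a b) (hf2 : IntervalIntegrable (fun r => f r ^ 2) volume a b) :
    (∫ r in a..b, f r) ^ 2 ≤ (b - a) * ∫ r in a..b, f r ^ 2 := by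
  rcases hab.eq_or_lt with rfl | hlt
  · simp
  set I := ∫ r in a..b, f r
  set m := I / (b - a)
  have hba : 0 < b - a := by linarith
  have h0 : 0 ≤ ∫ r in a..b, (f r - m) ^ 2 :=
    intervalIntegral.integral_nonneg hab fun r _ => sq_nonneg _
  have h1 : ∫ r in a..b, (f r - m) ^ 2 =
      (∫ r in a..b, f r ^ 2) - 2 * m * I + m ^ 2 * (b - a) := by
    have : ∀ r, (f r - m) ^ 2 = f r ^ 2 - 2 * m * f r + m ^ 2 := fun r => by ring
    simp only [this]
    rw [intervalIntegral.integral_add (hf2.sub (hf.const_mul _)) intervalIntegrable_const,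
      intervalIntegral.integral_sub hf2 (hf.const_mul _), intervalIntegral.integral_const_mul,
      intervalIntegral.integral_const, smul_eq_mul]
    ring
  have h2 : I = m * (b - a) := by simp only [m]; field_simp
  have h3 : I ^ 2 = (b - a) * (m * I) := by
    calc I ^ 2 = I * I := sq I
      _ = (m * (b - a)) * I := by rw [← h2]
      _ = _ := by ring
  rw [h3]
  refine mul_le_mul_of_nonneg_left ?_ hba.le
  have h4 : m ^ 2 * (b - a) = m * I := by rw [h2]; ring
  linarith

theorem norm_add_sq_le {E : Type*} [SeminormedAddCommGroup E] (a b : E) :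
    ‖a + b‖ ^ 2 ≤ 2 * ‖a‖ ^ 2 + 2 * ‖b‖ ^ 2 := by
  have h1 : ‖a + b‖ ^ 2 ≤ (‖a‖ + ‖b‖) ^ 2 := by gcongr; exact norm_add_le a b
  nlinarith [sq_nonneg (‖a‖ - ‖b‖)]

/-! ### Pointwise estimates for radial H¹ functions -/

namespace KleinGordon

variable {d : ℕ}

/-- The radial `L²` norm square of a function on the half-line. -/
def radSq (d : ℕ) (k : ℝ → ℂ) : ℝ := ∫ r in Set.Ioi (0 : ℝ), r ^ (d - 1) * ‖k r‖ ^ 2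

theorem radSq_nonneg (k : ℝ → ℂ) : 0 ≤ radSq d k :=
  setIntegral_nonneg measurableSet_Ioi fun _ hr => mul_nonneg (pow_nonneg (le_of_lt hr) _)
    (sq_nonneg _)

theorem intervalIntegrable_norm_sq {k : ℝ → ℂ}
    (hk : IntegrableOn (fun r : ℝ => r ^ (d - 1) * ‖k r‖ ^ 2) (Set.Ioi 0)) {a b : ℝ}
    (ha : 0 < a) (hab : a ≤ b) : IntervalIntegrable (fun r => ‖k r‖ ^ 2) volume a b := by
  rw [intervalIntegrable_iff_integrableOn_Icc_of_le hab]
  have h2 : IntegrableOn (fun r : ℝ => r ^ (d - 1) * ‖k r‖ ^ 2) (Set.Icc a b) :=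
    hk.mono_set fun r hr => lt_of_lt_of_le ha hr.1
  have h3 : ContinuousOn (fun r : ℝ => (r ^ (d - 1))⁻¹) (Set.Icc a b) :=
    (continuous_pow _).continuousOn.inv₀ fun r hr => (pow_pos (lt_of_lt_of_le ha hr.1) _).ne'
  refine (h2.continuousOn_smul h3 isCompact_Icc).congr_fun (fun r hr => ?_) measurableSet_Icc
  exact inv_mul_cancel_left₀ (pow_pos (lt_of_lt_of_le ha hr.1) _).ne' _

theorem pow_mul_integral_norm_sq_le {k : ℝ → ℂ}
    (hk : IntegrableOn (fun r : ℝ => r ^ (d - 1) * ‖k r‖ ^ 2) (Set.Ioi 0)) {a b : ℝ}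
    (ha : 0 < a) (hab : a ≤ b) : a ^ (d - 1) * ∫ r in a..b, ‖k r‖ ^ 2 ≤ radSq d k := by
  rw [← intervalIntegral.integral_const_mul, intervalIntegral.integral_of_le hab]
  have hsub : Set.Ioc a b ⊆ Set.Ioi 0 := fun r hr => lt_trans ha hr.1
  refine (setIntegral_mono_on ?_ (hk.mono_set hsub) measurableSet_Ioc fun r hr => ?_).trans
    (setIntegral_mono_set hk ?_ hsub.eventuallyLE)
  · have := (intervalIntegrable_norm_sq hk ha hab).const_mul (a ^ (d - 1))
    rwa [intervalIntegrable_iff_integrableOn_Ioc_of_le hab] at this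
  · gcongr
    exact hr.1.le
  · filter_upwards [ae_restrict_mem measurableSet_Ioi] with r hr
    exact mul_nonneg (pow_nonneg (le_of_lt hr) _) (sq_nonneg _)

namespace IsProfile

variable [NeZero d] {p : H1rad d} {g h : ℝ → ℂ} (hp : IsProfile p g h)
include hp

theorem integrableOn_fst : IntegrableOn (fun r : ℝ => r ^ (d - 1) * ‖g r‖ ^ 2) (Set.Ioi 0) :=
  integrableOn_norm_sq_of_ae_eq hp.eq_fst

theorem integrableOn_deriv : IntegrableOn (fun r : ℝ => r ^ (d - 1) * ‖h r‖ ^ 2) (Set.Ioi 0) :=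
  integrableOn_norm_sq_of_ae_eq hp.eq_deriv

theorem sphereArea_mul_radSq_fst : sphereArea d * radSq d g ≤ ‖p‖ ^ 2 := by
  rw [radSq, norm_sq_of_ae_eq hp.eq_fst]
  gcongr
  exact WithLp.norm_fst_le _ p.1

theorem sphereArea_mul_radSq_deriv : sphereArea d * radSq d h ≤ d ^ 2 * ‖p‖ ^ 2 := by
  rw [radSq, norm_sq_of_ae_eq hp.eq_deriv, ← mul_pow]
  gcongr
  exact norm_radDeriv_le p

theorem pow_mul_norm_sub_sq_le {a b : ℝ} (ha : 0 < a) (hab : a ≤ b) :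
    a ^ (d - 1) * ‖g b - g a‖ ^ 2 ≤ (b - a) * radSq d h := by
  have hb : 0 < b := lt_of_lt_of_le ha hab
  rw [hp.sub_eq a b ha hb]
  have h1 : ‖∫ r in a..b, h r‖ ^ 2 ≤ (∫ r in a..b, ‖h r‖) ^ 2 := by
    gcongr
    exact intervalIntegral.norm_integral_le_integral_norm hab
  have h2 := sq_intervalIntegral_le hab (hp.locIntPos.intervalIntegrable ha hb).norm
    (intervalIntegrable_norm_sq hp.integrableOn_deriv ha hab)
  have h3 := pow_mul_integral_norm_sq_le hp.integrableOn_deriv ha hab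
  have h4 : 0 ≤ b - a := by linarith
  have h5 : 0 < a ^ (d - 1) := by positivity
  calc a ^ (d - 1) * ‖∫ r in a..b, h r‖ ^ 2
      ≤ a ^ (d - 1) * ((b - a) * ∫ r in a..b, ‖h r‖ ^ 2) := by gcongr; exact h1.trans h2
    _ = (b - a) * (a ^ (d - 1) * ∫ r in a..b, ‖h r‖ ^ 2) := by ring
    _ ≤ _ := by gcongr

/-- Compare g(r) with g(s) for s in [1,2] and average over s; there the weight is at least 1 and s -
r ≤ 2. -/
theorem pow_mul_norm_sq_le {r : ℝ} (hr : 0 < r) (hr1 : r ≤ 1) :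
    r ^ (d - 1) * ‖g r‖ ^ 2 ≤ 2 * radSq d g + 4 * radSq d h := by
  have hH := radSq_nonneg (d := d) h
  have hpt : ∀ s ∈ Set.Icc (1 : ℝ) 2, r ^ (d - 1) * ‖g r‖ ^ 2 - 4 * radSq d h ≤ 2 * ‖g s‖ ^ 2 := by
    intro s hs
    have h1 := hp.pow_mul_norm_sub_sq_le hr (hr1.trans hs.1)
    have h2 := norm_add_sq_le (g s) (-(g s - g r))
    rw [norm_neg, neg_sub, add_sub_cancel] at h2
    have h3 : r ^ (d - 1) ≤ 1 := pow_le_one₀ hr.le hr1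
    have h4 : 0 < r ^ (d - 1) := by positivity
    have h5 : (s - r) * radSq d h ≤ 2 * radSq d h := by gcongr; linarith [hs.2]
    calc r ^ (d - 1) * ‖g r‖ ^ 2 - 4 * radSq d h
        ≤ r ^ (d - 1) * (2 * ‖g s‖ ^ 2 + 2 * ‖g s - g r‖ ^ 2) - 4 * radSq d h := by gcongr
      _ = r ^ (d - 1) * (2 * ‖g s‖ ^ 2) + 2 * (r ^ (d - 1) * ‖g s - g r‖ ^ 2) - 4 * radSq d h := by
          ring
      _ ≤ 1 * (2 * ‖g s‖ ^ 2) + 2 * (2 * radSq d h) - 4 * radSq d h := by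
          have := h1.trans h5
          have : r ^ (d - 1) * (2 * ‖g s‖ ^ 2) ≤ 1 * (2 * ‖g s‖ ^ 2) := by gcongr
          linarith
      _ = _ := by ring
  have hi := intervalIntegrable_norm_sq hp.integrableOn_fst one_pos one_le_two
  have h6 := intervalIntegral.integral_mono_on one_le_two intervalIntegrable_const
    (hi.const_mul 2) hpt
  have h7 := pow_mul_integral_norm_sq_le hp.integrableOn_fst one_pos one_le_two
  rw [intervalIntegral.integral_const, intervalIntegral.integral_const_mul] at h6
  simp only [one_pow, one_mul, smul_eq_mul] at h6 h7
  linarith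

/-- Poincaré inequality on a shell: as the weighted mean of g vanishes, g(r) is the weighted mean of
g(r) - g(t), which is controlled by h. -/
theorem norm_sq_le_of_integral_eq_zero {a b r : ℝ} (ha : 0 < a) (hab : a < b)
    (h0 : ∫ t in a..b, t ^ (d - 1) • g t = 0) (hr : r ∈ Set.Icc a b) :
    a ^ (d - 1) * ‖g r‖ ^ 2 ≤ (b - a) * radSq d h := by
  have hH := radSq_nonneg (d := d) h
  have ha1 : 0 < a ^ (d - 1) := by positivity
  set c := Real.sqrt ((b - a) * radSq d h / a ^ (d - 1))
  have hc : ∀ t ∈ Set.Icc a b, ‖g r - g t‖ ≤ c := by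
    intro t ht
    apply Real.le_sqrt_of_sq_le
    rw [le_div_iff₀ ha1]
    rcases le_total r t with hrt | hrt
    · have h1 := hp.pow_mul_norm_sub_sq_le (lt_of_lt_of_le ha hr.1) hrt
      rw [norm_sub_rev]
      calc ‖g t - g r‖ ^ 2 * a ^ (d - 1) ≤ ‖g t - g r‖ ^ 2 * r ^ (d - 1) := by
            gcongr; exact hr.1
        _ ≤ (t - r) * radSq d h := by rw [mul_comm]; exact h1
        _ ≤ _ := by gcongr; exacts [ht.2, hr.1]
    · have h1 := hp.pow_mul_norm_sub_sq_le (lt_of_lt_of_le ha ht.1) hrt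
      calc ‖g r - g t‖ ^ 2 * a ^ (d - 1) ≤ ‖g r - g t‖ ^ 2 * t ^ (d - 1) := by
            gcongr; exact ht.1
        _ ≤ (r - t) * radSq d h := by rw [mul_comm]; exact h1
        _ ≤ _ := by gcongr; exacts [hr.2, ht.1]
  have hpow : IntervalIntegrable (fun t : ℝ => t ^ (d - 1)) volume a b :=
    (continuous_pow _).intervalIntegrable _ _
  have hg : IntervalIntegrable (fun t => t ^ (d - 1) • g t) volume a b :=
    (LocIntPos.of_continuousOn ((continuous_pow _).continuousOn.smul hp.continuousOn)).intervalIntegrable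
      ha (ha.trans hab)
  have h1 : ∫ t in a..b, t ^ (d - 1) • (g r - g t) = (∫ t in a..b, t ^ (d - 1)) • g r := by
    simp only [smul_sub]
    rw [intervalIntegral.integral_sub _ hg, h0, sub_zero, intervalIntegral.integral_smul_const]
    exact (LocIntPos.of_continuousOn ((continuous_pow _).continuousOn.smul
      continuousOn_const)).intervalIntegrable ha (ha.trans hab)
  have hm : 0 < ∫ t in a..b, t ^ (d - 1) :=
    intervalIntegral.intervalIntegral_pos_of_pos_on hpow
      (fun t ht => pow_pos (ha.trans ht.1) _) hab
  have h2 : ‖∫ t in a..b, t ^ (d - 1) • (g r - g t)‖ ≤ ∫ t in a..b, t ^ (d - 1) * c := by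
    refine intervalIntegral.norm_integral_le_of_norm_le hab.le ?_ (hpow.mul_const _)
    refine Eventually.of_forall fun t ht => ?_
    have ht0 : 0 < t := ha.trans ht.1
    rw [norm_smul, Real.norm_of_nonneg (by positivity)]
    gcongr
    exact hc t (Set.Ioc_subset_Icc_self ht)
  rw [h1, norm_smul, Real.norm_of_nonneg hm.le, intervalIntegral.integral_mul_const] at h2
  have h3 : ‖g r‖ ≤ c := le_of_mul_le_mul_left h2 hm
  have h4 : ‖g r‖ ^ 2 ≤ (b - a) * radSq d h / a ^ (d - 1) := by
    rw [← Real.sq_sqrt (show 0 ≤ (b - a) * radSq d h / a ^ (d - 1) from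
      div_nonneg (mul_nonneg (by linarith) hH) ha1.le)]
    gcongr
  rw [le_div_iff₀ ha1] at h4
  linarith

/-- Three regions: for r ≤ 2δ the weighted pointwise bound on a short interval, for 2δ < r ≤ R the
Poincaré inequality on shells of width η, and for r > R the smallness of v. -/
theorem norm_radMul_sq_le {v : ℝ → ℂ} (hv : MemLp (fun x : Space d => v ‖x‖) ∞ volume)
    {M ε R δ η : ℝ} (hM : ∀ r, 0 < r → ‖v r‖ ≤ M) (hε : ∀ r, R ≤ r → ‖v r‖ ≤ ε)
    (hR : 0 < R) (hδ : 0 < δ) (hδ1 : 2 * δ ≤ 1) (hη : 0 < η) (hηδ : η ≤ δ)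
    (h0 : ∀ j : ℕ, δ ≤ j * η → j * η ≤ R →
      ∫ t in (j * η)..((j + 1 : ℕ) * η), t ^ (d - 1) • g t = 0) :
    ‖radMul d v (inclCLM d p)‖ ^ 2 ≤ (2 * δ * (M ^ 2 * (2 + 4 * d ^ 2)) +
      R * (M ^ 2 * (R ^ (d - 1) * (η * d ^ 2 / δ ^ (d - 1)))) + ε ^ 2) * ‖p‖ ^ 2 := by
  set G := radSq d g
  set H := radSq d h
  have hG0 : 0 ≤ G := radSq_nonneg g
  have hH0 : 0 ≤ H := radSq_nonneg h
  have hw : ((radMul d v (inclCLM d p) : L2 d) : Space d → ℂ) =ᵐ[volume]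
      fun x => v ‖x‖ * g ‖x‖ := by
    filter_upwards [coeFn_radMul hv (inclCLM d p), hp.eq_fst] with x h1 h2
    rw [h1, ← h2]
    rfl
  set c₁ := M ^ 2 * (2 * G + 4 * H)
  set c₂ := M ^ 2 * (R ^ (d - 1) * (η * H / δ ^ (d - 1)))
  have hc₁ : 0 ≤ c₁ := by positivity
  have hc₂ : 0 ≤ c₂ := by positivity
  have hδp : 0 < δ ^ (d - 1) := by positivity
  have hpt : ∀ r ∈ Set.Ioi (0 : ℝ), r ^ (d - 1) * ‖v r * g r‖ ^ 2 ≤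
      ((Set.Ioc 0 (2 * δ)).indicator (fun _ => c₁) r + (Set.Ioc 0 R).indicator (fun _ => c₂) r) +
        ε ^ 2 * (r ^ (d - 1) * ‖g r‖ ^ 2) := by
    intro r hr
    have hr0 : 0 < r := hr
    have hrp : 0 < r ^ (d - 1) := by positivity
    have hi1 : 0 ≤ (Set.Ioc 0 (2 * δ)).indicator (fun _ => c₁) r :=
      Set.indicator_nonneg (fun _ _ => hc₁) r
    have hi2 : 0 ≤ (Set.Ioc 0 R).indicator (fun _ => c₂) r :=
      Set.indicator_nonneg (fun _ _ => hc₂) r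
    have hi3 : 0 ≤ ε ^ 2 * (r ^ (d - 1) * ‖g r‖ ^ 2) := by positivity
    have hexp : r ^ (d - 1) * ‖v r * g r‖ ^ 2 = ‖v r‖ ^ 2 * (r ^ (d - 1) * ‖g r‖ ^ 2) := by
      rw [norm_mul, mul_pow]; ring
    have hMr : ‖v r‖ ^ 2 ≤ M ^ 2 := by gcongr; exact hM r hr0
    rw [hexp]
    rcases le_or_gt r (2 * δ) with h1 | h1
    · rw [Set.indicator_of_mem (show r ∈ Set.Ioc 0 (2 * δ) from ⟨hr0, h1⟩)]
      have h2 := hp.pow_mul_norm_sq_le hr0 (h1.trans hδ1)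
      have h3 : ‖v r‖ ^ 2 * (r ^ (d - 1) * ‖g r‖ ^ 2) ≤ c₁ := by
        simp only [c₁]; gcongr
      linarith
    rcases le_or_gt r R with h4 | h4
    · rw [Set.indicator_of_mem (show r ∈ Set.Ioc 0 R from ⟨hr0, h4⟩)]
      have hj1 := Nat.floor_le (show 0 ≤ r / η by positivity)
      have hj2 := Nat.lt_floor_add_one (r / η)
      set j := ⌊r / η⌋₊
      rw [le_div_iff₀ hη] at hj1
      rw [div_lt_iff₀ hη] at hj2
      -- Since r > 2δ and η ≤ δ, the shell containing r starts beyond δ; this is why the inner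
      -- region reaches to 2δ.
      have hjδ : δ ≤ j * η := by linarith
      have h5 := hp.norm_sq_le_of_integral_eq_zero (r := r) (hδ.trans_le hjδ)
        (by push_cast; linarith) (h0 j hjδ (hj1.trans h4)) ⟨hj1, by push_cast; linarith⟩
      have h6 : ‖g r‖ ^ 2 ≤ η * H / δ ^ (d - 1) := by
        rw [le_div_iff₀ hδp, mul_comm]
        calc δ ^ (d - 1) * ‖g r‖ ^ 2 ≤ (j * η) ^ (d - 1) * ‖g r‖ ^ 2 := by gcongr
          _ ≤ _ := h5
          _ = η * H := by push_cast; ring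
      have h3 : ‖v r‖ ^ 2 * (r ^ (d - 1) * ‖g r‖ ^ 2) ≤ c₂ := by
        simp only [c₂]; gcongr
      linarith
    · have h2 : ‖v r‖ ^ 2 ≤ ε ^ 2 := by gcongr; exact hε r h4.le
      have h3 : ‖v r‖ ^ 2 * (r ^ (d - 1) * ‖g r‖ ^ 2) ≤ ε ^ 2 * (r ^ (d - 1) * ‖g r‖ ^ 2) := by
        gcongr
      linarith
  have hind : ∀ (b c : ℝ), IntegrableOn
      (fun r : ℝ => (Set.Ioc 0 b).indicator (fun _ => c) r) (Set.Ioi 0) := by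
    intro b c
    exact (integrable_indicator_iff measurableSet_Ioc).2 (integrableOn_const (by simp))
      |>.integrableOn
  have hindv : ∀ (b c : ℝ), 0 < b →
      ∫ r in Set.Ioi (0 : ℝ), (Set.Ioc 0 b).indicator (fun _ => c) r = b * c := by
    intro b c hb
    rw [setIntegral_indicator measurableSet_Ioc,
      Set.inter_eq_right.2 Set.Ioc_subset_Ioi_self, setIntegral_const]
    simp [hb.le]
  have hi12 : IntegrableOn (fun r : ℝ => (Set.Ioc 0 (2 * δ)).indicator (fun _ => c₁) r +
      (Set.Ioc 0 R).indicator (fun _ => c₂) r) (Set.Ioi 0) := (hind (2 * δ) c₁).add (hind R c₂)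
  have hle := setIntegral_mono_on (integrableOn_norm_sq_of_ae_eq (k := fun r => v r * g r) hw)
    (hi12.add (hp.integrableOn_fst.const_mul (ε ^ 2))) measurableSet_Ioi hpt
  simp only [Pi.add_apply] at hle
  rw [integral_add hi12 (hp.integrableOn_fst.const_mul (ε ^ 2)),
    integral_add (hind (2 * δ) c₁) (hind R c₂), hindv _ _ (by positivity), hindv _ _ hR,
    integral_const_mul] at hle
  have hnorm : ‖radMul d v (inclCLM d p)‖ ^ 2 =
      sphereArea d * ∫ r in Set.Ioi (0 : ℝ), r ^ (d - 1) * ‖v r * g r‖ ^ 2 :=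
    (norm_sq_of_ae_eq (k := fun r => v r * g r) hw).symm
  have hσ := sphereArea_pos (d := d)
  have e1 := hp.sphereArea_mul_radSq_fst
  have e2 := hp.sphereArea_mul_radSq_deriv
  rw [hnorm]
  calc sphereArea d * ∫ r in Set.Ioi (0 : ℝ), r ^ (d - 1) * ‖v r * g r‖ ^ 2
      ≤ sphereArea d * (2 * δ * c₁ + R * c₂ + ε ^ 2 * G) := by gcongr; exact hle
    _ = 2 * δ * (M ^ 2 * (2 * (sphereArea d * G) + 4 * (sphereArea d * H))) +
        R * (M ^ 2 * (R ^ (d - 1) * (η * (sphereArea d * H) / δ ^ (d - 1)))) +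
        ε ^ 2 * (sphereArea d * G) := by simp only [c₁, c₂]; ring
    _ ≤ 2 * δ * (M ^ 2 * (2 * ‖p‖ ^ 2 + 4 * (d ^ 2 * ‖p‖ ^ 2))) +
        R * (M ^ 2 * (R ^ (d - 1) * (η * (d ^ 2 * ‖p‖ ^ 2) / δ ^ (d - 1)))) +
        ε ^ 2 * ‖p‖ ^ 2 := by gcongr
    _ = _ := by ring

end IsProfile

/-! ### Compactness of the potential relative to the free operator -/

section Compactness

variable [NeZero d]

/-- The indicator function of an annulus. -/
def annulusFun (d : ℕ) (a b : ℝ) : L2 d :=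
  indicatorConstLp 2 (s := {x : Space d | a < ‖x‖ ∧ ‖x‖ ≤ b})
    ((measurableSet_lt measurable_const measurable_norm).inter
      (measurableSet_le measurable_norm measurable_const))
    (((measure_mono fun x hx => by simpa using hx.2).trans_lt
      (measure_closedBall_lt_top (x := (0 : Space d)) (r := b))).ne) (1 : ℂ)

theorem coeFn_annulusFun (a b : ℝ) : annulusFun d a b =ᵐ[volume]
    fun x => (((Set.Ioc a b).indicator (fun _ => (1 : ℝ)) ‖x‖ : ℝ) : ℂ) := by
  refine indicatorConstLp_coeFn.trans (Eventually.of_forall fun x => ?_)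
  by_cases hx : a < ‖x‖ ∧ ‖x‖ ≤ b <;> simp [hx]

theorem inner_annulusFun {u : L2 d} {g : ℝ → ℂ} (hu : u =ᵐ[volume] fun x => g ‖x‖) {a b : ℝ}
    (ha : 0 < a) (hab : a ≤ b) : inner ℂ (annulusFun d a b) u =
      sphereArea d • ∫ t in a..b, t ^ (d - 1) • g t := by
  have h1 : inner ℂ (annulusFun d a b) u =
      ∫ x : Space d, (((Set.Ioc a b).indicator (fun _ => (1 : ℝ)) ‖x‖ : ℝ) : ℂ) * u x := by
    rw [L2.inner_def]
    refine integral_congr_ae ?_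
    filter_upwards [coeFn_annulusFun a b] with x hx
    rw [hx, RCLike.inner_apply, Complex.conj_ofReal, mul_comm]
  rw [h1, integral_smul_radial hu ((Set.Ioc a b).indicator fun _ => (1 : ℝ)), intervalIntegral.integral_of_le hab]
  congr 1
  have h2 : ∀ r : ℝ, (r ^ (d - 1) * (Set.Ioc a b).indicator (fun _ => (1 : ℝ)) r) • g r =
      (Set.Ioc a b).indicator (fun r => r ^ (d - 1) • g r) r := by
    intro r
    by_cases hr : r ∈ Set.Ioc a b <;> simp [hr]
  simp only [h2]
  rw [setIntegral_indicator measurableSet_Ioc, Set.inter_eq_right.2]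
  exact fun r hr => ha.trans hr.1

/-- S factors through H¹_rad by a bounded map J. Choose R, then δ, then η, so that each region in
`norm_radMul_sq_le` contributes at most e²‖Jf‖²; the annular means are the finitely many functionals
of the compactness criterion. -/
theorem isCompactOperator_radMul_comp_freeRes {v : ℝ → ℂ}
    (hv : MemLp (fun x : Space d => v ‖x‖) ∞ volume) {M : ℝ} (hM : ∀ r, 0 < r → ‖v r‖ ≤ M)
    (hv0 : Tendsto v atTop (𝓝 0)) : IsCompactOperator (radMul d v ∘L freeRes d) := by
  obtain ⟨J, hJ⟩ := ContinuousLinearMap.exists_lift_of_range_subset (inclCLM d) (incl_injective d)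
    (freeRes d) fun f => exists_incl_eq (freeRes_mem_H2rad f)
  have hM0 : 0 ≤ M := (norm_nonneg _).trans (hM 1 one_pos)
  refine isCompactOperator_of_small_on_ker _ fun ε hε => ?_
  set e : ℝ := ε / (2 * (‖J‖ + 1)) with he
  have hJn : 0 ≤ ‖J‖ := norm_nonneg J
  have hepos : 0 < e := by positivity
  obtain ⟨R, hR0, hR⟩ : ∃ R, 0 < R ∧ ∀ r, R ≤ r → ‖v r‖ ≤ e := by
    obtain ⟨R, hR⟩ := eventually_atTop.1
      ((tendsto_zero_iff_norm_tendsto_zero.1 hv0).eventually_le_const hepos)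
    exact ⟨max R 1, by positivity, fun r hr => hR r ((le_max_left _ _).trans hr)⟩
  obtain ⟨δ, hδ, hδ1, hδe⟩ : ∃ δ : ℝ, 0 < δ ∧ 2 * δ ≤ 1 ∧
      2 * δ * (M ^ 2 * (2 + 4 * d ^ 2)) ≤ e ^ 2 := by
    set K := M ^ 2 * (2 + 4 * (d : ℝ) ^ 2)
    have hK : 0 ≤ K := by positivity
    refine ⟨min (1 / 2) (e ^ 2 / (2 * (K + 1))), by positivity, ?_, ?_⟩
    · linarith [min_le_left (1 / 2) (e ^ 2 / (2 * (K + 1)))]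
    · calc 2 * min (1 / 2) (e ^ 2 / (2 * (K + 1))) * K
          ≤ 2 * (e ^ 2 / (2 * (K + 1))) * (K + 1) := by
            gcongr
            · exact min_le_right _ _
            · linarith
        _ = e ^ 2 := by field_simp
  obtain ⟨η, hη, hηδ, hηe⟩ : ∃ η : ℝ, 0 < η ∧ η ≤ δ ∧
      R * (M ^ 2 * (R ^ (d - 1) * (η * d ^ 2 / δ ^ (d - 1)))) ≤ e ^ 2 := by
    set K := R * (M ^ 2 * (R ^ (d - 1) * (d ^ 2 / δ ^ (d - 1))))
    have hK : 0 ≤ K := by positivity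
    refine ⟨min δ (e ^ 2 / (K + 1)), by positivity, min_le_left _ _, ?_⟩
    calc R * (M ^ 2 * (R ^ (d - 1) * (min δ (e ^ 2 / (K + 1)) * d ^ 2 / δ ^ (d - 1))))
        = min δ (e ^ 2 / (K + 1)) * K := by simp only [K]; ring
      _ ≤ (e ^ 2 / (K + 1)) * (K + 1) := by
          gcongr
          · exact min_le_right _ _
          · linarith
      _ = e ^ 2 := by field_simp
  refine ⟨⌊R / η⌋₊ + 1, fun j => (innerSL ℂ (annulusFun d (j * η) ((j + 1 : ℕ) * η))) ∘L
    (L2rad d).subtypeL ∘L freeRes d, fun f hf => ?_⟩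
  obtain ⟨g, h, hp⟩ := exists_profile (J f)
  have hfst : (J f).1.fst = (freeRes d f : L2 d) := congrArg Subtype.val (hJ f)
  have hbound := hp.norm_radMul_sq_le hv hM hR hR0 hδ hδ1 hη hηδ fun j hj1 hj2 => by
    have hjlt : j < ⌊R / η⌋₊ + 1 := by
      rw [Nat.lt_add_one_iff]
      apply Nat.le_floor
      rwa [le_div_iff₀ hη]
    have h1 : inner ℂ (annulusFun d (j * η) ((j + 1 : ℕ) * η)) (J f).1.fst = 0 := by
      rw [hfst]
      exact hf ⟨j, hjlt⟩
    rw [inner_annulusFun hp.eq_fst (hδ.trans_le hj1) (by push_cast; nlinarith)] at h1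
    exact (smul_eq_zero.1 h1).resolve_left sphereArea_pos.ne'
  have h2 : ‖(radMul d v ∘L freeRes d) f‖ ^ 2 ≤ (2 * e * ‖J f‖) ^ 2 := by
    have : (radMul d v ∘L freeRes d) f = radMul d v (inclCLM d (J f)) := by rw [hJ]; rfl
    rw [this]
    -- Three contributions of at most e² each, and 3e² ≤ (2e)².
    refine hbound.trans ?_
    rw [mul_pow]
    gcongr
    nlinarith [sq_nonneg e]
  have h3 := (sq_le_sq₀ (norm_nonneg _) (by positivity)).1 h2
  calc _ ≤ 2 * e * ‖J f‖ := h3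
    _ ≤ 2 * e * ((‖J‖ + 1) * ‖f‖) := by
        gcongr
        exact (J.le_opNorm f).trans (by gcongr; linarith)
    _ = ε * ‖f‖ := by rw [he]; field_simp

end Compactness

end KleinGordon

/-! ### Nonlinear radial equation: boundedness near 0 and decay at infinity -/

theorem monotoneOn_of_hasDerivAt_nonneg {s : Set ℝ} (hs : Convex ℝ s) {f f' : ℝ → ℝ}
    (hf : ∀ t ∈ s, HasDerivAt f (f' t) t) (h0 : ∀ t ∈ s, 0 ≤ f' t) : MonotoneOn f s := by
  refine monotoneOn_of_deriv_nonneg hs (fun t ht => (hf t ht).continuousAt.continuousWithinAt)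
    (fun t ht => (hf t (interior_subset ht)).differentiableAt.differentiableWithinAt) fun t ht => ?_
  rw [(hf t (interior_subset ht)).deriv]
  exact h0 t (interior_subset ht)

theorem abs_sub_le_of_abs_deriv_le {y k B B' : ℝ → ℝ} {a b : ℝ} (hab : a ≤ b)
    (hy : ∀ t ∈ Set.Icc a b, HasDerivAt y (k t) t) (hB : ∀ t ∈ Set.Icc a b, HasDerivAt B (B' t) t)
    (h : ∀ t ∈ Set.Icc a b, |k t| ≤ B' t) : |y b - y a| ≤ B b - B a := by
  have h1 := monotoneOn_of_hasDerivAt_nonneg (convex_Icc a b) (fun t ht => (hB t ht).sub (hy t ht))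
    fun t ht => by linarith [le_abs_self (k t), h t ht]
  have h2 := monotoneOn_of_hasDerivAt_nonneg (convex_Icc a b) (fun t ht => (hB t ht).add (hy t ht))
    fun t ht => by linarith [neg_abs_le (k t), h t ht]
  have h3 := h1 (Set.left_mem_Icc.2 hab) (Set.right_mem_Icc.2 hab) hab
  have h4 := h2 (Set.left_mem_Icc.2 hab) (Set.right_mem_Icc.2 hab) hab
  simp only [Pi.sub_apply, Pi.add_apply] at h3 h4
  rw [abs_le]
  constructor <;> linarith

theorem hasDerivAt_rpow_div {σ t : ℝ} (hσ : σ ≠ 0) (ht : 0 < t) (C : ℝ) :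
    HasDerivAt (fun t : ℝ => C / σ * t ^ σ) (C * t ^ (σ - 1)) t := by
  have h := (Real.hasDerivAt_rpow_const (p := σ) (Or.inl ht.ne')).const_mul (C / σ)
  rwa [← mul_assoc, div_mul_cancel₀ C hσ] at h

/-- `y` solves `y'' + (n/r) y' = F(y)` on `(0, ∞)`, `k = y'`, with finite radial `H¹` norm. -/
structure IsRadialSolution (n : ℕ) (F y k : ℝ → ℝ) : Prop where
  deriv_fst : ∀ r, 0 < r → HasDerivAt y (k r) r
  deriv_flux : ∀ r, 0 < r → HasDerivAt (fun r => r ^ n * k r) (r ^ n * F (y r)) r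
  sq_fst : IntegrableOn (fun r => r ^ n * y r ^ 2) (Set.Ioi 0)
  sq_deriv : IntegrableOn (fun r => r ^ n * k r ^ 2) (Set.Ioi 0)

namespace IsRadialSolution

variable {n : ℕ} {F y k : ℝ → ℝ} (hs : IsRadialSolution n F y k)
include hs

theorem continuousOn_deriv : ContinuousOn k (Set.Ioi 0) := by
  have h1 : ContinuousOn (fun r : ℝ => (r ^ n)⁻¹ * (r ^ n * k r)) (Set.Ioi 0) :=
    ((continuous_pow _).continuousOn.inv₀ fun r hr => (pow_pos hr _).ne').mul
      fun r (hr : 0 < r) => (hs.deriv_flux r hr).continuousAt.continuousWithinAt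
  exact h1.congr fun r hr => (inv_mul_cancel_left₀ (pow_pos hr _).ne' _).symm

theorem continuousOn_fst : ContinuousOn y (Set.Ioi 0) := fun r hr =>
  (hs.deriv_fst r hr).continuousAt.continuousWithinAt

/-- Integrate |k| ≤ l tⁿk² + l⁻¹t⁻ⁿ from r to 1; the parameter l = r^{-a} balances both terms. For n
= 1 any a > 0 is admissible and absorbs the logarithm. -/
theorem abs_le_rpow {a : ℝ} (ha : 0 < a) (hn : (n : ℝ) - 1 ≤ 2 * a) :
    ∃ K, 1 ≤ K ∧ ∀ r, 0 < r → r ≤ 1 → |y r| ≤ K * r ^ (-a) := by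
  set H := ∫ r in Set.Ioi (0 : ℝ), r ^ n * k r ^ 2
  have hH : 0 ≤ H := setIntegral_nonneg measurableSet_Ioi fun r hr =>
    mul_nonneg (pow_nonneg (le_of_lt hr) _) (sq_nonneg _)
  refine ⟨1 + |y 1| + (H + 1 / (2 * a)), ?_, fun r hr hr1 => ?_⟩
  · have : 0 < 1 / (2 * a) := by positivity
    linarith [abs_nonneg (y 1)]
  set l := r ^ (-a)
  have hl : 0 < l := Real.rpow_pos_of_pos hr _
  have hl1 : 1 ≤ l := Real.one_le_rpow_of_pos_of_le_one_of_nonpos hr hr1 (by linarith)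
  have hc : ContinuousOn (fun s : ℝ => s ^ n * k s ^ 2) (Set.Ioi 0) :=
    (continuous_pow _).continuousOn.mul (hs.continuousOn_deriv.pow 2)
  have hpos : ∀ t ∈ Set.Icc r 1, 0 < t := fun t ht => lt_of_lt_of_le hr ht.1
  have hB : ∀ t ∈ Set.Icc r 1, HasDerivAt (fun t => l * (∫ s in r..t, s ^ n * k s ^ 2) +
      l⁻¹ * (1 / (-(2 * a)) * t ^ (-(2 * a)))) (l * (t ^ n * k t ^ 2) + l⁻¹ * (1 * t ^ (-(2 * a) - 1))) t := by
    intro t ht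
    refine HasDerivAt.add (HasDerivAt.const_mul l ?_)
      ((hasDerivAt_rpow_div (by linarith) (hpos t ht) 1).const_mul _)
    have := hasDerivAt_of_forall_sub_eq_integral (g := fun t => ∫ s in r..t, s ^ n * k s ^ 2)
      (fun a b ha hb => intervalIntegral.integral_interval_sub_left
        ((LocIntPos.of_continuousOn hc).intervalIntegrable hr hb)
        ((LocIntPos.of_continuousOn hc).intervalIntegrable hr ha)) hc (hpos t ht)
    exact this
  have hk : ∀ t ∈ Set.Icc r 1, |k t| ≤ l * (t ^ n * k t ^ 2) + l⁻¹ * (1 * t ^ (-(2 * a) - 1)) := by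
    intro t ht
    have ht0 := hpos t ht
    have htn : 0 < t ^ n := by positivity
    have h1 : (t ^ n)⁻¹ ≤ t ^ (-(2 * a) - 1) := by
      rw [← Real.rpow_natCast, ← Real.rpow_neg ht0.le]
      exact Real.rpow_le_rpow_of_exponent_ge ht0 ht.2 (by linarith)
    have h2 : |k t| ≤ l * (t ^ n * k t ^ 2) + l⁻¹ * (t ^ n)⁻¹ := by
      have h3 : 0 ≤ (l * t ^ n)⁻¹ * ((l * t ^ n * |k t| - 1) ^ 2 + l * t ^ n * |k t|) := by positivity
      have h4 : (l * t ^ n)⁻¹ * ((l * t ^ n * |k t| - 1) ^ 2 + l * t ^ n * |k t|) =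
          l * (t ^ n * |k t| ^ 2) + l⁻¹ * (t ^ n)⁻¹ - |k t| := by field_simp; ring
      rw [sq_abs] at h4
      linarith
    calc |k t| ≤ l * (t ^ n * k t ^ 2) + l⁻¹ * (t ^ n)⁻¹ := h2
      _ ≤ _ := by rw [one_mul]; gcongr
  have h1 := abs_sub_le_of_abs_deriv_le hr1 (fun t ht => hs.deriv_fst t (hpos t ht)) hB hk
  have h2 : ∫ s in r..1, s ^ n * k s ^ 2 ≤ H := by
    rw [intervalIntegral.integral_of_le hr1]
    refine setIntegral_mono_set hs.sq_deriv ?_ (LE.le.eventuallyLE fun s hs' => hr.trans hs'.1)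
    filter_upwards [ae_restrict_mem measurableSet_Ioi] with s hs'
    exact mul_nonneg (pow_nonneg (le_of_lt hs') _) (sq_nonneg _)
  have h3 : l⁻¹ * r ^ (-(2 * a)) = l := by
    have : r ^ (-(2 * a)) = l * l := by
      rw [← Real.rpow_add hr]; congr 1; ring
    rw [this, inv_mul_cancel_left₀ hl.ne']
  simp only [intervalIntegral.integral_same, mul_zero, zero_add, Real.one_rpow, mul_one] at h1
  have h4 : l * (∫ s in r..1, s ^ n * k s ^ 2) + l⁻¹ * (1 / -(2 * a)) -
      l⁻¹ * (1 / -(2 * a) * r ^ (-(2 * a))) ≤ l * H + 1 / (2 * a) * l := by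
    have e1 : l⁻¹ * (1 / -(2 * a) * r ^ (-(2 * a))) = -(1 / (2 * a)) * l := by
      rw [mul_left_comm, h3, one_div_neg_eq_neg_one_div]
    have e2 : l⁻¹ * (1 / -(2 * a)) ≤ 0 := by
      rw [one_div_neg_eq_neg_one_div]
      have : 0 < l⁻¹ * (1 / (2 * a)) := by positivity
      linarith
    rw [e1]
    have := mul_le_mul_of_nonneg_left h2 hl.le
    linarith
  have h5 : |y r| ≤ |y 1| + |y 1 - y r| := by
    have := abs_sub_abs_le_abs_sub (y r) (y 1)
    rw [abs_sub_comm] at this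
    linarith
  have h6 : |y 1| ≤ |y 1| * l := le_mul_of_one_le_right (abs_nonneg _) hl1
  have h7 : (1 + |y 1| + (H + 1 / (2 * a))) * l = l + |y 1| * l + (l * H + 1 / (2 * a) * l) := by
    ring
  linarith

/-- The flux sⁿk(s) must tend to 0 at the origin: otherwise it stays at least c > 0 in modulus, so
sⁿk² ≥ c²s⁻ⁿ ≥ c²/s for n ≥ 1, which is not integrable at 0. -/
theorem abs_flux_le (hn : 1 ≤ n) {K σ : ℝ}
    (hK : ∀ s r, 0 < s → s ≤ r → r ≤ 1 → |r ^ n * k r - s ^ n * k s| ≤ K * r ^ σ)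
    {r : ℝ} (hr : 0 < r) (hr1 : r ≤ 1) : |r ^ n * k r| ≤ K * r ^ σ := by
  by_contra hcon
  rw [not_le] at hcon
  set c := |r ^ n * k r| - K * r ^ σ
  have hc : 0 < c := by simp only [c]; linarith
  have hlow : ∀ s, 0 < s → s ≤ r → c ^ 2 * s ^ (-1 : ℝ) ≤ s ^ n * k s ^ 2 := by
    intro s hs0 hsr
    have h1 := hK s r hs0 hsr hr1
    have h2 := abs_sub_abs_le_abs_sub (r ^ n * k r) (s ^ n * k s)
    have h3 : c ≤ |s ^ n * k s| := by simp only [c]; linarith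
    have h4 : c ^ 2 ≤ (s ^ n * k s) ^ 2 := by
      rw [← sq_abs (s ^ n * k s)]; gcongr
    have h5 : s ^ n ≤ s := by
      calc s ^ n ≤ s ^ 1 := pow_le_pow_of_le_one hs0.le (hsr.trans hr1) hn
        _ = s := pow_one s
    rw [Real.rpow_neg_one, ← div_eq_mul_inv, div_le_iff₀ hs0]
    calc c ^ 2 ≤ (s ^ n * k s) ^ 2 := h4
      _ = s ^ n * k s ^ 2 * s ^ n := by ring
      _ ≤ _ := by gcongr
  have hint : IntegrableOn (fun s : ℝ => c ^ 2 * s ^ (-1 : ℝ)) (Set.Ioo 0 r) := by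
    refine Integrable.mono' (hs.sq_deriv.mono_set Set.Ioo_subset_Ioi_self) ?_ ?_
    · exact (Measurable.const_mul (by fun_prop) _).aestronglyMeasurable
    · filter_upwards [ae_restrict_mem measurableSet_Ioo] with s hs'
      rw [Real.norm_of_nonneg]
      · exact hlow s hs'.1 hs'.2.le
      · have := Real.rpow_pos_of_pos hs'.1 (-1)
        positivity
  have h6 : IntegrableOn (fun s : ℝ => s ^ (-1 : ℝ)) (Set.Ioo 0 r) := by
    have h7 : IntegrableOn (fun s : ℝ => (c ^ 2)⁻¹ * (c ^ 2 * s ^ (-1 : ℝ))) (Set.Ioo 0 r) :=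
      hint.const_mul (c ^ 2)⁻¹
    exact h7.congr_fun (fun s _ => inv_mul_cancel_left₀ (by positivity) _) measurableSet_Ioo
  rw [intervalIntegral.integrableOn_Ioo_rpow_iff hr] at h6
  exact lt_irrefl _ h6

theorem abs_deriv_le_rpow (hn : 1 ≤ n) {A K a ε : ℝ} (hA : 0 ≤ A) (hK0 : 0 ≤ K)
    (hF : ∀ r, 0 < r → r ≤ 1 → |F (y r)| ≤ A * |y r| * r ^ (ε - 2))
    (hK : ∀ r, 0 < r → r ≤ 1 → |y r| ≤ K * r ^ (-a)) (hσ : 0 < n - 1 - a + ε) :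
    ∃ C, 0 ≤ C ∧ ∀ r, 0 < r → r ≤ 1 → |k r| ≤ C * r ^ (-a + ε - 1) := by
  set σ := n - 1 - a + ε
  refine ⟨A * K / σ, by positivity, fun r hr hr1 => ?_⟩
  have hflux : ∀ s r, 0 < s → s ≤ r → r ≤ 1 → |r ^ n * k r - s ^ n * k s| ≤ A * K / σ * r ^ σ := by
    intro s r hs0 hsr hr1
    have hpos : ∀ t ∈ Set.Icc s r, 0 < t := fun t ht => lt_of_lt_of_le hs0 ht.1
    have h1 := abs_sub_le_of_abs_deriv_le hsr (fun t ht => hs.deriv_flux t (hpos t ht))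
      (fun t ht => hasDerivAt_rpow_div hσ.ne' (hpos t ht) (A * K)) fun t ht => by
        have ht0 := hpos t ht
        have ht1 : t ≤ 1 := ht.2.trans hr1
        rw [abs_mul, abs_of_pos (pow_pos ht0 n)]
        have h2 : |F (y t)| ≤ A * (K * t ^ (-a)) * t ^ (ε - 2) :=
          (hF t ht0 ht1).trans (by gcongr; exact hK t ht0 ht1)
        calc t ^ n * |F (y t)| ≤ t ^ n * (A * (K * t ^ (-a)) * t ^ (ε - 2)) := by gcongr
          _ = A * K * (t ^ (n : ℝ) * t ^ (-a) * t ^ (ε - 2)) := by rw [Real.rpow_natCast]; ring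
          _ = A * K * t ^ (σ - 1) := by
              rw [← Real.rpow_add ht0, ← Real.rpow_add ht0]
              congr 2
              simp only [σ]; ring
    have h3 : 0 ≤ A * K / σ * s ^ σ := by positivity
    linarith
  have h1 := hs.abs_flux_le hn hflux hr hr1
  rw [abs_mul, abs_of_pos (pow_pos hr n)] at h1
  have h2 : r ^ σ = r ^ n * r ^ (-a + ε - 1) := by
    rw [← Real.rpow_natCast, ← Real.rpow_add hr]
    congr 1
    simp only [σ]; ring
  rw [h2, ← mul_assoc, mul_right_comm, mul_comm] at h1
  have h3 := pow_pos hr n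
  refine le_of_mul_le_mul_right ?_ h3
  linarith

theorem abs_le_of_abs_deriv_le {C b : ℝ} (hb : b ≠ 0)
    (hk : ∀ r, 0 < r → r ≤ 1 → |k r| ≤ C * r ^ (b - 1)) {r : ℝ} (hr : 0 < r) (hr1 : r ≤ 1) :
    |y r| ≤ |y 1| + (C / b - C / b * r ^ b) := by
  have hpos : ∀ t ∈ Set.Icc r 1, 0 < t := fun t ht => lt_of_lt_of_le hr ht.1
  have h1 := abs_sub_le_of_abs_deriv_le hr1 (fun t ht => hs.deriv_fst t (hpos t ht))
    (fun t ht => hasDerivAt_rpow_div hb (hpos t ht) C) fun t ht => hk t (hpos t ht) ht.2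
  have h5 := abs_sub_abs_le_abs_sub (y r) (y 1)
  rw [abs_sub_comm] at h5
  rw [Real.one_rpow, mul_one] at h1
  linarith

/-- Bootstrap: integrating the equation twice improves |y| ≲ r^{-a} to r^{-(a-ε)}. The exponent is
truncated at ε/2 so that no step produces a logarithm; from ε/2 one further integration reaches a
positive power and hence a bound. -/
theorem bounded_near_zero (hn : 1 ≤ n) {A K a₀ ε : ℝ} (hA : 0 ≤ A) (hK0 : 0 ≤ K) (hε : 0 < ε)
    (hF : ∀ r, 0 < r → r ≤ 1 → |F (y r)| ≤ A * |y r| * r ^ (ε - 2))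
    (hK : ∀ r, 0 < r → r ≤ 1 → |y r| ≤ K * r ^ (-a₀)) (hσ : 0 < n - 1 - a₀ + ε) :
    ∃ B, ∀ r, 0 < r → r ≤ 1 → |y r| ≤ B := by
  have hn' : (1 : ℝ) ≤ n := by exact_mod_cast hn
  have hσ' : ∀ a, a ≤ max a₀ (ε / 2) → 0 < n - 1 - a + ε := by
    intro a ha
    rcases le_max_iff.1 ha with h | h <;> linarith
  have step : ∀ j : ℕ, ∃ K, 0 ≤ K ∧
      ∀ r, 0 < r → r ≤ 1 → |y r| ≤ K * r ^ (-max (a₀ - j * ε) (ε / 2)) := by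
    intro j
    induction j with
    | zero =>
      refine ⟨K, hK0, fun r hr hr1 => (hK r hr hr1).trans ?_⟩
      gcongr ?_ * ?_
      refine Real.rpow_le_rpow_of_exponent_ge hr hr1 ?_
      have := le_max_left (a₀ - (0 : ℕ) * ε) (ε / 2)
      simp only [Nat.cast_zero, zero_mul, sub_zero] at this ⊢
      linarith
    | succ j ih =>
      obtain ⟨K, hK0, hK⟩ := ih
      set a := max (a₀ - j * ε) (ε / 2)
      set b := max (a₀ - (j + 1 : ℕ) * ε) (ε / 2) with hb
      have hja : 0 ≤ (j : ℝ) * ε := by positivity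
      have haa : a ≤ max a₀ (ε / 2) := max_le_max_right _ (by linarith)
      have hb0 : 0 < b := lt_of_lt_of_le (by positivity) (le_max_right _ _)
      have hab : a - ε ≤ b := by
        rw [sub_le_iff_le_add]
        refine max_le ?_ ?_
        · have := le_max_left (a₀ - (j + 1 : ℕ) * ε) (ε / 2)
          push_cast at this
          rw [hb]
          push_cast
          linarith
        · linarith
      obtain ⟨C, hC, hk⟩ := hs.abs_deriv_le_rpow hn hA hK0 hF hK (hσ' a haa)
      have hk' : ∀ r, 0 < r → r ≤ 1 → |k r| ≤ C * r ^ (-b - 1) := fun r hr hr1 =>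
        (hk r hr hr1).trans (by
          gcongr ?_ * ?_
          exact Real.rpow_le_rpow_of_exponent_ge hr hr1 (by linarith))
      refine ⟨|y 1| + C / b, by positivity, fun r hr hr1 => ?_⟩
      have h1 := hs.abs_le_of_abs_deriv_le (b := -b) (by linarith) hk' hr hr1
      have hl1 : 1 ≤ r ^ (-b) := Real.one_le_rpow_of_pos_of_le_one_of_nonpos hr hr1 (by linarith)
      have h2 : |y 1| ≤ |y 1| * r ^ (-b) := le_mul_of_one_le_right (abs_nonneg _) hl1
      have h3 : 0 ≤ C / b := by positivity
      rw [div_neg] at h1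
      linarith
  obtain ⟨j, hj⟩ := exists_nat_gt (a₀ / ε)
  rw [div_lt_iff₀ hε] at hj
  obtain ⟨K, hK0, hK⟩ := step j
  rw [max_eq_right (by linarith)] at hK
  obtain ⟨C, hC, hk⟩ := hs.abs_deriv_le_rpow hn hA hK0 hF hK (by linarith)
  refine ⟨|y 1| + C / (-(ε / 2) + ε), fun r hr hr1 => ?_⟩
  have h1 := hs.abs_le_of_abs_deriv_le (by linarith) hk hr hr1
  have h2 : 0 ≤ C / (-(ε / 2) + ε) * r ^ (-(ε / 2) + ε) := by
    have : 0 < -(ε / 2) + ε := by linarith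
    positivity
  linarith

theorem integrableOn_sq_Ioi : IntegrableOn (fun r => y r ^ 2) (Set.Ioi 1) := by
  refine Integrable.mono' (hs.sq_fst.mono_set (Set.Ioi_subset_Ioi zero_le_one)) ?_ ?_
  · exact ((hs.continuousOn_fst.mono (Set.Ioi_subset_Ioi zero_le_one)).pow 2).aestronglyMeasurable
      measurableSet_Ioi
  · filter_upwards [ae_restrict_mem measurableSet_Ioi] with r hr
    rw [Real.norm_of_nonneg (sq_nonneg _)]
    exact le_mul_of_one_le_left (sq_nonneg _) (one_le_pow₀ (le_of_lt hr))

theorem integrableOn_flux_mul : IntegrableOn (fun r => 2 * y r * (r ^ n * k r)) (Set.Ioi 1) := by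
  refine Integrable.mono' ((hs.sq_fst.add hs.sq_deriv).mono_set (Set.Ioi_subset_Ioi zero_le_one))
    ?_ ?_
  · refine ContinuousOn.aestronglyMeasurable ?_ measurableSet_Ioi
    refine ContinuousOn.mono ?_ (Set.Ioi_subset_Ioi zero_le_one)
    exact (continuousOn_const.mul hs.continuousOn_fst).mul
      ((continuous_pow n).continuousOn.mul hs.continuousOn_deriv)
  · filter_upwards [ae_restrict_mem measurableSet_Ioi] with r hr
    have hr0 : (0 : ℝ) < r := lt_trans one_pos hr
    have h1 : 0 < r ^ n := by positivity
    simp only [Pi.add_apply]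
    rw [Real.norm_eq_abs, abs_le]
    constructor
    · nlinarith [mul_nonneg h1.le (sq_nonneg (y r + k r))]
    · nlinarith [mul_nonneg h1.le (sq_nonneg (y r - k r))]

theorem hasDerivAt_sq {r : ℝ} (hr : 0 < r) : HasDerivAt (fun r => y r ^ 2) (2 * y r * k r) r := by
  simpa using (hs.deriv_fst r hr).fun_pow 2

/-- Both y² and its derivative 2yk are integrable on (1,∞), because the weight rⁿ is at least 1
there. -/
theorem tendsto_sq_atTop : Tendsto (fun r => y r ^ 2) atTop (𝓝 0) := by
  refine tendsto_zero_of_hasDerivAt_of_integrableOn_Ioi (a := 1)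
    (fun r hr => hs.hasDerivAt_sq (lt_trans one_pos hr)) ?_ hs.integrableOn_sq_Ioi
  refine Integrable.mono' hs.integrableOn_flux_mul.norm ?_ ?_
  · refine ContinuousOn.aestronglyMeasurable ?_ measurableSet_Ioi
    refine ContinuousOn.mono ?_ (Set.Ioi_subset_Ioi zero_le_one)
    exact (continuousOn_const.mul hs.continuousOn_fst).mul hs.continuousOn_deriv
  · filter_upwards [ae_restrict_mem measurableSet_Ioi] with r hr
    have h1 : 1 ≤ r ^ n := one_le_pow₀ (le_of_lt hr)
    rw [mul_left_comm, norm_mul (r ^ n), Real.norm_of_nonneg (zero_le_one.trans h1)]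
    exact le_mul_of_one_le_left (norm_nonneg _) h1

theorem tendsto_atTop : Tendsto y atTop (𝓝 0) := by
  have h := (Real.continuous_sqrt.tendsto 0).comp hs.tendsto_sq_atTop
  rw [Real.sqrt_zero] at h
  refine (tendsto_zero_iff_abs_tendsto_zero _).2 (h.congr fun r => ?_)
  simp [Real.sqrt_sq_eq_abs]

/-- Exponential decay. -/
theorem exists_sq_le_exp (hF : ∀ᶠ z in 𝓝 0, z ^ 2 / 2 ≤ z * F z) :
    ∃ C R, 0 ≤ C ∧ ∀ r, R ≤ r → y r ^ 2 ≤ C * Real.exp (-r) := by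
  obtain ⟨R₀, hR₀⟩ := eventually_atTop.1 (hs.tendsto_atTop.eventually hF)
  set R := max R₀ 1
  have hR1 : 1 ≤ R := le_max_right _ _
  have hpos : ∀ r ∈ Set.Ici R, 0 < r := fun r hr => lt_of_lt_of_le (by linarith) hr
  -- P = rⁿ(y²)'. The equation gives P' ≥ |P|, so P eʳ increases and P ≥ -Ce^{-r}. As rⁿ ≥ 1, y² -
  -- Ce^{-r} is then increasing; it tends to 0, so it is nonpositive.
  set P : ℝ → ℝ := fun r => 2 * y r * (r ^ n * k r)
  set P' : ℝ → ℝ := fun r => 2 * k r * (r ^ n * k r) + 2 * y r * (r ^ n * F (y r))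
  have hP : ∀ r ∈ Set.Ici R, HasDerivAt P (P' r) r := fun r hr =>
    ((hs.deriv_fst r (hpos r hr)).const_mul 2).mul (hs.deriv_flux r (hpos r hr))
  have hPP : ∀ r ∈ Set.Ici R, |P r| ≤ P' r := by
    intro r hr
    have h1 : 0 < r ^ n := pow_pos (hpos r hr) n
    have h2 := hR₀ r ((le_max_left _ _).trans hr)
    have h3 : r ^ n * (2 * k r ^ 2 + y r ^ 2) ≤ P' r := by
      simp only [P']
      nlinarith [mul_le_mul_of_nonneg_left h2 h1.le]
    refine le_trans ?_ h3
    simp only [P]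
    rw [abs_le]
    constructor
    · nlinarith [mul_nonneg h1.le (sq_nonneg (y r + k r)), mul_nonneg h1.le (sq_nonneg (k r))]
    · nlinarith [mul_nonneg h1.le (sq_nonneg (y r - k r)), mul_nonneg h1.le (sq_nonneg (k r))]
  have hmono1 : MonotoneOn (fun r => P r * Real.exp (-r)) (Set.Ici R) :=
    monotoneOn_of_hasDerivAt_nonneg (convex_Ici R)
      (fun r hr => (hP r hr).mul ((hasDerivAt_neg r).exp)) fun r hr => by
        have h1 := hPP r hr
        have h2 := le_abs_self (P r)
        have h3 := Real.exp_pos (-r)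
        nlinarith
  have hmono2 : MonotoneOn (fun r => P r * Real.exp r) (Set.Ici R) :=
    monotoneOn_of_hasDerivAt_nonneg (convex_Ici R)
      (fun r hr => (hP r hr).mul (Real.hasDerivAt_exp r)) fun r hr => by
        have h1 := hPP r hr
        have h2 := neg_abs_le (P r)
        have h3 := Real.exp_pos r
        nlinarith
  set C := |P R| * Real.exp R
  have hC : 0 ≤ C := by positivity
  have hlow : ∀ r ∈ Set.Ici R, -(C * Real.exp (-r)) ≤ P r := by
    intro r hr
    have h1 : P R * Real.exp R ≤ P r * Real.exp r := hmono2 Set.self_mem_Ici hr hr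
    have h2 : -C ≤ P R * Real.exp R := by
      have := neg_abs_le (P R)
      have := Real.exp_pos R
      simp only [C]; nlinarith
    have h3 : -C ≤ P r * Real.exp r := h2.trans h1
    calc -(C * Real.exp (-r)) = -C * Real.exp (-r) := by ring
      _ ≤ P r * Real.exp r * Real.exp (-r) := by gcongr
      _ = P r := by rw [mul_assoc, ← Real.exp_add]; simp
  have hmono3 : MonotoneOn (fun r => y r ^ 2 - C * Real.exp (-r)) (Set.Ici R) := by
    refine monotoneOn_of_hasDerivAt_nonneg (convex_Ici R)
      (fun r hr => (hs.hasDerivAt_sq (hpos r hr)).sub (((hasDerivAt_neg r).exp).const_mul C))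
      fun r hr => ?_
    have h1 := hlow r hr
    have h2 : 1 ≤ r ^ n := one_le_pow₀ (hR1.trans hr)
    have h3 : P r = r ^ n * (2 * y r * k r) := by simp only [P]; ring
    have h4 : 0 ≤ C * Real.exp (-r) := by positivity
    rw [h3] at h1
    by_contra hcon
    rw [not_le] at hcon
    have h5 : 2 * y r * k r < -(C * Real.exp (-r)) := by linarith
    nlinarith
  have hlim : Tendsto (fun r => y r ^ 2 - C * Real.exp (-r)) atTop (𝓝 0) := by
    have h1 : Tendsto (fun r => C * Real.exp (-r)) atTop (𝓝 (C * 0)) :=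
      (Real.tendsto_exp_atBot.comp tendsto_neg_atTop_atBot).const_mul C
    simpa using hs.tendsto_sq_atTop.sub h1
  refine ⟨C, R, hC, fun r hr => ?_⟩
  have h1 : y r ^ 2 - C * Real.exp (-r) ≤ 0 := by
    refine ge_of_tendsto hlim ?_
    filter_upwards [eventually_ge_atTop r] with s hs'
    exact hmono3 hr (hr.trans hs') hs'
  linarith

end IsRadialSolution

namespace KleinGordon

variable {d : ℕ}

/-! ### The equilibrium and the potential it generates -/

section Equilibrium

theorem integrable_mul_of_schwartz (ψ : 𝓢(Space d, ℂ)) (u : L2 d) :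
    Integrable fun x => ψ x * u x :=
  (ψ.memLp 2).integrable_mul (Lp.memLp u)

theorem integrable_radial_smul [NeZero d] {F : Type*} [NormedAddCommGroup F] [NormedSpace ℝ F]
    {χ : ℝ → ℝ} (hχ : IsHalfLineTest χ) {k : ℝ → F} (hk : LocIntPos k) :
    Integrable fun x : Space d => χ ‖x‖ • k ‖x‖ := by
  refine (integrable_norm_iff (d := d) (f := fun r => χ r • k r)).2 ?_
  simp only [← mul_smul]
  exact ((hχ.pow_mul (d - 1)).integrable_smul hk).integrableOn

theorem laplacian_radTest_apply {χ : ℝ → ℝ} (hχ : IsHalfLineTest χ) (x : Space d) :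
    Δ (radTest hχ d) x = ((Δ fun x : Space d => χ ‖x‖) x : ℂ) := by
  rw [SchwartzMap.laplacian_apply]
  have h2 : ContDiff ℝ 2 fun x : Space d => χ ‖x‖ :=
    (contDiff_radial_test hχ).of_le (WithTop.coe_le_coe.2 le_top)
  exact h2.contDiffAt.laplacian_CLM_comp_left
    (l := Complex.ofRealCLM)

/-- Only radial tests supported away from the origin are used, so no integrability of f(φ) near 0 is
required. -/
theorem equilibrium_pairing [NeZero d] {f : ℝ → ℝ} {φ : Space d → ℝ}
    (hφ : IsRadialEquilibrium f φ) {u : L2 d} (hu : u =ᵐ[volume] fun x => (φ x : ℂ))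
    {y : ℝ → ℝ} (hy : φ =ᵐ[volume] fun x => y ‖x‖) (hfy : LocIntPos fun r => f (y r))
    {χ : ℝ → ℝ} (hχ : IsHalfLineTest χ) :
    (Δ (toDist u)) (radTest hχ d) = ∫ x : Space d, (χ ‖x‖ : ℂ) * ((y ‖x‖ - f (y ‖x‖) : ℝ) : ℂ) := by
  set ψ : Space d → ℝ := fun x => χ ‖x‖
  have heq := hφ.equation ψ (contDiff_radial_test hχ) (hasCompactSupport_radial_test hχ)
  have i1 : Integrable fun x => φ x * (Δ ψ) x := by
    have h1 := (integrable_mul_of_schwartz (Δ (radTest hχ d)) u).re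
    refine h1.congr ?_
    filter_upwards [hu] with x hx
    rw [hx, laplacian_radTest_apply, ← Complex.ofReal_mul]
    exact mul_comm _ _
  have i2 : Integrable fun x => φ x * ψ x := by
    have h1 := (integrable_mul_of_schwartz (radTest hχ d) u).re
    refine h1.congr ?_
    filter_upwards [hu] with x hx
    rw [hx, radTest_apply, ← Complex.ofReal_mul]
    exact mul_comm _ _
  have i3 : Integrable fun x => f (φ x) * ψ x := by
    refine (integrable_radial_smul (d := d) hχ hfy).congr ?_
    filter_upwards [hy] with x hx
    rw [hx, smul_eq_mul, mul_comm]
  have h1 : ∫ x, φ x * (-(Δ ψ) x + ψ x) = -(∫ x, φ x * (Δ ψ) x) + ∫ x, φ x * ψ x := by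
    simp only [mul_add, mul_neg]
    have i1' : Integrable fun x => -(φ x * (Δ ψ) x) := i1.neg
    rw [integral_add i1' i2, integral_neg]
  have h2 : ∫ x, φ x * (Δ ψ) x = ∫ x, (φ x * ψ x - f (φ x) * ψ x) := by
    rw [integral_sub i2 i3]
    linarith
  have h3 : (Δ (toDist u)) (radTest hχ d) = ((∫ x, φ x * (Δ ψ) x : ℝ) : ℂ) := by
    rw [TemperedDistribution.laplacian_apply_apply, toDist_apply, ← integral_complex_ofReal]
    refine integral_congr_ae ?_
    filter_upwards [hu] with x hx
    rw [hx, laplacian_radTest_apply, Complex.ofReal_mul, mul_comm]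
  rw [h3, h2, ← integral_complex_ofReal]
  refine integral_congr_ae ?_
  filter_upwards [hy] with x hx
  rw [← hx]
  push_cast
  ring

theorem exists_radialSolution [NeZero d] {f : ℝ → ℝ} (hf : Continuous f) {φ : Space d → ℝ}
    (hφ : IsRadialEquilibrium f φ) :
    ∃ y k, IsRadialSolution (d - 1) (fun z => z - f z) y k ∧ (φ =ᵐ[volume] fun x => y ‖x‖) ∧
      ∃ K, ∀ r, 0 < r → r ≤ 1 → r ^ (d - 1) * y r ^ 2 ≤ K := by
  obtain ⟨p, hpφ⟩ := hφ.mem_H1rad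
  have hpφ' : (p.1.fst : Space d → ℂ) =ᵐ[volume] fun x => (φ x : ℂ) := hpφ
  obtain ⟨g, h, hp⟩ := exists_profile p
  set y : ℝ → ℝ := fun r => (g r).re
  have hyc : ContinuousOn y (Set.Ioi 0) := Complex.continuous_re.comp_continuousOn hp.continuousOn
  have hy : φ =ᵐ[volume] fun x => y ‖x‖ := by
    filter_upwards [hpφ', hp.eq_fst] with x h1 h2
    rw [h1] at h2
    simp only [y, ← h2, Complex.ofReal_re]
  have hWc : ContinuousOn (fun r => ((y r - f (y r) : ℝ) : ℂ)) (Set.Ioi 0) :=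
    Complex.continuous_ofReal.comp_continuousOn (hyc.sub (hf.comp_continuousOn hyc))
  obtain ⟨k, hpk, hk1, hk2⟩ := hp.exists_classical hWc fun χ hχ =>
    equilibrium_pairing hφ hpφ' hy (LocIntPos.of_continuousOn (hf.comp_continuousOn hyc)) hχ
  have hre : ∀ z : ℂ, z.re ^ 2 ≤ ‖z‖ ^ 2 := fun z => by
    rw [← sq_abs z.re]
    gcongr
    exact Complex.abs_re_le_norm z
  have hdom : ∀ {q : ℝ → ℂ}, LocIntPos q →
      IntegrableOn (fun r : ℝ => r ^ (d - 1) * ‖q r‖ ^ 2) (Set.Ioi 0) →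
      IntegrableOn (fun r : ℝ => r ^ (d - 1) * (q r).re ^ 2) (Set.Ioi 0) := by
    intro q hq hi
    refine Integrable.mono' hi ?_ ?_
    · have h1 := hq.locallyIntegrableOn.aestronglyMeasurable
      have h2 : AEStronglyMeasurable (fun r => (q r).re) (volume.restrict (Set.Ioi 0)) :=
        Complex.continuous_re.comp_aestronglyMeasurable h1
      exact (continuous_pow _).aestronglyMeasurable.mul (h2.pow 2)
    · filter_upwards [ae_restrict_mem measurableSet_Ioi] with r hr
      have hr' : 0 < r ^ (d - 1) := pow_pos hr _
      rw [Real.norm_of_nonneg (by positivity)]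
      gcongr r ^ (d - 1) * ?_
      exact hre _
  refine ⟨y, fun r => (k r).re, ⟨fun r hr => ?_, fun r hr => ?_, ?_, ?_⟩, hy, ?_⟩
  · exact Complex.reCLM.hasFDerivAt.comp_hasDerivAt r (hk1 r hr)
  · have h1 := Complex.reCLM.hasFDerivAt.comp_hasDerivAt r (hk2 r hr)
    simpa only [Function.comp_def, Complex.reCLM_apply, Complex.smul_re, smul_eq_mul,
      Complex.ofReal_re] using h1
  · exact hdom (LocIntPos.of_continuousOn hp.continuousOn) hp.integrableOn_fst
  · exact hdom hpk.locIntPos hpk.integrableOn_deriv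
  · refine ⟨2 * radSq d g + 4 * radSq d h, fun r hr hr1 => ?_⟩
    refine le_trans ?_ (hp.pow_mul_norm_sq_le hr hr1)
    gcongr r ^ (d - 1) * ?_
    exact hre _

theorem abs_le_of_abs_deriv_le_max {f : ℝ → ℝ} (hf : Differentiable ℝ f) (h0 : f 0 = 0)
    {C β γ : ℝ} (hβ : 0 < β) (hγ : 0 < γ) (hC : 0 ≤ C)
    (h : ∀ z, |deriv f z| ≤ C * max (|z| ^ β) (|z| ^ γ)) (z : ℝ) :
    |f z| ≤ C * max (|z| ^ β) (|z| ^ γ) * |z| := by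
  have h1 := (convex_Icc (-|z|) |z|).norm_image_sub_le_of_norm_deriv_le (f := f)
    (C := C * max (|z| ^ β) (|z| ^ γ)) (x := 0) (y := z) (fun t _ => hf t) (fun t ht => by
      have ht' : |t| ≤ |z| := abs_le.2 ht
      refine (h t).trans ?_
      gcongr) ⟨by simp, by simp⟩ ⟨neg_abs_le z, le_abs_self z⟩
  simpa [h0] using h1

/-- Boundedness of the profile near 0 bounds v there; decay of the profile and f'(0) = 0 give v → 0;
exponential decay and |f'(y)| ≤ C|y|^β for |y| ≤ 1 give integrability at infinity. -/
theorem GrowthCondition.exists_potential [NeZero d] {f : ℝ → ℝ} (hf : ContDiff ℝ 1 f)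
    (hodd : ∀ y, f (-y) = -f y) (hf0 : deriv f 0 = 0) (hgr : GrowthCondition d f)
    {φ : Space d → ℝ} (hφ : IsRadialEquilibrium f φ) :
    ∃ v : ℝ → ℝ, ((fun x => deriv f (φ x)) =ᵐ[volume] fun x => v ‖x‖) ∧
      ContinuousOn v (Set.Ioi 0) ∧ (∃ M, ∀ r, 0 < r → |v r| ≤ M) ∧
      Tendsto v atTop (𝓝 0) ∧ IntegrableOn v (Set.Ioi 1) := by
  obtain ⟨C, θ, β, hθ, hθd, hβ, hβθ, hC, -⟩ := hgr
  have hdiff : Differentiable ℝ f := hf.differentiable (by simp)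
  have hf'c : Continuous (deriv f) := hf.continuous_deriv le_rfl
  have hfz : f 0 = 0 := by
    have := hodd 0
    rw [neg_zero] at this
    linarith
  have hC0 : 0 ≤ C := by
    have := (abs_nonneg _).trans (hC 1)
    simpa using this
  have hγ : 0 < θ - 1 := by linarith
  have hfle := abs_le_of_abs_deriv_le_max hdiff hfz hβ hγ hC0 hC
  obtain ⟨y, k, hs, hy, K₁, hK₁⟩ := exists_radialSolution hf.continuous hφ
  have hbd : ∃ B, ∀ r, 0 < r → r ≤ 1 → |y r| ≤ B := by
    have hd0 : d ≠ 0 := NeZero.ne d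
    rcases (show d = 1 ∨ 2 ≤ d by omega) with hd1 | hd2
    · refine ⟨Real.sqrt K₁, fun r hr hr1 => ?_⟩
      have h1 := hK₁ r hr hr1
      rw [hd1] at h1
      simp only [tsub_self, pow_zero, one_mul] at h1
      exact Real.abs_le_sqrt h1
    have hcast : ((d - 1 : ℕ) : ℝ) = d - 1 := by
      rw [Nat.cast_sub (by omega), Nat.cast_one]
    -- With |y| ≲ r^{-a} the nonlinearity is at most |y| r^{-a(θ-1)}, so ε = 2 - a(θ-1) is the
    -- bootstrap gain. For d ≥ 3 take a = (d-2)/2; then ε > 0 is exactly θ < (d+2)/(d-2). For d = 2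
    -- the choice a = 1/θ works for every θ.
    obtain ⟨a, ha, had, hε, hσ⟩ : ∃ a : ℝ, 0 < a ∧ (d : ℝ) - 2 ≤ 2 * a ∧ 0 < 2 - a * (θ - 1) ∧
        0 < (d : ℝ) - 2 - a + (2 - a * (θ - 1)) := by
      rcases (show d = 2 ∨ 3 ≤ d by omega) with h2 | h3
      · have hθ0 : 0 < θ := by linarith
        have e1 : 1 / θ * (θ - 1) = 1 - 1 / θ := by field_simp
        have e2 : 0 < 1 / θ := by positivity
        refine ⟨1 / θ, e2, ?_, ?_, ?_⟩
        · rw [h2]; push_cast; linarith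
        · rw [e1]; linarith
        · rw [e1, h2]; push_cast; linarith
      · have h3' : (3 : ℝ) ≤ d := by exact_mod_cast h3
        have h4 := hθd h3
        rw [lt_div_iff₀ (by linarith)] at h4
        refine ⟨((d : ℝ) - 2) / 2, by linarith, by linarith, by linarith, by linarith⟩
    obtain ⟨K, hK1, hK⟩ := hs.abs_le_rpow ha (by rw [hcast]; linarith)
    refine hs.bounded_near_zero (A := (1 + C) * K ^ (θ - 1)) (K := K) (a₀ := a)
      (ε := 2 - a * (θ - 1)) (by omega) (by positivity) (by linarith) hε ?_ hK
      (by rw [hcast]; linarith)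
    intro r hr hr1
    have hra : 1 ≤ r ^ (-a) := Real.one_le_rpow_of_pos_of_le_one_of_nonpos hr hr1 (by linarith)
    set Y := K * r ^ (-a) with hY
    -- A majorant at least 1 lets the larger power θ - 1 dominate both the power β and the linear
    -- term.
    have hY1 : 1 ≤ Y := one_le_mul_of_one_le_of_one_le hK1 hra
    have hyY := hK r hr hr1
    have hYg : Y ^ (θ - 1) = K ^ (θ - 1) * r ^ (2 - a * (θ - 1) - 2) := by
      rw [hY, Real.mul_rpow (by linarith) (by linarith), ← Real.rpow_mul hr.le]
      congr 2
      ring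
    have hmax : max (|y r| ^ β) (|y r| ^ (θ - 1)) ≤ Y ^ (θ - 1) := by
      refine max_le ?_ ?_
      · calc |y r| ^ β ≤ Y ^ β := by gcongr
          _ ≤ Y ^ (θ - 1) := Real.rpow_le_rpow_of_exponent_le hY1 hβθ.le
      · gcongr
    have hYg1 : 1 ≤ Y ^ (θ - 1) := Real.one_le_rpow hY1 hγ.le
    calc |y r - f (y r)| ≤ |y r| + |f (y r)| := abs_sub _ _
      _ ≤ Y ^ (θ - 1) * |y r| + C * Y ^ (θ - 1) * |y r| := by
          gcongr
          · exact le_mul_of_one_le_left (abs_nonneg _) hYg1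
          · refine (hfle (y r)).trans ?_
            gcongr
      _ = (1 + C) * K ^ (θ - 1) * |y r| * r ^ (2 - a * (θ - 1) - 2) := by rw [hYg]; ring
  have hlim := hs.tendsto_atTop
  have hvc : ContinuousOn (fun r => deriv f (y r)) (Set.Ioi 0) :=
    hf'c.comp_continuousOn hs.continuousOn_fst
  have hv0 : Tendsto (fun r => deriv f (y r)) atTop (𝓝 0) := by
    have := (hf'c.tendsto 0).comp hlim
    rwa [hf0] at this
  refine ⟨fun r => deriv f (y r), ?_, hvc, ?_, hv0, ?_⟩
  · filter_upwards [hy] with x hx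
    rw [hx]
  · obtain ⟨B, hB⟩ := hbd
    obtain ⟨R, hR⟩ := eventually_atTop.1
      ((tendsto_zero_iff_abs_tendsto_zero _).1 hv0 |>.eventually_le_const one_pos)
    obtain ⟨M₁, hM₁⟩ := (isCompact_Icc (a := -B) (b := B)).exists_bound_of_continuousOn
      hf'c.continuousOn
    obtain ⟨M₂, hM₂⟩ := (isCompact_Icc (a := 1) (b := R)).exists_bound_of_continuousOn
      (hvc.mono fun r hr => lt_of_lt_of_le one_pos hr.1)
    refine ⟨max 1 (max M₁ M₂), fun r hr => ?_⟩
    rcases le_total r 1 with h1 | h1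
    · exact (hM₁ _ (abs_le.1 (hB r hr h1))).trans ((le_max_left _ _).trans (le_max_right _ _))
    rcases le_total r R with h2 | h2
    · exact (hM₂ r ⟨h1, h2⟩).trans ((le_max_right _ _).trans (le_max_right _ _))
    · exact (hR r h2).trans (le_max_left _ _)
  · have hsmall : ∀ᶠ z in 𝓝 (0 : ℝ), z ^ 2 / 2 ≤ z * (z - f z) := by
      have h1 : HasDerivAt f 0 0 := by simpa only [hf0] using (hdiff 0).hasDerivAt
      have h2 := (hasDerivAt_iff_isLittleO.1 h1).def (show (0 : ℝ) < 1 / 2 by norm_num)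
      filter_upwards [h2] with z hz
      simp only [hfz, sub_zero, smul_zero, Real.norm_eq_abs] at hz
      have h3 : z * f z ≤ |z| * |f z| := (le_abs_self _).trans (abs_mul _ _).le
      have h4 : |z| * |f z| ≤ |z| * (1 / 2 * |z|) := by gcongr
      have h5 : |z| * |z| = z ^ 2 := by rw [← sq, sq_abs]
      nlinarith
    obtain ⟨D, R, hD, hR⟩ := hs.exists_sq_le_exp hsmall
    refine integrable_of_isBigO_exp_neg (b := β / 2) (by positivity)
      (hvc.mono fun r (hr : 1 ≤ r) => lt_of_lt_of_le one_pos hr) ?_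
    refine Asymptotics.IsBigO.of_bound (C * D ^ (β / 2)) ?_
    filter_upwards [eventually_ge_atTop R,
      ((tendsto_zero_iff_abs_tendsto_zero _).1 hlim).eventually_le_const one_pos] with r hrR hr1
    have hr1' : |y r| ≤ 1 := hr1
    have h1 : max (|y r| ^ β) (|y r| ^ (θ - 1)) ≤ |y r| ^ β := by
      refine max_le le_rfl ?_
      exact Real.rpow_le_rpow_of_exponent_ge_of_imp (abs_nonneg _) hr1' hβθ.le
        fun _ h => absurd h hγ.ne'
    have h2 : |y r| ^ β ≤ D ^ (β / 2) * Real.exp (-(β / 2) * r) := by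
      have e1 : |y r| ^ β = (y r ^ 2) ^ (β / 2) := by
        rw [← sq_abs, ← Real.rpow_natCast, ← Real.rpow_mul (abs_nonneg _)]
        congr 1
        push_cast
        ring
      have e2 : D ^ (β / 2) * Real.exp (-(β / 2) * r) = (D * Real.exp (-r)) ^ (β / 2) := by
        rw [Real.mul_rpow hD (Real.exp_pos _).le, ← Real.exp_mul]
        congr 2
        ring
      rw [e1, e2]
      gcongr
      exact hR r hrR
    rw [Real.norm_of_nonneg (Real.exp_pos _).le]
    calc ‖deriv f (y r)‖ ≤ C * max (|y r| ^ β) (|y r| ^ (θ - 1)) := hC _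
      _ ≤ C * (D ^ (β / 2) * Real.exp (-(β / 2) * r)) := by gcongr; exact h1.trans h2
      _ = _ := by ring

end Equilibrium

end KleinGordon

/-! ### Linear radial equation: uniqueness, Wronskian, embedded eigenvalues -/

/-- `g` solves the radial linear equation `g'' + (n/r) g' = q(r) g` on `(0, ∞)`, `h = g'`. -/
structure IsRadialLinear {F : Type*} [NormedAddCommGroup F] [NormedSpace ℝ F] (n : ℕ) (q : ℝ → ℝ)
    (g h : ℝ → F) : Prop where
  deriv_fst : ∀ r, 0 < r → HasDerivAt g (h r) r
  deriv_flux : ∀ r, 0 < r → HasDerivAt (fun r => r ^ n • h r) (r ^ n • q r • g r) r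

namespace IsRadialLinear

section Linear

variable {F : Type*} [NormedAddCommGroup F] [NormedSpace ℝ F] {n : ℕ} {q : ℝ → ℝ} {g h : ℝ → F}

/-- ODE uniqueness for the first-order system in (g, rⁿh), whose coefficients are bounded on a
compact interval of (0,∞) around r and 1. -/
theorem eq_zero_of_initial (hs : IsRadialLinear n q g h) (hq : ContinuousOn q (Set.Ioi 0))
    (hg1 : g 1 = 0) (hh1 : h 1 = 0) {r : ℝ} (hr : 0 < r) : g r = 0 := by
  set a := min r 1 / 2
  set b := max r 1 + 1
  have ha : 0 < a := by positivity
  have har : a < r ∧ a < 1 := by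
    have h1 := min_le_left r 1
    have h2 := min_le_right r 1
    have h3 : 0 < min r 1 := by positivity
    constructor <;> simp only [a] <;> linarith
  have hbr : r < b ∧ 1 < b := by
    have h1 := le_max_left r 1
    have h2 := le_max_right r 1
    constructor <;> simp only [b] <;> linarith
  have hsub : Set.Icc a b ⊆ Set.Ioi 0 := fun t ht => lt_of_lt_of_le ha ht.1
  have hpow : ContinuousOn (fun t : ℝ => t ^ n) (Set.Icc a b) := (continuous_pow n).continuousOn
  obtain ⟨C₁, hC₁⟩ := isCompact_Icc.exists_bound_of_continuousOn
    (hpow.inv₀ fun t ht => (pow_pos (hsub ht) n).ne')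
  obtain ⟨C₂, hC₂⟩ := isCompact_Icc.exists_bound_of_continuousOn (hpow.mul (hq.mono hsub))
  set C := max (max C₁ C₂) 0
  let w : ℝ → F × F → F × F := fun t z => ((t ^ n)⁻¹ • z.2, (t ^ n * q t) • z.1)
  have hw : ∀ t ∈ Set.Ioo a b, LipschitzOnWith (Real.toNNReal C) (w t) Set.univ := by
    intro t ht
    refine (LipschitzWith.of_dist_le_mul fun z z' => ?_).lipschitzOnWith
    rw [Real.coe_toNNReal _ (le_max_right _ _), dist_eq_norm, dist_eq_norm]
    have ht' := Set.Ioo_subset_Icc_self ht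
    refine max_le ?_ ?_
    · show ‖(t ^ n)⁻¹ • z.2 - (t ^ n)⁻¹ • z'.2‖ ≤ _
      rw [← smul_sub, norm_smul]
      exact mul_le_mul ((hC₁ t ht').trans ((le_max_left _ _).trans (le_max_left _ _)))
        (norm_snd_le (z - z')) (norm_nonneg _) (le_max_right _ _)
    · show ‖(t ^ n * q t) • z.1 - (t ^ n * q t) • z'.1‖ ≤ _
      rw [← smul_sub, norm_smul]
      exact mul_le_mul ((hC₂ t ht').trans ((le_max_right _ _).trans (le_max_left _ _)))
        (norm_fst_le (z - z')) (norm_nonneg _) (le_max_right _ _)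
  have huniq := ODE_solution_unique_of_mem_Ioo (v := w) (s := fun _ => Set.univ)
    (f := fun t => (g t, t ^ n • h t)) (g := fun _ => 0) hw (t₀ := 1) ⟨har.2, hbr.2⟩
    (fun t ht => ⟨?_, Set.mem_univ _⟩) (fun t _ => ⟨?_, Set.mem_univ _⟩) (by simp [hg1, hh1])
  · exact congrArg Prod.fst (huniq ⟨har.1, hbr.1⟩)
  · have ht0 : 0 < t := ha.trans ht.1
    have h1 := (hs.deriv_fst t ht0).prodMk (hs.deriv_flux t ht0)
    have h2 : w t (g t, t ^ n • h t) = (h t, t ^ n • q t • g t) := by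
      simp only [w]
      rw [inv_smul_smul₀ (pow_pos ht0 n).ne', mul_smul]
    rw [h2]
    exact h1
  · have h2 : w t (0 : F × F) = 0 := by simp [w]
    rw [h2]
    exact hasDerivAt_const _ _

theorem sub_smul {𝕜 : Type*} [NormedField 𝕜] [NormedSpace 𝕜 F] [SMulCommClass ℝ 𝕜 F]
    {g' h' : ℝ → F} (hs : IsRadialLinear n q g h) (hs' : IsRadialLinear n q g' h') (c : 𝕜) :
    IsRadialLinear n q (fun r => g r - c • g' r) (fun r => h r - c • h' r) where
  deriv_fst r hr := (hs.deriv_fst r hr).sub ((hs'.deriv_fst r hr).const_smul c)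
  deriv_flux r hr := by
    have h1 := (hs.deriv_flux r hr).fun_sub ((hs'.deriv_flux r hr).const_smul c)
    simpa only [smul_sub, smul_comm _ c, Pi.smul_apply] using h1

theorem comp_clm {G : Type*} [NormedAddCommGroup G] [NormedSpace ℝ G] (T : F →L[ℝ] G)
    (hs : IsRadialLinear n q g h) : IsRadialLinear n q (fun r => T (g r)) (fun r => T (h r)) where
  deriv_fst r hr := T.hasFDerivAt.comp_hasDerivAt r (hs.deriv_fst r hr)
  deriv_flux r hr := by
    have h1 := T.hasFDerivAt.comp_hasDerivAt r (hs.deriv_flux r hr)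
    simpa only [Function.comp_def, map_smul] using h1

end Linear

section Wronskian

variable {n : ℕ} {q : ℝ → ℝ} {g₁ h₁ g₂ h₂ : ℝ → ℂ}

/-- The weighted Wronskian rⁿ(g₁h₂ - g₂h₁) is constant, and integrable on (0,∞) because the
solutions have finite H¹ norm; so it is zero. -/
theorem wronskian_eq_zero (hs₁ : IsRadialLinear n q g₁ h₁) (hs₂ : IsRadialLinear n q g₂ h₂)
    (ig₁ : IntegrableOn (fun r : ℝ => r ^ n * ‖g₁ r‖ ^ 2) (Set.Ioi 0))
    (ih₁ : IntegrableOn (fun r : ℝ => r ^ n * ‖h₁ r‖ ^ 2) (Set.Ioi 0))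
    (ig₂ : IntegrableOn (fun r : ℝ => r ^ n * ‖g₂ r‖ ^ 2) (Set.Ioi 0))
    (ih₂ : IntegrableOn (fun r : ℝ => r ^ n * ‖h₂ r‖ ^ 2) (Set.Ioi 0)) :
    g₁ 1 * h₂ 1 = g₂ 1 * h₁ 1 := by
  set W : ℝ → ℂ := fun r => g₁ r * (r ^ n • h₂ r) - g₂ r * (r ^ n • h₁ r)
  have hW : ∀ r, 0 < r → HasDerivAt W 0 r := by
    intro r hr
    have h1 := ((hs₁.deriv_fst r hr).mul (hs₂.deriv_flux r hr)).sub
      ((hs₂.deriv_fst r hr).mul (hs₁.deriv_flux r hr))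
    refine h1.congr_deriv ?_
    simp only [Complex.real_smul]
    ring
  have hconst : ∀ r ∈ Set.Ioi (0 : ℝ), W r = W 1 := fun r hr =>
    isOpen_Ioi.is_const_of_deriv_eq_zero (𝕜 := ℝ) isPreconnected_Ioi
      (fun t ht => (hW t ht).differentiableAt.differentiableWithinAt)
      (fun t ht => (hW t ht).deriv) hr (Set.mem_Ioi.2 one_pos)
  have hint : IntegrableOn (fun _ : ℝ => W 1) (Set.Ioi 0) := by
    refine Integrable.mono' ((ig₁.add ih₁).add (ig₂.add ih₂)) aestronglyMeasurable_const ?_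
    filter_upwards [ae_restrict_mem measurableSet_Ioi] with r hr
    rw [← hconst r hr]
    have hr' : 0 < r ^ n := pow_pos hr n
    refine (norm_sub_le _ _).trans ?_
    simp only [norm_mul, norm_smul, Real.norm_of_nonneg hr'.le, Pi.add_apply]
    nlinarith [mul_nonneg hr'.le (sq_nonneg (‖g₁ r‖ - ‖h₂ r‖)),
      mul_nonneg hr'.le (sq_nonneg (‖g₂ r‖ - ‖h₁ r‖)), mul_nonneg hr'.le (sq_nonneg ‖g₁ r‖),
      mul_nonneg hr'.le (sq_nonneg ‖g₂ r‖), mul_nonneg hr'.le (sq_nonneg ‖h₁ r‖),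
      mul_nonneg hr'.le (sq_nonneg ‖h₂ r‖)]
  rw [integrableOn_const_iff] at hint
  have h0 : W 1 = 0 := by simpa using hint
  simp only [W, one_pow, one_smul] at h0
  exact sub_eq_zero.1 h0

end Wronskian

section Embedded

variable {n : ℕ} {q v : ℝ → ℝ} {y k : ℝ → ℝ}

/-- Square integrable solutions of `y'' + (n/r) y' = -(κ² + v) y` with `v` integrable at infinity
have zero Cauchy data. -/
theorem initial_eq_zero {κ : ℝ} (hκ : 0 < κ) (hs : IsRadialLinear n (fun r => -κ ^ 2 - v r) y k)
    (hvc : ContinuousOn v (Set.Ioi 0)) (hv : IntegrableOn v (Set.Ioi 1))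
    (iy : IntegrableOn (fun r : ℝ => r ^ n * y r ^ 2) (Set.Ioi 0))
    (ik : IntegrableOn (fun r : ℝ => r ^ n * k r ^ 2) (Set.Ioi 0)) : y 1 = 0 ∧ k 1 = 0 := by
  -- Liouville substitution u = r^m y: then u' = r^m H, u'' = (-κ² + Q)u and E = u'² + κ²u². Hence
  -- E' = 2Quu', bounded by (|Q|/κ)E, with Q integrable at infinity.
  set m : ℝ := n / 2 with hm
  have hyc : ContinuousOn y (Set.Ioi 0) := fun r hr =>
    (hs.deriv_fst r hr).continuousAt.continuousWithinAt
  have hk' : ∀ r, 0 < r → HasDerivAt k ((-κ ^ 2 - v r) * y r - n / r * k r) r := by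
    intro r hr
    have hr0 := hr.ne'
    have h1 := ((hasDerivAt_pow n r).fun_inv (pow_ne_zero n hr0)).fun_mul (hs.deriv_flux r hr)
    refine (h1.congr_deriv ?_).congr_of_eventuallyEq ?_
    · have hp : r ^ n ≠ 0 := pow_ne_zero n hr0
      have h2 : (n : ℝ) * r ^ (n - 1) = n / r * r ^ n := by
        rcases n with _ | j
        · simp
        · rw [Nat.add_sub_cancel, pow_succ]
          field_simp
      rw [h2]
      simp only [smul_eq_mul]
      field_simp
      ring
    · filter_upwards [Ioi_mem_nhds hr] with s hs'
      simp only [smul_eq_mul]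
      rw [inv_mul_cancel_left₀ (pow_pos hs' n).ne']
  have hkc : ContinuousOn k (Set.Ioi 0) := fun r hr =>
    (hk' r hr).continuousAt.continuousWithinAt
  set H : ℝ → ℝ := fun r => k r + m / r * y r
  set Q : ℝ → ℝ := fun r => -v r + (m ^ 2 - m) / r ^ 2
  set E : ℝ → ℝ := fun r => r ^ n * (H r ^ 2 + κ ^ 2 * y r ^ 2)
  have hE0 : ∀ r, 0 < r → 0 ≤ E r := fun r hr => by positivity
  have hE : ∀ r, 0 < r → HasDerivAt E (2 * r ^ n * H r * y r * Q r) r := by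
    intro r hr
    have hr0 := hr.ne'
    have hH : HasDerivAt H ((-κ ^ 2 - v r) * y r - n / r * k r +
        (m * (-(r ^ 2)⁻¹) * y r + m / r * k r)) r := by
      have h1 : HasDerivAt (fun r => m / r) (m * (-(r ^ 2)⁻¹)) r := by
        simpa only [div_eq_mul_inv] using (hasDerivAt_inv hr0).const_mul m
      exact (hk' r hr).add (h1.mul (hs.deriv_fst r hr))
    have h1 := (hasDerivAt_pow n r).mul ((hH.fun_pow 2).fun_add
      (((hs.deriv_fst r hr).fun_pow 2).const_mul (κ ^ 2)))
    refine h1.congr_deriv ?_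
    have h2 : (n : ℝ) * r ^ (n - 1) = 2 * m / r * r ^ n := by
      rw [hm]
      rcases n with _ | j
      · simp
      · rw [Nat.add_sub_cancel, pow_succ]
        field_simp
    have h3 : (n : ℝ) = 2 * m := by rw [hm]; ring
    rw [h2, h3]
    simp only [H, Q, Nat.add_one_sub_one, pow_one, Nat.cast_ofNat]
    generalize r ^ n = ρ
    field_simp
    ring
  have hEle : ∀ r, 0 < r → |2 * r ^ n * H r * y r * Q r| ≤ |Q r| / κ * E r := by
    intro r hr
    have hrn : 0 < r ^ n := pow_pos hr n
    have h1 : 2 * |H r * y r| ≤ (H r ^ 2 + κ ^ 2 * y r ^ 2) / κ := by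
      rw [le_div_iff₀ hκ, abs_mul]
      have := sq_nonneg (|H r| - κ * |y r|)
      rw [sub_sq, mul_pow, sq_abs, sq_abs] at this
      linarith
    have h2 : 2 * r ^ n * H r * y r * Q r = r ^ n * (2 * (H r * y r)) * Q r := by ring
    rw [h2, abs_mul, abs_mul, abs_mul, abs_of_pos hrn, abs_two]
    calc r ^ n * (2 * |H r * y r|) * |Q r|
        ≤ r ^ n * ((H r ^ 2 + κ ^ 2 * y r ^ 2) / κ) * |Q r| := by gcongr
      _ = |Q r| / κ * E r := by simp only [E]; ring
  have hQc : ContinuousOn Q (Set.Ioi 0) :=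
    hvc.neg.add (continuousOn_const.div (continuous_pow 2).continuousOn
      fun r (hr : 0 < r) => (pow_pos hr 2).ne')
  have hQi : IntegrableOn (fun r => |Q r| / κ) (Set.Ioi 1) := by
    have h1 : IntegrableOn (fun r : ℝ => (m ^ 2 - m) * r ^ (-2 : ℝ)) (Set.Ioi 1) :=
      (integrableOn_Ioi_rpow_of_lt (by norm_num) one_pos).const_mul _
    have h2 : IntegrableOn Q (Set.Ioi 1) := by
      refine (hv.neg.add h1).congr_fun (fun r hr => ?_) measurableSet_Ioi
      have hr0 : (0 : ℝ) < r := lt_trans one_pos hr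
      simp only [Pi.add_apply, Pi.neg_apply, Q]
      rw [Real.rpow_neg hr0.le, Real.rpow_two, div_eq_mul_inv]
    exact h2.abs.div_const κ
  have hQκc : ContinuousOn (fun r => |Q r| / κ) (Set.Ioi 0) := hQc.abs.div_const κ
  set P : ℝ → ℝ := fun r => ∫ s in (1 : ℝ)..r, |Q s| / κ
  have hP : ∀ r, 0 < r → HasDerivAt P (|Q r| / κ) r := fun r hr =>
    hasDerivAt_of_forall_sub_eq_integral (h := fun r => |Q r| / κ)
      (fun a b ha hb => intervalIntegral.integral_interval_sub_left
        ((LocIntPos.of_continuousOn hQκc).intervalIntegrable one_pos hb)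
        ((LocIntPos.of_continuousOn hQκc).intervalIntegrable one_pos ha)) hQκc hr
  set I := ∫ s in Set.Ioi (1 : ℝ), |Q s| / κ
  have hPI : ∀ r, 1 ≤ r → P r ≤ I := by
    intro r hr
    simp only [P]
    rw [intervalIntegral.integral_of_le hr]
    refine setIntegral_mono_set hQi (Eventually.of_forall fun s => ?_)
      (LE.le.eventuallyLE Set.Ioc_subset_Ioi_self)
    show 0 ≤ |Q s| / κ
    positivity
  -- Grönwall's argument gives E ≥ E(1)e^{-I} on [1,∞); since E is integrable there, E(1) = 0.
  have hmono : MonotoneOn (fun r => E r * Real.exp (P r)) (Set.Ici 1) := by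
    refine monotoneOn_of_hasDerivAt_nonneg (convex_Ici 1) (fun r (hr : 1 ≤ r) =>
      (hE r (by linarith)).mul (hP r (by linarith)).exp) fun r (hr : 1 ≤ r) => ?_
    have h1 := neg_abs_le (2 * r ^ n * H r * y r * Q r)
    have h2 := hEle r (by linarith)
    have h3 := Real.exp_pos (P r)
    have h4 : 0 ≤ (2 * r ^ n * H r * y r * Q r + |Q r| / κ * E r) * Real.exp (P r) := by
      refine mul_nonneg (by linarith) h3.le
    linarith
  have hlow : ∀ r, 1 ≤ r → E 1 * Real.exp (-I) ≤ E r := by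
    intro r hr
    have h1 : E 1 * Real.exp (P 1) ≤ E r * Real.exp (P r) := hmono Set.self_mem_Ici hr hr
    have hP1 : P 1 = 0 := by simp [P]
    rw [hP1, Real.exp_zero, mul_one] at h1
    have hEr := hE0 r (by linarith)
    calc E 1 * Real.exp (-I) ≤ E r * Real.exp (P r) * Real.exp (-I) := by gcongr
      _ = E r * Real.exp (P r - I) := by rw [mul_assoc, ← Real.exp_add, sub_eq_add_neg]
      _ ≤ E r * 1 := by
          gcongr
          rw [Real.exp_le_one_iff]
          linarith [hPI r hr]
      _ = E r := mul_one _
  have hEi : IntegrableOn (fun _ : ℝ => E 1 * Real.exp (-I)) (Set.Ioi 1) := by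
    have hdom : IntegrableOn (fun r : ℝ => 2 * (r ^ n * k r ^ 2) +
        (2 * m ^ 2 + κ ^ 2) * (r ^ n * y r ^ 2)) (Set.Ioi 1) :=
      IntegrableOn.mono_set ((ik.const_mul 2).add (iy.const_mul _))
        (Set.Ioi_subset_Ioi zero_le_one)
    refine Integrable.mono' hdom aestronglyMeasurable_const ?_
    filter_upwards [ae_restrict_mem measurableSet_Ioi] with r hr
    have hr1 : (1 : ℝ) ≤ r := le_of_lt hr
    have hr0 : 0 < r := by linarith
    have hE1 := hE0 1 one_pos
    rw [Real.norm_of_nonneg (by positivity)]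
    refine (hlow r hr1).trans ?_
    have hrn : 0 < r ^ n := pow_pos hr0 n
    have h1 : H r ^ 2 ≤ 2 * k r ^ 2 + 2 * m ^ 2 * y r ^ 2 := by
      have h2 : (m / r * y r) ^ 2 ≤ m ^ 2 * y r ^ 2 := by
        rw [mul_pow, div_pow]
        gcongr
        exact div_le_self (sq_nonneg m) (one_le_pow₀ hr1)
      simp only [H]
      nlinarith [sq_nonneg (k r - m / r * y r)]
    calc E r = r ^ n * (H r ^ 2 + κ ^ 2 * y r ^ 2) := rfl
      _ ≤ r ^ n * (2 * k r ^ 2 + 2 * m ^ 2 * y r ^ 2 + κ ^ 2 * y r ^ 2) := by gcongr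
      _ = _ := by ring
  rw [integrableOn_const_iff] at hEi
  have h0 : E 1 = 0 := by simpa [Real.exp_ne_zero] using hEi
  have h1 : H 1 ^ 2 + κ ^ 2 * y 1 ^ 2 = 0 := by simpa only [E, one_pow, one_mul] using h0
  have hy1 : y 1 = 0 := by
    have h2 : κ ^ 2 * y 1 ^ 2 = 0 := le_antisymm (by nlinarith [sq_nonneg (H 1)]) (by positivity)
    simpa [hκ.ne'] using h2
  refine ⟨hy1, ?_⟩
  rw [hy1] at h1
  simpa [H, hy1] using h1

end Embedded

end IsRadialLinear

namespace KleinGordon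

variable {d : ℕ} [NeZero d]

/-! ### The Schrödinger operator with a radial potential -/

section Schrodinger

/-- Nothing is known about v outside (0,∞); cutting it off there gives a measurable function and
changes v(|x|) only on the null set {0}. -/
theorem memLp_radial {v : ℝ → ℝ} (hvc : ContinuousOn v (Set.Ioi 0)) {M : ℝ}
    (hM : ∀ r, 0 < r → |v r| ≤ M) : MemLp (fun x : Space d => (v ‖x‖ : ℂ)) ∞ volume := by
  have hmeas : Measurable ((Set.Ioi (0 : ℝ)).indicator v) := by
    have := hvc.measurable_piecewise (continuousOn_const (c := (0 : ℝ)) (s := (Set.Ioi (0 : ℝ))ᶜ))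
      measurableSet_Ioi
    rwa [show (Set.Ioi (0 : ℝ)).piecewise v (fun _ => 0) = (Set.Ioi (0 : ℝ)).indicator v from
      Set.piecewise_eq_indicator] at this
  have h1 : MemLp (fun x : Space d => (((Set.Ioi (0 : ℝ)).indicator v ‖x‖ : ℝ) : ℂ)) ∞ volume := by
    refine memLp_top_of_continuous_bound
      (Complex.measurable_ofReal.comp (hmeas.comp measurable_norm)) M fun x => ?_
    rw [Complex.norm_real]
    by_cases hx : 0 < ‖x‖
    · rw [Set.indicator_of_mem (Set.mem_Ioi.2 hx)]
      exact hM _ hx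
    · have hx' : ‖x‖ ∉ Set.Ioi (0 : ℝ) := hx
      rw [Set.indicator_of_notMem hx', norm_zero]
      exact (abs_nonneg _).trans (hM 1 one_pos)
  refine (memLp_congr_ae ?_).1 h1
  refine (ae_norm_iff (d := d) (P := fun r =>
    (((Set.Ioi (0 : ℝ)).indicator v r : ℝ) : ℂ) = (v r : ℂ))).2 ?_
  filter_upwards [ae_restrict_mem measurableSet_Ioi] with r hr
  rw [Set.indicator_of_mem hr]

variable {v : ℝ → ℝ}

theorem schrodinger_graph_iff (hv : MemLp (fun x : Space d => (v ‖x‖ : ℂ)) ∞ volume)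
    {V : Space d → ℝ} (hV : V =ᵐ[volume] fun x => v ‖x‖) (u w : L2rad d) :
    (u, w) ∈ (schrodinger V).graph ↔
      ∃ f, u = freeRes d f ∧ w = f - radMul d (fun r => (v r : ℂ)) (freeRes d f) := by
  have hq : ∀ u : L2rad d, ((radMul d (fun r => (v r : ℂ)) u : L2 d) : Space d → ℂ) =ᵐ[volume]
      fun x => (V x : ℂ) * (u : L2 d) x := by
    intro u
    filter_upwards [coeFn_radMul (g := fun r => (v r : ℂ)) hv u, hV] with x h1 h2
    rw [h1, h2]
  rw [schrodinger_graph]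
  constructor
  · rintro ⟨hu, q, hqu, h⟩
    obtain ⟨f, rfl⟩ := exists_freeRes_eq hu
    refine ⟨f, rfl, ?_⟩
    have h1 : q = (radMul d (fun r => (v r : ℂ)) (freeRes d f) : L2 d) :=
      Lp.ext (EventuallyEq.trans hqu (hq _).symm)
    have h2 : toDist (w : L2 d) = -Δ (toDist (freeRes d f : L2 d)) + toDist (freeRes d f : L2 d) -
      toDist q := h
    rw [← freeRes_equation, ← map_sub, h1] at h2
    exact Subtype.ext (toDist_injective h2)
  · rintro ⟨f, rfl, rfl⟩
    refine ⟨freeRes_mem_H2rad f, _, hq _, ?_⟩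
    show toDist ((f : L2 d) - (radMul d (fun r => (v r : ℂ)) (freeRes d f) : L2 d)) = _
    rw [map_sub, ← freeRes_equation]

theorem schrodinger_domain (hv : MemLp (fun x : Space d => (v ‖x‖ : ℂ)) ∞ volume)
    {V : Space d → ℝ} (hV : V =ᵐ[volume] fun x => v ‖x‖) : (schrodinger V).domain = H2rad d := by
  ext u
  rw [LinearPMap.mem_domain_iff]
  simp_rw [schrodinger_graph_iff hv hV]
  constructor
  · rintro ⟨w, f, rfl, -⟩
    exact freeRes_mem_H2rad f
  · intro hu
    obtain ⟨f, rfl⟩ := exists_freeRes_eq hu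
    exact ⟨_, f, rfl, rfl⟩

theorem mem_dampedOp_domain_iff (hv : MemLp (fun x : Space d => (v ‖x‖ : ℂ)) ∞ volume)
    {V : Space d → ℝ} (hV : V =ᵐ[volume] fun x => v ‖x‖) (α : ℝ) (u : Hrad d) :
    u ∈ (dampedOp α V).domain ↔
      incl d u.1 ∈ H2rad d ∧ u.2 ∈ LinearMap.range (incl d) := by
  rw [LinearPMap.mem_domain_iff, ← schrodinger_domain hv hV]
  simp_rw [LinearPMap.mem_domain_iff (f := schrodinger V), dampedOp_graph]
  constructor
  · rintro ⟨w, h1, h2⟩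
    exact ⟨⟨_, h2⟩, w.1, h1.symm⟩
  · rintro ⟨⟨w, hw⟩, p, hp⟩
    refine ⟨(p, -w - (2 * α : ℂ) • u.2), hp.symm, ?_⟩
    simpa using hw

theorem isPerturbedInverse_schrodinger (hvc : ContinuousOn v (Set.Ioi 0)) {M : ℝ}
    (hM : ∀ r, 0 < r → |v r| ≤ M) (hv0 : Tendsto v atTop (𝓝 0)) {V : Space d → ℝ}
    (hV : V =ᵐ[volume] fun x => v ‖x‖) :
    IsPerturbedInverse (schrodinger V) (freeRes d) (radMul d fun r => (v r : ℂ)) where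
  graph := schrodinger_graph_iff (memLp_radial hvc hM) hV
  symm_S := inner_freeRes
  symm_V f g := inner_mulOp (memLp_radial hvc hM)
    (Eventually.of_forall fun _ => Complex.ofReal_im _) _ _
  inj := freeRes_injective
  compact := by
    refine isCompactOperator_radMul_comp_freeRes (memLp_radial hvc hM) (M := M)
      (fun r hr => ?_) ?_
    · rw [Complex.norm_real]
      exact hM r hr
    · have := (Complex.continuous_ofReal.tendsto 0).comp hv0
      rwa [Complex.ofReal_zero] at this
  isUnit _ := isUnit_one_sub_freeRes
  not_isUnit _ := not_isUnit_one_sub_freeRes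
  inj_ray w _ := one_sub_freeRes_injective w

theorem isDamped_dampedOp (α : ℝ) {V : Space d → ℝ}
    (h : IsPerturbedInverse (schrodinger V) (freeRes d) (radMul d fun r => (v r : ℂ))) :
    IsDamped (dampedOp α V) (schrodinger V) (freeRes d) (radMul d fun r => (v r : ℂ))
      (inclCLM d) α where
  pert := h
  inj_i := incl_injective d
  range_i f := exists_incl_eq (freeRes_mem_H2rad f)
  graph u w := by
    rw [dampedOp_graph]
    rfl

/-- The radial profile of an eigenfunction. -/
theorem exists_eigen_profile (hvc : ContinuousOn v (Set.Ioi 0)) {M : ℝ}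
    (hM : ∀ r, 0 < r → |v r| ≤ M) {μ : ℝ} {f : L2rad d}
    (hf : f = (μ : ℂ) • freeRes d f + radMul d (fun r => (v r : ℂ)) (freeRes d f)) :
    ∃ g k : ℝ → ℂ, ((freeRes d f : L2 d) : Space d → ℂ) =ᵐ[volume] (fun x => g ‖x‖) ∧
      IsRadialLinear (d - 1) (fun r => 1 - μ - v r) g k ∧
      IntegrableOn (fun r : ℝ => r ^ (d - 1) * ‖g r‖ ^ 2) (Set.Ioi 0) ∧
      IntegrableOn (fun r : ℝ => r ^ (d - 1) * ‖k r‖ ^ 2) (Set.Ioi 0) := by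
  have hv := memLp_radial (d := d) hvc hM
  obtain ⟨p, hpf⟩ := exists_incl_eq (freeRes_mem_H2rad f)
  have hpf' : p.1.fst = (freeRes d f : L2 d) := congrArg Subtype.val hpf
  obtain ⟨g, h, hp⟩ := exists_profile p
  have hWc : ContinuousOn (fun r => (1 - μ - v r) • g r) (Set.Ioi 0) :=
    (continuousOn_const.sub hvc).smul hp.continuousOn
  obtain ⟨k, hpk, hk1, hk2⟩ := hp.exists_classical hWc fun χ hχ => by
    -- For u = Sf one has f = -Δu + u, so the eigenvalue equation reads Δu = u - f = (1 - μ - v)u.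
    have h1 : Δ (toDist p.1.fst) = toDist ((freeRes d f : L2 d) - (f : L2 d)) := by
      rw [hpf', map_sub, freeRes_equation f]
      abel
    have h2 : (f : L2 d) = (μ : ℂ) • (freeRes d f : L2 d) +
        (radMul d (fun r => (v r : ℂ)) (freeRes d f) : L2 d) := congrArg Subtype.val hf
    rw [h1, toDist_apply]
    refine integral_congr_ae ?_
    filter_upwards [Lp.coeFn_sub (freeRes d f : L2 d) (f : L2 d),
      Lp.coeFn_add ((μ : ℂ) • (freeRes d f : L2 d))
        (radMul d (fun r => (v r : ℂ)) (freeRes d f) : L2 d),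
      Lp.coeFn_smul (μ : ℂ) (freeRes d f : L2 d), coeFn_radMul (g := fun r => (v r : ℂ)) hv (freeRes d f), hp.eq_fst]
      with x e1 e2 e3 e4 e5
    rw [hpf'] at e5
    rw [← h2] at e2
    rw [radTest_apply, e1, Pi.sub_apply, e2, Pi.add_apply, e3, Pi.smul_apply, e4, e5,
      Complex.real_smul, smul_eq_mul]
    push_cast
    ring
  refine ⟨g, k, hpf' ▸ hp.eq_fst, ⟨hk1, hk2⟩, hp.integrableOn_fst, hpk.integrableOn_deriv⟩

theorem pencil_eq_zero_iff {S V : L2rad d →L[ℂ] L2rad d} {z : ℂ} {f : L2rad d} :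
    pencil S V z f = 0 ↔ f = z • S f + V (S f) := by
  rw [pencil_apply]
  constructor <;> intro h
  · rw [sub_sub, sub_eq_zero, add_comm] at h
    rwa [add_comm] at h
  · rw [sub_sub, ← h, sub_self]

theorem eq_zero_of_profile {u : L2rad d} {g : ℝ → ℂ}
    (hu : ((u : L2 d) : Space d → ℂ) =ᵐ[volume] fun x => g ‖x‖) (hg : ∀ r, 0 < r → g r = 0) :
    u = 0 := by
  refine Subtype.ext (Lp.ext ?_)
  have h1 : ∀ᵐ x : Space d, g ‖x‖ = 0 := by
    refine (ae_norm_iff (P := fun r => g r = 0)).2 ?_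
    filter_upwards [ae_restrict_mem measurableSet_Ioi] with r hr using hg r hr
  show ((u : L2 d) : Space d → ℂ) =ᵐ[volume] ((0 : L2 d) : Space d → ℂ)
  filter_upwards [hu, h1, Lp.coeFn_zero ℂ 2 (volume : Measure (Space d))] with x e1 e2 e3
  rw [e1, e2, e3, Pi.zero_apply]

variable {V : Space d → ℝ}

/-- There are no eigenvalues above the bottom of the essential spectrum. -/
theorem not_mem_pointSpectrum_of_one_lt (hvc : ContinuousOn v (Set.Ioi 0)) {M : ℝ}
    (hM : ∀ r, 0 < r → |v r| ≤ M) (hvi : IntegrableOn v (Set.Ioi 1))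
    (h : IsPerturbedInverse (schrodinger V) (freeRes d) (radMul d fun r => (v r : ℂ))) {μ : ℝ}
    (hμ : 1 < μ) : (μ : ℂ) ∉ (schrodinger V).pointSpectrum := by
  rw [h.mem_pointSpectrum_iff]
  rintro ⟨f, hf0, hf⟩
  rw [pencil_eq_zero_iff] at hf
  obtain ⟨g, k, hg, hlin, ig, ik⟩ := exists_eigen_profile hvc hM hf
  -- For μ > 1 the equation oscillates at infinity with frequency κ = √(μ - 1) > 0; real and
  -- imaginary parts are treated separately.
  have hκ : 0 < Real.sqrt (μ - 1) := Real.sqrt_pos.2 (by linarith)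
  have hq : (fun r => 1 - μ - v r) = fun r => -Real.sqrt (μ - 1) ^ 2 - v r := by
    funext r
    rw [Real.sq_sqrt (by linarith)]
    ring
  have key : ∀ T : ℂ →L[ℝ] ℝ, (∀ z, |T z| ≤ ‖z‖) → T (g 1) = 0 ∧ T (k 1) = 0 := by
    intro T hT
    have hTlin := hlin.comp_clm T
    have hTsq : ∀ z, T z ^ 2 ≤ ‖z‖ ^ 2 := fun z => by
      rw [← sq_abs (T z)]
      gcongr
      exact hT z
    have hdom : ∀ {a : ℝ → ℂ}, ContinuousOn (fun r => T (a r)) (Set.Ioi 0) →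
        IntegrableOn (fun r : ℝ => r ^ (d - 1) * ‖a r‖ ^ 2) (Set.Ioi 0) →
        IntegrableOn (fun r : ℝ => r ^ (d - 1) * T (a r) ^ 2) (Set.Ioi 0) := by
      intro a ha hi
      refine Integrable.mono' hi
        (((continuous_pow _).continuousOn.mul (ha.pow 2)).aestronglyMeasurable
          measurableSet_Ioi) ?_
      filter_upwards [ae_restrict_mem measurableSet_Ioi] with r hr
      have hr' : 0 < r ^ (d - 1) := pow_pos hr _
      rw [Real.norm_of_nonneg (by positivity)]
      gcongr r ^ (d - 1) * ?_
      exact hTsq _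
    have hgc : ContinuousOn (fun r => T (g r)) (Set.Ioi 0) := fun r hr =>
      (hTlin.deriv_fst r hr).continuousAt.continuousWithinAt
    have hkc : ContinuousOn (fun r => T (k r)) (Set.Ioi 0) := by
      have h1 : ContinuousOn (fun r : ℝ => (r ^ (d - 1))⁻¹ * (r ^ (d - 1) • T (k r)))
          (Set.Ioi 0) :=
        ((continuous_pow _).continuousOn.inv₀ fun r hr => (pow_pos hr _).ne').mul
          fun r (hr : 0 < r) => (hTlin.deriv_flux r hr).continuousAt.continuousWithinAt
      exact h1.congr fun r hr => (inv_mul_cancel_left₀ (pow_pos hr _).ne' _).symm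
    rw [hq] at hTlin
    exact hTlin.initial_eq_zero hκ hvc hvi (hdom hgc ig) (hdom hkc ik)
  have hre := key Complex.reCLM Complex.abs_re_le_norm
  have him := key Complex.imCLM Complex.abs_im_le_norm
  have hu : freeRes d f = 0 := eq_zero_of_profile hg fun r hr =>
    hlin.eq_zero_of_initial (continuousOn_const.sub hvc) (Complex.ext hre.1 him.1)
      (Complex.ext hre.2 him.2) hr
  exact hf0 (freeRes_injective f hu)

/-- The vanishing Wronskian makes the Cauchy data at r = 1 of two eigenfunctions proportional, and
uniqueness for the ODE carries this over to the eigenfunctions. -/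
theorem finrank_eigenspace_eq_one (hvc : ContinuousOn v (Set.Ioi 0)) {M : ℝ}
    (hM : ∀ r, 0 < r → |v r| ≤ M)
    (h : IsPerturbedInverse (schrodinger V) (freeRes d) (radMul d fun r => (v r : ℂ))) {μ : ℝ}
    (hμ : (μ : ℂ) ∈ (schrodinger V).pointSpectrum) :
    Module.finrank ℂ ((schrodinger V).eigenspace μ) = 1 := by
  have hprof : ∀ u ∈ (schrodinger V).eigenspace μ, ∃ g k : ℝ → ℂ,
      ((u : L2 d) : Space d → ℂ) =ᵐ[volume] (fun x => g ‖x‖) ∧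
      IsRadialLinear (d - 1) (fun r => 1 - μ - v r) g k ∧
      IntegrableOn (fun r : ℝ => r ^ (d - 1) * ‖g r‖ ^ 2) (Set.Ioi 0) ∧
      IntegrableOn (fun r : ℝ => r ^ (d - 1) * ‖k r‖ ^ 2) (Set.Ioi 0) := by
    intro u hu
    obtain ⟨f, rfl, hf⟩ := (h.mem_eigenspace_iff _ _).1 hu
    exact exists_eigen_profile hvc hM (pencil_eq_zero_iff.1 hf)
  have hqc : ContinuousOn (fun r => 1 - μ - v r) (Set.Ioi 0) := continuousOn_const.sub hvc
  obtain ⟨u₁, hu₁, hne⟩ := (Submodule.ne_bot_iff _).1 hμ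
  obtain ⟨g₁, k₁, hg₁, hl₁, ig₁, ik₁⟩ := hprof u₁ hu₁
  refine (finrank_eq_one_iff_of_nonzero' (⟨u₁, hu₁⟩ : (schrodinger V).eigenspace μ)
    (fun h0 => hne (congrArg Subtype.val h0))).2 ?_
  rintro ⟨u₂, hu₂⟩
  obtain ⟨g₂, k₂, hg₂, hl₂, ig₂, ik₂⟩ := hprof u₂ hu₂
  have hW := hl₁.wronskian_eq_zero hl₂ ig₁ ik₁ ig₂ ik₂
  obtain ⟨c, hc1, hc2⟩ : ∃ c : ℂ, g₂ 1 = c * g₁ 1 ∧ k₂ 1 = c * k₁ 1 := by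
    by_cases h1 : g₁ 1 = 0
    · have h2 : k₁ 1 ≠ 0 := fun h2 =>
        hne (eq_zero_of_profile hg₁ fun r hr => hl₁.eq_zero_of_initial hqc h1 h2 hr)
      rw [h1, zero_mul] at hW
      have h3 : g₂ 1 = 0 := (mul_eq_zero.1 hW.symm).resolve_right h2
      exact ⟨k₂ 1 / k₁ 1, by rw [h1, h3, mul_zero], by field_simp⟩
    · refine ⟨g₂ 1 / g₁ 1, by field_simp, ?_⟩
      field_simp
      linear_combination hW
  have hl := hl₂.sub_smul hl₁ c
  have hdiff : u₂ - c • u₁ = 0 := by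
    refine eq_zero_of_profile (g := fun r => g₂ r - c • g₁ r) ?_ fun r hr =>
      hl.eq_zero_of_initial hqc (by simp [hc1]) (by simp [hc2]) hr
    show ((((u₂ : L2 d) - c • (u₁ : L2 d) : L2 d)) : Space d → ℂ) =ᵐ[volume] _
    filter_upwards [Lp.coeFn_sub (u₂ : L2 d) (c • (u₁ : L2 d)), Lp.coeFn_smul c (u₁ : L2 d),
      hg₁, hg₂] with x e1 e2 e3 e4
    rw [e1, Pi.sub_apply, e2, Pi.smul_apply, e3, e4]
  exact ⟨c, Subtype.ext (sub_eq_zero.1 hdiff).symm⟩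

end Schrodinger

end KleinGordon

end

/-! ### Assembly of the theorem -/

theorem lemma2p10 (α : ℝ) (hα : 0 < α) :
    ∃ δ : ℝ, 0 < δ ∧
    ∀ (d : ℕ) (_ : 1 ≤ d) (_ : d ≤ 6)
      (f : ℝ → ℝ) (_ : ContDiff ℝ 1 f) (_ : ∀ y, f (-y) = -f y) (_ : deriv f 0 = 0)
      (_ : KleinGordon.GrowthCondition d f)
      (φ : KleinGordon.Space d → ℝ) (_ : KleinGordon.IsRadialEquilibrium f φ)
      (L : KleinGordon.L2rad d →ₗ.[ℂ] KleinGordon.L2rad d)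
      (_ : L = KleinGordon.schrodinger (fun x => deriv f (φ x)))
      (A : KleinGordon.Hrad d →ₗ.[ℂ] KleinGordon.Hrad d)
      (_ : A = KleinGordon.dampedOp α (fun x => deriv f (φ x))),
      -- the operators are defined on the full Sobolev domains
      L.domain = KleinGordon.H2rad d ∧
      (∀ u : KleinGordon.Hrad d, u ∈ A.domain ↔
        KleinGordon.incl d u.1 ∈ KleinGordon.H2rad d ∧
          u.2 ∈ LinearMap.range (KleinGordon.incl d)) ∧
      -- discrete spectrum
      (A.discSpectrum.Nonempty ↔ L.discSpectrum.Nonempty) ∧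
      (∀ z : ℂ, z ∈ A.discSpectrum ↔ -(z ^ 2 + 2 * α * z) ∈ L.discSpectrum) ∧
      -- the essential spectrum lies strictly to the left of the imaginary axis
      (∀ z ∈ A.essSpectrum, z.re < -δ) ∧
      -- the spectrum on the imaginary axis
      (A.opSpectrum ∩ {z : ℂ | z.re = 0} = ∅ ∨ A.opSpectrum ∩ {z : ℂ | z.re = 0} = {0}) ∧
      (A.opSpectrum ∩ {z : ℂ | z.re = 0} = {0} ↔ (0 : ℂ) ∈ A.pointSpectrum) ∧
      (A.opSpectrum ∩ {z : ℂ | z.re = 0} = {0} ↔ (0 : ℂ) ∈ L.pointSpectrum) ∧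
      ((0 : ℂ) ∈ L.pointSpectrum →
        Module.finrank ℂ (L.eigenspace 0) = 1 ∧
          L.IsSimpleEigenvalue 0 ∧ A.IsSimpleEigenvalue 0) ∧
      -- the eigenvalues
      (∀ z : ℂ, z ∈ A.pointSpectrum ↔ ∃ μ : ℝ, (μ : ℂ) ∈ L.pointSpectrum ∧
        (z = -α + ((α : ℂ) ^ 2 - μ) ^ (1 / 2 : ℂ) ∨
          z = -α - ((α : ℂ) ^ 2 - μ) ^ (1 / 2 : ℂ))) ∧
      (1 ≤ α → ∀ z ∈ A.discSpectrum ∪ A.pointSpectrum, z.im = 0) ∧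
      (α < 1 → ∀ z ∈ A.discSpectrum ∪ A.pointSpectrum, z.im = 0 ∨
        (z.re = -α ∧ ∃ μ : ℝ, 0 < μ ∧ μ ≤ 1 ∧ (μ : ℂ) ∈ L.pointSpectrum ∧
          (z = -α + ((α : ℂ) ^ 2 - μ) ^ (1 / 2 : ℂ) ∨
            z = -α - ((α : ℂ) ^ 2 - μ) ^ (1 / 2 : ℂ)))) ∧
      -- the essential spectrum
      (∀ z : ℂ, z ∈ A.essSpectrum ↔ -(z ^ 2 + 2 * α * z) ∈ L.essSpectrum) ∧
      (α ≤ 1 → A.essSpectrum = {z : ℂ | z.re = -α ∧ Real.sqrt (1 - α ^ 2) ≤ |z.im|}) ∧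
      (1 < α → A.essSpectrum = {z : ℂ | z.re = -α} ∪
        {z : ℂ | z.im = 0 ∧ z.re ∈ Set.Icc (-α - Real.sqrt (α ^ 2 - 1))
          (-α + Real.sqrt (α ^ 2 - 1))}) := by
  -- The gap is that of the preimage of [1,∞) under p, so it is fixed before d, f and φ and depends
  -- on α alone.
  obtain ⟨δ, hδ, hgap⟩ := exists_gap_of_pos hα
  refine ⟨δ, hδ, ?_⟩
  rintro d hd - f hf hodd hf0 hgr φ hφ L rfl A rfl
  have : NeZero d := ⟨by omega⟩
  obtain ⟨v, hV, hvc, ⟨M, hM⟩, hv0, hvi⟩ := hgr.exists_potential hf hodd hf0 hφ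
  have hP := KleinGordon.isPerturbedInverse_schrodinger hvc hM hv0 hV
  have hD := KleinGordon.isDamped_dampedOp α hP
  have hv := KleinGordon.memLp_radial (d := d) hvc hM
  have hL : ∀ μ : ℝ, 1 < μ → (μ : ℂ) ∉ (KleinGordon.schrodinger fun x => deriv f (φ x)).pointSpectrum :=
    fun μ hμ => KleinGordon.not_mem_pointSpectrum_of_one_lt hvc hM hvi hP hμ
  have hess : ∀ z, z ∈ (KleinGordon.dampedOp α fun x => deriv f (φ x)).essSpectrum ↔
      dampedSymbol α z ∈ unitRay := fun z => by
    rw [hD.mem_essSpectrum_iff, hP.essSpectrum_eq]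
  have him := hD.opSpectrum_inter_imaginary_eq_iff hα
  refine ⟨KleinGordon.schrodinger_domain hv hV, KleinGordon.mem_dampedOp_domain_iff hv hV α,
    ⟨?_, ?_⟩, hD.mem_discSpectrum_iff, fun z hz => hgap z ((hess z).1 hz),
    Set.subset_singleton_iff_eq.1 (hD.opSpectrum_inter_imaginary_subset hα), ?_, him, fun h0 => ?_,
    hD.mem_pointSpectrum_iff_exists, fun h1 z hz => ?_, fun h1 z hz => ?_, hD.mem_essSpectrum_iff,
    fun h1 => ?_, fun h1 => ?_⟩
  · rintro ⟨z, hz⟩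
    exact ⟨_, (hD.mem_discSpectrum_iff z).1 hz⟩
  · rintro ⟨μ, hμ⟩
    obtain ⟨z, rfl⟩ := exists_dampedSymbol_eq α μ
    exact ⟨z, (hD.mem_discSpectrum_iff z).2 hμ⟩
  · rw [him, hD.mem_pointSpectrum_iff]
    simp [dampedSymbol]
  · have h1 := KleinGordon.finrank_eigenspace_eq_one (μ := 0) hvc hM hP (by simpa using h0)
    rw [Complex.ofReal_zero] at h1
    exact ⟨h1, hD.isSimpleEigenvalue_zero hα h1⟩
  · rcases hD.real_or_of_mem hL hz with h2 | ⟨-, h2, -⟩ | h2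
    · exact h2
    · linarith
    · linarith
  · rcases hD.real_or_of_mem hL hz with h2 | ⟨h2, -, h3⟩ | h2
    · exact Or.inl h2
    · exact Or.inr ⟨h2, h3⟩
    · linarith
  · ext z
    rw [hess, dampedSymbol_mem_unitRay_iff_of_le h1 hα]
    rfl
  · ext z
    rw [hess, dampedSymbol_mem_unitRay_iff_of_lt h1]
    rfl
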